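/- Let $q\in(0,1)$. Let $\mathcal H$ be the Hilbert space with orthonormal basis $e^{(n)}_{ij}$, $n\in\{0,\tfrac12,1,\dots\}$, $i,j\in\{-n,-n+1,\dots,n\}$ (the $L_2$-space $L_2(h)$ of the Haar state $h$ of $SU_q(2)$, with its normalized matrix coefficients), and let $\alpha,\beta$ be the bounded operators $$\alpha e^{(n)}_{ij}=a_+(n,i,j)\,e^{(n+1/2)}_{i-1/2,\,j-1/2}+a_-(n,i,j)\,e^{(n-1/2)}_{i-1/2,\,j-1/2},\qquad \beta e^{(n)}_{ij}=b_+(n,i,j)\,e^{(n+1/2)}_{i+1/2,\,j-1/2}+b_-(n,i,j)\,e^{(n-1/2)}_{i+1/2,\,j-1/2},$$ where $$a_+=\Bigl(q^{2(n+i)+2(n+j)+2}\tfrac{(1-q^{2n-2j+2})(1-q^{2n-2i+2})}{(1-q^{4n+2})(1-q^{4n+4})}\Bigr)^{1/2},\quad a_-=\Bigl(\tfrac{(1-q^{2n+2j})(1-q^{2n+2i})}{(1-q^{4n})(1-q^{4n+2})}\Bigr)^{1/2},$$ $$b_+=-\Bigl(q^{2(n+j)}\tfrac{(1-q^{2n-2j+2})(1-q^{2n+2i+2})}{(1-q^{4n+2})(1-q^{4n+4})}\Bigr)^{1/2},\quad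 b_-=\Bigl(q^{2(n+i)}\tfrac{(1-q^{2n+2j})(1-q^{2n-2i})}{(1-q^{4n})(1-q^{4n+2})}\Bigr)^{1/2}$$ (terms with a label out of range, and $a_-,b_-$ for $n=0$, are zero). Let $\mathcal A_f$ be the $*$-algebra generated by $\alpha,\beta$ and let $\mathcal A$, the algebra of continuous functions on $SU_q(2)$, be its norm closure. Let $D$ be the self-adjoint operator $e^{(n)}_{ij}\mapsto d(n,i)e^{(n)}_{ij}$ on its maximal domain, where $d(n,i)=2n+1$ for $i\ne n$ and $d(n,n)=-(2n+1)$; let $F=\operatorname{sign}D$ and let $P_0=(1-F)/2$ be the projection onto the closed span of the $e^{(n)}_{nj}$. Then: 1. The operators satisfy the relations of $SU_q(2)$: $\alpha^*\alpha+\beta^*\beta=1$, $\alpha\alpha^*+q^2\beta\beta^*=1$, $\alpha\beta=q\beta\alpha$, $\alpha\beta^*=q\beta^*\alpha$, $\beta^*\beta=\beta\beta^*$. The triple $(\mathcal A_f,\mathcal H,D)$ is an odd spectral triple: $D$ is self-adjoint with compact resolvent, and for every $a\in\mathcal A_f$ the operator $a$ preserves the domain of $D$ and $[D,a]$ extends to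 a bounded operator. It is equivariant: on finite linear combinations of the $e^{(n)}_{ij}$, $D$ commutes with $A_0:e^{(n)}_{ij}\mapsto q^je^{(n)}_{ij}$, with $A_1:e^{(n)}_{ij}\mapsto(q^{-2n}+q^{2n+2}-q^{-2j}-q^{2j+2})^{1/2}e^{(n)}_{i,j+1}$ (which is $0$ for $j=n$), and with $A_1^*$. 2. The Chern character of $(\mathcal A_f,\mathcal H,D)$ is nontrivial. Precisely, $F=F^*$, $F^2=1$, all $[F,a]$ with $a\in\mathcal A_f$ are Hilbert–Schmidt, and the Chern character of the resulting 2-summable odd Fredholm module, i.e. the class of the functional $$\tau_1(a_0,a_1)=\tfrac{\lambda_1}{2}\operatorname{Tr}\bigl(F[F,a_0][F,a_1]\bigr),\qquad \lambda_1=\sqrt{2i}\;\Gamma(3/2),$$ in the periodic cyclic cohomology $HP^1(\mathcal A_f)$, is defined (that is, $\tau_1$ is a cocycle of the $(b,B)$-complex of finitely supported cochains) and is nonzero. 3. The pairing of $D$ with $K_1(\mathcal A)$ is nontrivial. Precisely, for every $r\in\mathbb N$ with $q^{2r}<\tfrac12$, the element $\gamma_r=(\beta^*\beta)^r(\beta-1)+1$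 of $\mathcal A_f$ is invertible in $\mathcal A$, and $P_0\gamma_rP_0$ is a Fredholm operator on $P_0\mathcal H$ of index $-1$. -/

import Mathlib

noncomputable section

namespace SUq

/-! ## Operators on `ℓ²(ι)` with respect to the standard basis -/

section L2

variable {ι : Type*}

/-- The Hilbert space `ℓ²(ι)` of square summable complex families. -/
abbrev L2 (ι : Type*) : Type _ := lp (fun _ : ι => ℂ) 2

/-- The standard orthonormal basis vectors of `ℓ²(ι)`. -/
def basisVec [DecidableEq ι] (i : ι) : L2 ι := lp.single 2 i (1 : ℂ)

theorem norm_extend_rpow (s : ι → ι) (g : ι → ℂ) (p : ℝ) (hp : 0 < p) :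
    (fun k => ‖Function.extend s g 0 k‖ ^ p) = Function.extend s (fun k => ‖g k‖ ^ p) 0 := by
  classical
  funext k
  by_cases h : ∃ a, s a = k
  · simp only [Function.extend, h, dif_pos]
  · simp [Function.extend, h, Real.zero_rpow hp.ne']

theorem wshift_aux (r s : ι → ι) (hr : Function.Injective r) (hs : Function.Injective s)
    (c : ι → ℝ) (C : ℝ) (hc : ∀ k, |c k| ≤ C) (f : L2 ι) :
    Summable (fun k => ‖Function.extend s (fun k => (c k : ℂ) * f (r k)) 0 k‖ ^ (2 : ℝ)) ∧
    ∑' k, ‖Function.extend s (fun k => (c k : ℂ) * f (r k)) 0 k‖ ^ (2 : ℝ)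
      ≤ (C * ‖f‖) ^ (2 : ℝ) := by
  have h2 : (2 : ENNReal).toReal = (2 : ℝ) := by simp
  have hp : 0 < (2 : ENNReal).toReal := by simp
  have hf := lp.hasSum_norm hp f
  rw [h2] at hf
  have hfr : Summable fun k => ‖f (r k)‖ ^ (2 : ℝ) := hf.summable.comp_injective hr
  have hle : ∀ k, ‖(c k : ℂ) * f (r k)‖ ^ (2 : ℝ) ≤ C ^ (2 : ℝ) * ‖f (r k)‖ ^ (2 : ℝ) := by
    intro k
    have hC : 0 ≤ C := (abs_nonneg _).trans (hc k)
    rw [norm_mul, Complex.norm_real, Real.norm_eq_abs,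
      Real.mul_rpow (abs_nonneg _) (norm_nonneg _)]
    gcongr
    exact hc k
  have hg : Summable fun k => ‖(c k : ℂ) * f (r k)‖ ^ (2 : ℝ) :=
    .of_nonneg_of_le (fun k => by positivity) hle (hfr.mul_left _)
  have hext : HasSum (Function.extend s (fun k => ‖(c k : ℂ) * f (r k)‖ ^ (2 : ℝ)) 0)
      (∑' k, ‖(c k : ℂ) * f (r k)‖ ^ (2 : ℝ)) := (hasSum_extend_zero hs).2 hg.hasSum
  rw [norm_extend_rpow _ _ _ two_pos]
  refine ⟨hext.summable, ?_⟩
  rw [hext.tsum_eq]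
  rcases isEmpty_or_nonempty ι with hι | ⟨⟨i₀⟩⟩
  · rw [tsum_empty, Real.rpow_two]
    positivity
  · have hC : 0 ≤ C := (abs_nonneg _).trans (hc i₀)
    calc ∑' k, ‖(c k : ℂ) * f (r k)‖ ^ (2 : ℝ)
        ≤ ∑' k, C ^ (2 : ℝ) * ‖f (r k)‖ ^ (2 : ℝ) := hg.tsum_le_tsum hle (hfr.mul_left _)
      _ = C ^ (2 : ℝ) * ∑' k, ‖f (r k)‖ ^ (2 : ℝ) := tsum_mul_left
      _ ≤ C ^ (2 : ℝ) * ‖f‖ ^ (2 : ℝ) := by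
          gcongr
          rw [← hf.tsum_eq]
          exact tsum_comp_le_tsum_of_inj hf.summable (fun _ => by positivity) hr
      _ = (C * ‖f‖) ^ (2 : ℝ) := (Real.mul_rpow hC (norm_nonneg _)).symm

/-- The bounded weighted partial shift `e_{r k} ↦ c_k e_{s k}` (and `e_i ↦ 0` if `i` is not in the
range of `r`), for injective `r`, `s` and bounded weights `c`. -/
def weightedShift (r s : ι → ι) (hr : Function.Injective r) (hs : Function.Injective s)
    (c : ι → ℝ) (C : ℝ) (hc : ∀ k, |c k| ≤ C) : L2 ι →L[ℂ] L2 ι :=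
  LinearMap.mkContinuous
    { toFun := fun f => ⟨Function.extend s (fun k => (c k : ℂ) * f (r k)) 0,
        memℓp_gen (by simpa using (wshift_aux r s hr hs c C hc f).1)⟩
      map_add' := by
        classical
        intro f g
        ext k
        change Function.extend s (fun k => (c k : ℂ) * (f + g) (r k)) 0 k =
          Function.extend s (fun k => (c k : ℂ) * f (r k)) 0 k +
            Function.extend s (fun k => (c k : ℂ) * g (r k)) 0 k
        by_cases h : ∃ a, s a = k
        · simp [Function.extend, h, mul_add]
        · simp [Function.extend, h]
      map_smul' := by
        classical
        intro z f
        ext k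
        change Function.extend s (fun k => (c k : ℂ) * (z • f) (r k)) 0 k =
          z • Function.extend s (fun k => (c k : ℂ) * f (r k)) 0 k
        by_cases h : ∃ a, s a = k
        · simp [Function.extend, h]; ring
        · simp [Function.extend, h] } C (by
    intro f
    rcases isEmpty_or_nonempty ι with hι | ⟨⟨i₀⟩⟩
    · have hz : ∀ x : L2 ι, x = 0 := fun x => by ext k; exact hι.elim k
      have hn : ∀ x : L2 ι, ‖x‖ = 0 := fun x => by rw [hz x, norm_zero]
      rw [hn f, mul_zero]
      exact (hn _).le
    · have hC : 0 ≤ C := (abs_nonneg _).trans (hc i₀)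
      refine lp.norm_le_of_tsum_le (by simp) (by positivity) ?_
      simpa using (wshift_aux r s hr hs c C hc f).2)

theorem weightedShift_basisVec [DecidableEq ι] (r s : ι → ι) (hr : Function.Injective r)
    (hs : Function.Injective s) (c : ι → ℝ) (C : ℝ) (hc : ∀ k, |c k| ≤ C) (k : ι) :
    weightedShift r s hr hs c C hc (basisVec (r k)) = (c k : ℂ) • basisVec (s k) := by
  ext j
  change Function.extend s (fun l => (c l : ℂ) * (basisVec (r k) : L2 ι) (r l)) 0 j =
    (c k : ℂ) * (basisVec (s k) : L2 ι) j
  by_cases h : ∃ a, s a = j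
  · obtain ⟨a, rfl⟩ := h
    rw [hs.extend_apply]
    by_cases ha : a = k
    · subst ha; simp [basisVec]
    · simp [basisVec, hs.ne ha, hr.ne ha]
  · have : j ≠ s k := fun hj => h ⟨k, hj.symm⟩
    simp [Function.extend, h, basisVec, this]

theorem weightedShift_basisVec_of_notMem [DecidableEq ι] (r s : ι → ι) (hr : Function.Injective r)
    (hs : Function.Injective s) (c : ι → ℝ) (C : ℝ) (hc : ∀ k, |c k| ≤ C) (i : ι)
    (hi : ∀ k, r k ≠ i) :
    weightedShift r s hr hs c C hc (basisVec i) = 0 := by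
  ext j
  change Function.extend s (fun l => (c l : ℂ) * (basisVec i : L2 ι) (r l)) 0 j = _
  by_cases h : ∃ a, s a = j
  · obtain ⟨a, rfl⟩ := h
    rw [hs.extend_apply]
    simp [basisVec, hi a]
  · simp [Function.extend, h]

/-- The unbounded diagonal operator `e_i ↦ d_i e_i`, on its maximal domain
`{f ∈ ℓ² : (d_i f_i) ∈ ℓ²}`. -/
def diagOp (d : ι → ℝ) : L2 ι →ₗ.[ℂ] L2 ι where
  domain :=
    { carrier := {f | Memℓp (fun i => (d i : ℂ) * f i) 2}
      add_mem' := by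
        intro f g hf hg
        have h : (fun i => (d i : ℂ) * (f + g) i)
            = (fun i => (d i : ℂ) * f i) + fun i => (d i : ℂ) * g i := by
          funext i; simp [mul_add]
        change Memℓp (fun i => (d i : ℂ) * (f + g) i) 2
        rw [h]
        exact Memℓp.add hf hg
      zero_mem' := by
        have h : (fun i => (d i : ℂ) * (0 : L2 ι) i) = 0 := by funext i; simp
        change Memℓp (fun i => (d i : ℂ) * (0 : L2 ι) i) 2
        rw [h]
        exact zero_memℓp
      smul_mem' := by
        intro z f hf
        have h : (fun i => (d i : ℂ) * (z • f) i) = z • fun i => (d i : ℂ) * f i := by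
          funext i; simp; ring
        change Memℓp (fun i => (d i : ℂ) * (z • f) i) 2
        rw [h]
        exact Memℓp.const_smul hf z }
  toFun :=
    { toFun := fun f => ⟨fun i => (d i : ℂ) * (f : L2 ι) i, f.2⟩
      map_add' := fun f g => by
        ext i
        exact mul_add (d i : ℂ) ((f : L2 ι) i) ((g : L2 ι) i)
      map_smul' := fun z f => by
        ext i
        exact mul_left_comm (d i : ℂ) z ((f : L2 ι) i) }

/-- The operator `sign D` for `D = diagOp d`: the bounded diagonal operator
`e_i ↦ sign (d_i) e_i`. -/
def signOp (d : ι → ℝ) : L2 ι →L[ℂ] L2 ι :=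
  weightedShift id id Function.injective_id Function.injective_id
    (fun i => Real.sign (d i)) 1 (fun i => by
      rcases Real.sign_apply_eq (d i) with h | h | h <;> simp [h])

/-- The trace `∑ ⟨e_i, T e_i⟩` (meaningful for trace class operators). -/
def tr [DecidableEq ι] (T : L2 ι →L[ℂ] L2 ι) : ℂ := ∑' i, (T (basisVec i) : L2 ι) i

/-- Membership of the Schatten ideal `𝓛^{2k}`, that is, `(T*T)^k` is trace class:
`∑ ⟨e_i, (T*T)^k e_i⟩ < ∞`, a series of nonnegative terms. -/
def IsSchattenEven [DecidableEq ι] (k : ℕ) (T : L2 ι →L[ℂ] L2 ι) : Prop :=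
  Summable fun i => (((star T * T) ^ k) (basisVec i) : L2 ι) i

end L2

/-! ## Odd spectral triples and Fredholm modules -/

section Triples

variable {H : Type*} [NormedAddCommGroup H] [InnerProductSpace ℂ H] [CompleteSpace H]

/-- `(A, H, D)` is an odd spectral triple: `A` is a `*`-algebra of bounded operators on `H`, and
`D` is a (densely defined) self-adjoint operator with compact resolvent such that for `a ∈ A` the
commutator `[D, a]` is defined on the domain of `D` and extends to a bounded operator. -/
structure IsOddSpectralTriple (A : StarSubalgebra ℂ (H →L[ℂ] H)) (D : H →ₗ.[ℂ] H) : Prop where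
  dense_domain : Dense (D.domain : Set H)
  isSelfAdjoint : IsSelfAdjoint D
  compact_resolvent : ∀ z : ℂ, z.im ≠ 0 → ∃ R : H →L[ℂ] H, IsCompactOperator R ∧
    (∀ v, ∃ h : R v ∈ D.domain, D ⟨R v, h⟩ - z • R v = v) ∧
    ∀ v : D.domain, R (D v - z • (v : H)) = v
  bounded_commutators : ∀ a ∈ A, ∃ T : H →L[ℂ] H, ∀ v : D.domain,
    ∃ h : a v ∈ D.domain, D ⟨a v, h⟩ - a (D v) = T v

/-- `(A, ℓ²(ι), F)` is an odd Fredholm module which is `p`-summable for the even integer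
`p = 2 (m + 1)`: `F = F*`, `F² = 1`, and `[F, a] ∈ 𝓛^p` for all `a ∈ A`. -/
structure IsSummableFredholmModule {ι : Type*} [DecidableEq ι]
    (A : StarSubalgebra ℂ (L2 ι →L[ℂ] L2 ι)) (F : L2 ι →L[ℂ] L2 ι) (m : ℕ) : Prop where
  isSelfAdjoint : IsSelfAdjoint F
  sq_eq_one : F * F = 1
  summable : ∀ a ∈ A, IsSchattenEven (m + 1) (F * a - a * F)

/-- The negative spectral projection `(1 - F) / 2` of a self-adjoint `F` with `F² = 1`. -/
def negProj (F : H →L[ℂ] H) : H →L[ℂ] H := (1 / 2 : ℂ) • (1 - F)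

/-- The compression `P T P` of `T`, as an operator on the range of `P`. -/
def compression (P T : H →L[ℂ] H) : P.range →L[ℂ] P.range :=
  (P * T * P).restrict (fun x _ => ⟨T (P x), rfl⟩)

/-- The index `dim ker T - dim coker T` (meaningful for Fredholm operators). -/
def fredholmIndex {E : Type*} [NormedAddCommGroup E] [NormedSpace ℂ E] (T : E →L[ℂ] E) : ℤ :=
  (Module.finrank ℂ T.ker : ℤ) - Module.finrank ℂ (E ⧸ T.range)

end Triples

/-! ## Periodic cyclic cohomology of a unital algebra through the `(b, B)`-bicomplex -/

section Cyclic

variable {A : Type*} [Ring A] [Algebra ℂ A]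

/-- The Hochschild coboundary
`(bφ)(a₀, …, aₙ₊₁) = ∑_{j ≤ n} (-1)^j φ(…, a_j a_{j+1}, …) + (-1)^{n+1} φ(aₙ₊₁ a₀, a₁, …, aₙ)`
of a functional of `n + 1` variables. -/
def hochschild {n : ℕ} (φ : (Fin (n + 1) → A) → ℂ) (a : Fin (n + 2) → A) : ℂ :=
  ∑ j : Fin (n + 1), (-1 : ℂ) ^ (j : ℕ) * φ (Fin.contractNth j.castSucc (· * ·) a)
    + (-1 : ℂ) ^ (n + 1) *
      φ (Fin.cons (a (Fin.last (n + 1)) * a 0) fun i : Fin n => a i.castSucc.succ)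

/-- `(B₀φ)(a₀, …, aₙ) = φ(1, a₀, …, aₙ) - (-1)^{n+1} φ(a₀, …, aₙ, 1)`. -/
def connesB₀ {n : ℕ} (φ : (Fin (n + 2) → A) → ℂ) (a : Fin (n + 1) → A) : ℂ :=
  φ (Fin.cons 1 a) - (-1 : ℂ) ^ (n + 1) * φ (Fin.snoc a 1)

/-- Connes' operator `B = N B₀`, with `N` the signed sum over cyclic permutations. -/
def connesB {n : ℕ} (φ : (Fin (n + 2) → A) → ℂ) (a : Fin (n + 1) → A) : ℂ :=
  ∑ s : Fin (n + 1), (-1 : ℂ) ^ (n * (s : ℕ)) * connesB₀ φ fun i => a (i + s)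

/-- An odd periodic cyclic cocycle: a family `φ = (φ₁, φ₃, φ₅, …)` (with `φ k` of degree `2k + 1`)
of multilinear functionals, only finitely many of them nonzero, with `(b + B) φ = 0`. -/
structure IsOddPeriodicCocycle (φ : ∀ k : ℕ, (Fin (2 * k + 2) → A) → ℂ) : Prop where
  multilinear : ∀ k, ∃ f : MultilinearMap ℂ (fun _ : Fin (2 * k + 2) => A) ℂ, ⇑f = φ k
  finite : ∃ K, ∀ k ≥ K, φ k = 0
  zero_degree : ∀ a, connesB (n := 0) (φ 0) a = 0
  pos_degree : ∀ k a, hochschild (n := 2 * k + 1) (φ k) a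
    + connesB (n := 2 * k + 2) (φ (k + 1)) a = 0

/-- `φ` is a coboundary in the periodic complex: `φ = (b + B) ψ` for a family
`ψ = (ψ₀, ψ₂, ψ₄, …)` (with `ψ k` of degree `2k`) of multilinear functionals, only finitely many of
them nonzero. -/
def IsOddPeriodicCoboundary (φ : ∀ k : ℕ, (Fin (2 * k + 2) → A) → ℂ) : Prop :=
  ∃ ψ : ∀ k : ℕ, MultilinearMap ℂ (fun _ : Fin (2 * k + 1) => A) ℂ,
    (∃ K, ∀ k ≥ K, ψ k = 0) ∧
    ∀ k a, φ k a = hochschild (n := 2 * k) (ψ k) a + connesB (n := 2 * k + 1) (ψ (k + 1)) a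

/-- `φ` is a cocycle which represents a nonzero class of `HP¹(A)`. -/
def RepresentsNonzeroClass (φ : ∀ k : ℕ, (Fin (2 * k + 2) → A) → ℂ) : Prop :=
  IsOddPeriodicCocycle φ ∧ ¬ IsOddPeriodicCoboundary φ

end Cyclic

/-- The character of an odd Fredholm module in degree `n = 2m + 1`,
`τₙ(a₀, …, aₙ) = λₙ · ½ Tr (F [F, a₀] ⋯ [F, aₙ])`,
with Connes' constant `λₙ = √(2i) (-1)^{n(n-1)/2} Γ(n/2 + 1)`. -/
def character {ι : Type*} [DecidableEq ι] {A : StarSubalgebra ℂ (L2 ι →L[ℂ] L2 ι)}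
    (F : L2 ι →L[ℂ] L2 ι) (m : ℕ) (a : Fin (2 * m + 2) → A) : ℂ :=
  (2 * Complex.I) ^ (1 / 2 : ℂ) * (-1) ^ ((2 * m + 1) * m)
      * Complex.Gamma ((2 * m + 1 : ℂ) / 2 + 1) *
    (1 / 2 * tr (F * (List.ofFn fun i => F * (a i : L2 ι →L[ℂ] L2 ι) - a i * F).prod))

/-- The Chern character of an odd Fredholm module that is `2 (m + 1)`-summable, as a cochain of
the periodic complex: its character, placed in degree `2m + 1`. -/
def chernCharacter {ι : Type*} [DecidableEq ι] (A : StarSubalgebra ℂ (L2 ι →L[ℂ] L2 ι))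
    (F : L2 ι →L[ℂ] L2 ι) (m : ℕ) (k : ℕ) (a : Fin (2 * k + 2) → A) : ℂ :=
  if k = m then character F k a else 0

/-! ## The quantum group `SU_q(2)` on its `L₂`-space -/

/-- The labels of the basis `e^{(n)}_{ij}`, `n = 0, 1/2, 1, …`, `i, j = -n, -n+1, …, n`, in the
coordinates `(N, x, y) = (2n, n + i, n + j)`. -/
abbrev Idx : Type := {p : ℕ × ℕ × ℕ // p.2.1 ≤ p.1 ∧ p.2.2 ≤ p.1}

/-- The Hilbert space with orthonormal basis `e^{(n)}_{ij}`. -/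
abbrev Hq : Type := L2 Idx

/-- The basis vector `e^{(n)}_{ij}` with `(N, x, y) = (2n, n + i, n + j)`
(zero if `(N, x, y)` is out of range). -/
def e (N x y : ℕ) : Hq := if h : x ≤ N ∧ y ≤ N then basisVec ⟨(N, x, y), h⟩ else 0

/-- The coefficient `a₊(n, i, j)`. -/
def aPlus (q : ℝ) (N x y : ℕ) : ℝ :=
  √(q ^ (2 * x + 2 * y + 2) * ((1 - q ^ (2 * (N - y) + 2)) * (1 - q ^ (2 * (N - x) + 2))) /
    ((1 - q ^ (2 * N + 2)) * (1 - q ^ (2 * N + 4))))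

/-- The coefficient `a₋(n, i, j)`. -/
def aMinus (q : ℝ) (N x y : ℕ) : ℝ :=
  √((1 - q ^ (2 * y)) * (1 - q ^ (2 * x)) / ((1 - q ^ (2 * N)) * (1 - q ^ (2 * N + 2))))

/-- The coefficient `b₊(n, i, j)`. -/
def bPlus (q : ℝ) (N x y : ℕ) : ℝ :=
  -√(q ^ (2 * y) * ((1 - q ^ (2 * (N - y) + 2)) * (1 - q ^ (2 * x + 2))) /
    ((1 - q ^ (2 * N + 2)) * (1 - q ^ (2 * N + 4))))

/-- The coefficient `b₋(n, i, j)`. -/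
def bMinus (q : ℝ) (N x y : ℕ) : ℝ :=
  √(q ^ (2 * x) * ((1 - q ^ (2 * y)) * (1 - q ^ (2 * (N - x)))) /
    ((1 - q ^ (2 * N)) * (1 - q ^ (2 * N + 2))))

theorem sqrt_ratio_le {q : ℝ} (hq : q ∈ Set.Ioo (0 : ℝ) 1) (m u v k l : ℕ) (hk : 2 ≤ k)
    (hl : 2 ≤ l) :
    |√(q ^ m * ((1 - q ^ u) * (1 - q ^ v)) / ((1 - q ^ k) * (1 - q ^ l)))| ≤ 1 / (1 - q ^ 2) := by
  obtain ⟨h0, h1⟩ := hq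
  have hpow : ∀ n : ℕ, 0 ≤ 1 - q ^ n ∧ 1 - q ^ n ≤ 1 := fun n =>
    ⟨sub_nonneg.2 (pow_le_one₀ h0.le h1.le), by linarith [pow_pos h0 n]⟩
  have hden : ∀ n : ℕ, 2 ≤ n → 1 - q ^ 2 ≤ 1 - q ^ n := fun n hn => by
    have := pow_le_pow_of_le_one h0.le h1.le hn
    linarith
  have h2 : 0 < 1 - q ^ 2 := by nlinarith
  rw [abs_of_nonneg (Real.sqrt_nonneg _), Real.sqrt_le_left (by positivity), div_pow, one_pow]
  apply div_le_div₀ zero_le_one _ (by positivity)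
  · rw [sq]
    exact mul_le_mul (hden k hk) (hden l hl) h2.le (hpow k).1
  · have ha : (1 - q ^ u) * (1 - q ^ v) ≤ 1 :=
      mul_le_one₀ (hpow u).2 (hpow v).1 (hpow v).2
    exact mul_le_one₀ (pow_le_one₀ h0.le h1.le) (mul_nonneg (hpow u).1 (hpow v).1) ha

theorem aPlus_le (q : Set.Ioo (0 : ℝ) 1) (N x y : ℕ) :
    |aPlus q N x y| ≤ 1 / (1 - (q : ℝ) ^ 2) :=
  sqrt_ratio_le q.2 _ _ _ _ _ (by omega) (by omega)

theorem aMinus_le (q : Set.Ioo (0 : ℝ) 1) (N x y : ℕ) :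
    |aMinus q (N + 1) x y| ≤ 1 / (1 - (q : ℝ) ^ 2) := by
  have := sqrt_ratio_le q.2 0 (2 * y) (2 * x) (2 * (N + 1)) (2 * (N + 1) + 2)
    (by omega) (by omega)
  simpa [aMinus] using this

theorem bPlus_le (q : Set.Ioo (0 : ℝ) 1) (N x y : ℕ) :
    |bPlus q N x y| ≤ 1 / (1 - (q : ℝ) ^ 2) := by
  rw [bPlus, abs_neg]
  exact sqrt_ratio_le q.2 _ _ _ _ _ (by omega) (by omega)

theorem bMinus_le (q : Set.Ioo (0 : ℝ) 1) (N x y : ℕ) :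
    |bMinus q (N + 1) x y| ≤ 1 / (1 - (q : ℝ) ^ 2) :=
  sqrt_ratio_le q.2 _ _ _ _ _ (by omega) (by omega)

/-- `(N, x, y) ↦ (N + 1, x + u, y + v)` for `u, v ∈ {0, 1}`. -/
def up (u v : Fin 2) (p : Idx) : Idx :=
  ⟨(p.1.1 + 1, p.1.2.1 + u, p.1.2.2 + v), by have := p.2; constructor <;> dsimp only <;> omega⟩

theorem up_injective (u v : Fin 2) : Function.Injective (up u v) := by
  rintro ⟨⟨N, x, y⟩, h⟩ ⟨⟨N', x', y'⟩, h'⟩ hp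
  simp only [up, Subtype.mk.injEq, Prod.mk.injEq] at hp ⊢
  omega

/-- The generator
`α e^{(n)}_{ij} = a₊(n,i,j) e^{(n+1/2)}_{i-1/2,j-1/2} + a₋(n,i,j) e^{(n-1/2)}_{i-1/2,j-1/2}`. -/
def alpha (q : Set.Ioo (0 : ℝ) 1) : Hq →L[ℂ] Hq :=
  weightedShift id (up 0 0) Function.injective_id (up_injective 0 0)
    (fun p => aPlus q p.1.1 p.1.2.1 p.1.2.2) _ (fun _ => aPlus_le q _ _ _) +
  weightedShift (up 1 1) id (up_injective 1 1) Function.injective_id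
    (fun p => aMinus q (p.1.1 + 1) (p.1.2.1 + 1) (p.1.2.2 + 1)) _ (fun _ => aMinus_le q _ _ _)

/-- The generator
`β e^{(n)}_{ij} = b₊(n,i,j) e^{(n+1/2)}_{i+1/2,j-1/2} + b₋(n,i,j) e^{(n-1/2)}_{i+1/2,j-1/2}`. -/
def beta (q : Set.Ioo (0 : ℝ) 1) : Hq →L[ℂ] Hq :=
  weightedShift id (up 1 0) Function.injective_id (up_injective 1 0)
    (fun p => bPlus q p.1.1 p.1.2.1 p.1.2.2) _ (fun _ => bPlus_le q _ _ _) +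
  weightedShift (up 0 1) id (up_injective 0 1) Function.injective_id
    (fun p => bMinus q (p.1.1 + 1) p.1.2.1 (p.1.2.2 + 1)) _ (fun _ => bMinus_le q _ _ _)

theorem alpha_e (q : Set.Ioo (0 : ℝ) 1) (N x y : ℕ) (hx : x ≤ N) (hy : y ≤ N) :
    alpha q (e N x y) = (aPlus q N x y : ℂ) • e (N + 1) x y
      + (aMinus q N x y : ℂ) • e (N - 1) (x - 1) (y - 1) := by
  have h : x ≤ N ∧ y ≤ N := ⟨hx, hy⟩
  rw [alpha, add_apply]
  congr 1
  · rw [e, dif_pos h, e, dif_pos (by omega)]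
    exact weightedShift_basisVec id (up 0 0) _ _ _ _ _ (⟨(N, x, y), h⟩ : Idx)
  · rw [e, dif_pos h]
    by_cases h0 : x = 0 ∨ y = 0
    · rw [weightedShift_basisVec_of_notMem]
      · rcases h0 with rfl | rfl <;> simp [aMinus]
      · rintro ⟨⟨N', x', y'⟩, h'⟩ hp
        simp [up] at hp
        omega
    · obtain ⟨N, rfl⟩ : ∃ M, N = M + 1 := ⟨N - 1, by omega⟩
      obtain ⟨x, rfl⟩ : ∃ M, x = M + 1 := ⟨x - 1, by omega⟩
      obtain ⟨y, rfl⟩ : ∃ M, y = M + 1 := ⟨y - 1, by omega⟩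
      rw [e, dif_pos (by omega)]
      exact weightedShift_basisVec (up 1 1) id _ _ _ _ _ (⟨(N, x, y), ⟨by dsimp only; omega, by dsimp only; omega⟩⟩ : Idx)

theorem beta_e (q : Set.Ioo (0 : ℝ) 1) (N x y : ℕ) (hx : x ≤ N) (hy : y ≤ N) :
    beta q (e N x y) = (bPlus q N x y : ℂ) • e (N + 1) (x + 1) y
      + (bMinus q N x y : ℂ) • e (N - 1) x (y - 1) := by
  have h : x ≤ N ∧ y ≤ N := ⟨hx, hy⟩
  rw [beta, add_apply]
  congr 1
  · rw [e, dif_pos h, e, dif_pos (by omega)]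
    exact weightedShift_basisVec id (up 1 0) _ _ _ _ _ (⟨(N, x, y), h⟩ : Idx)
  · rw [e, dif_pos h]
    by_cases h0 : x = N ∨ y = 0
    · rw [weightedShift_basisVec_of_notMem]
      · rcases h0 with rfl | rfl <;> simp [bMinus]
      · rintro ⟨⟨N', x', y'⟩, h'⟩ hp
        simp [up] at hp h'
        omega
    · obtain ⟨N, rfl⟩ : ∃ M, N = M + 1 := ⟨N - 1, by omega⟩
      obtain ⟨y, rfl⟩ : ∃ M, y = M + 1 := ⟨y - 1, by omega⟩
      rw [e, dif_pos (by omega)]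
      exact weightedShift_basisVec (up 0 1) id _ _ _ _ _ (⟨(N, x, y), ⟨by dsimp only; omega, by dsimp only; omega⟩⟩ : Idx)

/-- The defining relations of `C(SU_q(2))`. -/
structure SUqRelations {R : Type*} [Ring R] [StarRing R] [Algebra ℂ R] (q : ℝ) (a b : R) :
    Prop where
  star_a_a : star a * a + star b * b = 1
  a_star_a : a * star a + ((q ^ 2 : ℝ) : ℂ) • (b * star b) = 1
  a_b : a * b - (q : ℂ) • (b * a) = 0
  a_star_b : a * star b - (q : ℂ) • (star b * a) = 0
  normal_b : star b * b = b * star b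

/-- The `*`-algebra `A_f` generated by `α` and `β`. -/
def Af (q : Set.Ioo (0 : ℝ) 1) : StarSubalgebra ℂ (Hq →L[ℂ] Hq) :=
  StarAlgebra.adjoin ℂ {alpha q, beta q}

/-- The `C*`-algebra `C(SU_q(2))`: the norm closure of `A_f`. -/
def CSUq (q : Set.Ioo (0 : ℝ) 1) : StarSubalgebra ℂ (Hq →L[ℂ] Hq) := (Af q).topologicalClosure

/-- `d(n, i) = 2n + 1` if `i ≠ n`, and `d(n, i) = -(2n + 1)` if `i = n`. -/
def diracEigenvalue (p : Idx) : ℝ :=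
  if p.1.2.1 = p.1.1 then -((p.1.1 : ℝ) + 1) else (p.1.1 : ℝ) + 1

/-- The Dirac operator `e^{(n)}_{ij} ↦ d(n, i) e^{(n)}_{ij}`. -/
def dirac : Hq →ₗ.[ℂ] Hq := diagOp diracEigenvalue

/-- The operator `sign D`. -/
def signDirac : Hq →L[ℂ] Hq := signOp diracEigenvalue

/-- The element `γ_r = (β*β)^r (β - 1) + 1`. -/
def gam (q : Set.Ioo (0 : ℝ) 1) (r : ℕ) : Hq →L[ℂ] Hq :=
  (star (beta q) * beta q) ^ r * (beta q - 1) + 1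

/-! ### Equivariance -/

/-- The algebraic span of the `e^{(n)}_{ij}`. -/
abbrev Core : Type := Idx →₀ ℂ

/-- The inclusion of the algebraic span into the Hilbert space. -/
def Core.toHq : Core →ₗ[ℂ] Hq := Finsupp.linearCombination ℂ (basisVec : Idx → Hq)

/-- The vector `e^{(n)}_{ij}` of the core (zero if out of range). -/
def eCore (N x y : ℕ) : Core := if h : x ≤ N ∧ y ≤ N then Finsupp.single ⟨(N, x, y), h⟩ 1 else 0

/-- `(q^{-2n} + q^{2n+2} - q^{-2j} - q^{2j+2})^{1/2}`, where `N = 2n`, `y = n + j`. -/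
def nCoeff (q : ℝ) (N y : ℕ) : ℝ :=
  √(q ^ (-(N : ℤ)) + q ^ ((N : ℤ) + 2) - q ^ (-(2 * (y : ℤ) - N)) - q ^ (2 * (y : ℤ) - N + 2))

/-- `A₀ : e^{(n)}_{ij} ↦ q^j e^{(n)}_{ij}`. -/
def A₀ (q : ℝ) : Module.End ℂ Core := Finsupp.linearCombination ℂ fun p : Idx =>
  ((q ^ ((p.1.2.2 : ℝ) - p.1.1 / 2) : ℝ) : ℂ) • eCore p.1.1 p.1.2.1 p.1.2.2

/-- `A₁ : e^{(n)}_{ij} ↦ (q^{-2n} + q^{2n+2} - q^{-2j} - q^{2j+2})^{1/2} e^{(n)}_{i,j+1}`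
for `j < n`, and `e^{(n)}_{in} ↦ 0`. -/
def A₁ (q : ℝ) : Module.End ℂ Core := Finsupp.linearCombination ℂ fun p : Idx =>
  (nCoeff q p.1.1 p.1.2.2 : ℂ) • eCore p.1.1 p.1.2.1 (p.1.2.2 + 1)

/-- The adjoint of `A₁`: `e^{(n)}_{i,j+1} ↦ (q^{-2n} + q^{2n+2} - q^{-2j} - q^{2j+2})^{1/2}
e^{(n)}_{ij}`, and `e^{(n)}_{i,-n} ↦ 0`. -/
def A₁star (q : ℝ) : Module.End ℂ Core := Finsupp.linearCombination ℂ fun p : Idx =>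
  if p.1.2.2 = 0 then 0
  else (nCoeff q p.1.1 (p.1.2.2 - 1) : ℂ) • eCore p.1.1 p.1.2.1 (p.1.2.2 - 1)

/-- `D` is equivariant: on the core of finite combinations of the `e^{(n)}_{ij}`, which it
preserves, `D` commutes with `A₀`, `A₁` and `A₁*`. -/
def IsEquivariant (q : ℝ) (D : Hq →ₗ.[ℂ] Hq) : Prop :=
  ∃ T : Module.End ℂ Core,
    (∀ v, ∃ h : Core.toHq v ∈ D.domain, D ⟨Core.toHq v, h⟩ = Core.toHq (T v)) ∧
    Commute T (A₀ q) ∧ Commute T (A₁ q) ∧ Commute T (A₁star q)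

end SUq

end

noncomputable section

namespace SUq

/-! ### Weighted shifts, adjoints and Hilbert–Schmidt operators on `ℓ²` -/

section L2

variable {ι : Type*}

/-! The generators, their adjoints and their commutators with `F` are sums of weighted partial
shifts of the basis, so most claims become claims about weights. With integer labels and basis
vectors set to zero out of range, each relation of `SU_q(2)` splits into three coefficient
identities, for the shifts of `N` by `2`, `0` and `-2`. Once the square roots have been paired these
are rational identities in `q^N`, `q^x`, `q^y`.

The negative eigenspace of `D` is spanned by the labels on the line `x = N`. The parts `a₋` and `b₊`
preserve `N - x`, hence the sign of the eigenvalue. The parts `a₊` and `b₋` can cross between the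
line and its complement, but there their weight is `O(q^N)`. This beats the jump `2N + 3` of the
eigenvalue, which bounds `[D, a]`. It is also square summable over the `N + 1` labels of the line at
level `N`, so that `[F, a]` is Hilbert–Schmidt. The eigenvalue does not depend on `y`, whence
equivariance.

To see that the Chern character is not a coboundary, it is paired with the unitary fundamental
corepresentation `U`, a `2 × 2` matrix, by means of the generalized trace. For `X = U* - 1` and `Y =
U - 1` one has `XY = YX = -(X + Y)`, so Hochschild coboundaries on alternating words telescope. The
result is `(k + 1) ⟨bψ⟩ = ⟨Bψ⟩` between neighbouring degrees (`chernPairing_hochschild_succ`). If a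
cocycle concentrated in degree one is `(b + B)ψ`, the numbers `⟨Bψ⟩` in successive degrees are
therefore `(-1)^k / k!` times its pairing. They vanish eventually, so the pairing is zero
(`chernPairing_coboundary`). For the Chern character the contributions of `α` cancel, and those of
`β` give a nonzero multiple of `(1 - q²) Tr(F [F, β*] [F, β])`, where the trace is minus the squared
Hilbert–Schmidt norm of `[F, β]`.

Invertibility of `γ_r` is functional calculus for the normal operator `β`: the spectrum of `β*β`
lies in `{0} ∪ {q^{2k}}`, because `α*α` and `αα*` have the same nonzero spectrum.

For the index, let `E(p)` be the expectation of `(β*β)^r` at `e_p`. The compression of `γ_r` is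
lower bidiagonal on each chain `(N, N, y)` with `y` fixed, with diagonal entries `1 - E(p)` and
subdiagonal entries `b₊(p) E(up p)`. For `y ≥ 1` one has `E ≤ q^{2r} < 1/2`, from `α (β*β)^r α* ≤
q^{2r} αα*`, so the diagonal dominates. For `y = 0` one has `E → 1`, from `1 - E ≤ r ‖α e‖²`, so the
chain behaves like a unilateral shift. Hence the compression is an invertible operator times an
isometry of corank one (`exists_unit_mul_cornerIsometry`), of index `-1`. -/

theorem weightedShift_apply (r s : ι → ι) (hr : Function.Injective r)
    (hs : Function.Injective s) (c : ι → ℝ) (C : ℝ) (hc : ∀ k, |c k| ≤ C) (f : L2 ι) (j : ι) :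
    weightedShift r s hr hs c C hc f j = Function.extend s (fun k => (c k : ℂ) * f (r k)) 0 j :=
  rfl

theorem weightedShift_apply_image (r s : ι → ι) (hr : Function.Injective r)
    (hs : Function.Injective s) (c : ι → ℝ) (C : ℝ) (hc : ∀ k, |c k| ≤ C) (f : L2 ι) (k : ι) :
    weightedShift r s hr hs c C hc f (s k) = (c k : ℂ) * f (r k) := by
  rw [weightedShift_apply, hs.extend_apply]

theorem weightedShift_apply_of_notMem (r s : ι → ι) (hr : Function.Injective r)
    (hs : Function.Injective s) (c : ι → ℝ) (C : ℝ) (hc : ∀ k, |c k| ≤ C) (f : L2 ι) (j : ι)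
    (hj : ¬ ∃ k, s k = j) : weightedShift r s hr hs c C hc f j = 0 := by
  rw [weightedShift_apply, Function.extend_apply' _ _ _ hj]
  rfl

theorem weightedShift_norm_le (r s : ι → ι) (hr : Function.Injective r)
    (hs : Function.Injective s) (c : ι → ℝ) (C : ℝ) (hc : ∀ k, |c k| ≤ C) (hC : 0 ≤ C) :
    ‖weightedShift r s hr hs c C hc‖ ≤ C :=
  LinearMap.mkContinuous_norm_le _ hC _

/-- Both inner products are the same sum over `k`, extended by zero along `r` on one side and along
`s` on the other. -/
theorem star_weightedShift (r s : ι → ι) (hr : Function.Injective r)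
    (hs : Function.Injective s) (c : ι → ℝ) (C : ℝ) (hc : ∀ k, |c k| ≤ C) :
    star (weightedShift r s hr hs c C hc) = weightedShift s r hs hr c C hc := by
  rw [ContinuousLinearMap.star_eq_adjoint, eq_comm, ContinuousLinearMap.eq_adjoint_iff]
  intro x y
  rw [lp.inner_eq_tsum, lp.inner_eq_tsum]
  have h1 : (fun j => inner ℂ (weightedShift s r hs hr c C hc x j) (y j)) =
      Function.extend r (fun k => (c k : ℂ) * (starRingEnd ℂ (x (s k)) * y (r k))) 0 := by
    funext j
    by_cases h : ∃ k, r k = j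
    · obtain ⟨k, rfl⟩ := h
      rw [weightedShift_apply_image, hr.extend_apply]
      simp
      ring
    · rw [weightedShift_apply_of_notMem _ _ _ _ _ _ _ _ _ h, Function.extend_apply' _ _ _ h]
      simp
  have h2 : (fun j => inner ℂ (x j) (weightedShift r s hr hs c C hc y j)) =
      Function.extend s (fun k => (c k : ℂ) * (starRingEnd ℂ (x (s k)) * y (r k))) 0 := by
    funext j
    by_cases h : ∃ k, s k = j
    · obtain ⟨k, rfl⟩ := h
      rw [weightedShift_apply_image, hs.extend_apply]
      simp
      ring
    · rw [weightedShift_apply_of_notMem _ _ _ _ _ _ _ _ _ h, Function.extend_apply' _ _ _ h]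
      simp
  rw [h1, h2, tsum_extend_zero hr, tsum_extend_zero hs]

theorem hasSum_norm_sq (f : L2 ι) : HasSum (fun i => ‖f i‖ ^ 2) (‖f‖ ^ 2) := by
  have := lp.hasSum_norm (E := fun _ : ι => ℂ) (p := 2) (by norm_num) f
  simpa using this

variable [DecidableEq ι]

theorem inner_basisVec (i : ι) (f : L2 ι) : inner ℂ (basisVec i) f = f i := by
  rw [basisVec, lp.inner_single_left]
  simp

theorem basisVec_apply (i j : ι) : (basisVec i : L2 ι) j = if j = i then 1 else 0 := by
  simp [basisVec, Pi.single_apply]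

theorem norm_basisVec (i : ι) : ‖(basisVec i : L2 ι)‖ = 1 := by
  have := lp.norm_single (E := fun _ : ι => ℂ) (p := 2) (by norm_num) i (1 : ℂ)
  simpa only [basisVec, norm_one] using this

theorem hasSum_basisVec (f : L2 ι) : HasSum (fun i => f i • basisVec i) f := by
  have := lp.hasSum_single (E := fun _ : ι => ℂ) (p := 2) (by norm_num) f
  convert this using 2 with i
  ext j
  by_cases h : j = i
  · subst h; simp [basisVec]
  · simp [basisVec, h]

theorem ext_basisVec {T S : L2 ι →L[ℂ] L2 ι} (h : ∀ i, T (basisVec i) = S (basisVec i)) :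
    T = S := by
  ext1 f
  have h1 := (hasSum_basisVec f).mapL T
  have h2 := (hasSum_basisVec f).mapL S
  simp only [map_smul, h] at h1 h2
  exact h1.unique h2

/-- The matrix coefficients of the adjoint. -/
theorem star_apply_basisVec (T : L2 ι →L[ℂ] L2 ι) (i j : ι) :
    (star T (basisVec j) : L2 ι) i = starRingEnd ℂ ((T (basisVec i) : L2 ι) j) := by
  rw [← inner_basisVec, ContinuousLinearMap.star_eq_adjoint,
    ContinuousLinearMap.adjoint_inner_right, ← inner_basisVec, inner_conj_symm]

/-- Hilbert–Schmidt operators on `ℓ²(ι)`. -/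
def IsHilbertSchmidt (T : L2 ι →L[ℂ] L2 ι) : Prop :=
  Summable fun i => ‖T (basisVec i)‖ ^ 2

theorem star_mul_self_apply (T : L2 ι →L[ℂ] L2 ι) (i : ι) :
    ((star T * T) (basisVec i) : L2 ι) i = ((‖T (basisVec i)‖ ^ 2 : ℝ) : ℂ) := by
  rw [← inner_basisVec, mul_apply_eq_comp, ContinuousLinearMap.star_eq_adjoint,
    ContinuousLinearMap.adjoint_inner_right, inner_self_eq_norm_sq_to_K]
  simp

theorem isSchattenEven_one_iff (T : L2 ι →L[ℂ] L2 ι) :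
    IsSchattenEven 1 T ↔ IsHilbertSchmidt T := by
  unfold IsSchattenEven IsHilbertSchmidt
  simp only [pow_one, star_mul_self_apply]
  exact Complex.summable_ofReal

namespace IsHilbertSchmidt

variable {T S : L2 ι →L[ℂ] L2 ι}

/-- Square summability of the whole matrix is symmetric under transposition; closure under adjoints
and cyclicity of the trace rest on this. -/
theorem summable_prod (hT : IsHilbertSchmidt T) :
    Summable fun p : ι × ι => ‖(T (basisVec p.1) : L2 ι) p.2‖ ^ 2 := by
  rw [summable_prod_of_nonneg (fun _ => by positivity)]
  refine ⟨fun i => (hasSum_norm_sq (T (basisVec i))).summable, ?_⟩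
  have h : (fun i => ∑' j, ‖(T (basisVec i) : L2 ι) j‖ ^ 2) = fun i => ‖T (basisVec i)‖ ^ 2 :=
    funext fun i => (hasSum_norm_sq (T (basisVec i))).tsum_eq
  rw [h]
  exact hT

theorem of_summable_prod
    (h : Summable fun p : ι × ι => ‖(T (basisVec p.1) : L2 ι) p.2‖ ^ 2) :
    IsHilbertSchmidt T := by
  rw [summable_prod_of_nonneg (fun _ => by positivity)] at h
  have h' : (fun i => ∑' j, ‖(T (basisVec i) : L2 ι) j‖ ^ 2) = fun i => ‖T (basisVec i)‖ ^ 2 :=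
    funext fun i => (hasSum_norm_sq (T (basisVec i))).tsum_eq
  have h2 := h.2
  rw [h'] at h2
  exact h2

theorem star (hT : IsHilbertSchmidt T) : IsHilbertSchmidt (star T) := by
  refine of_summable_prod ?_
  convert hT.summable_prod.prod_symm using 3 with p
  rw [star_apply_basisVec, RCLike.norm_conj]
  rfl

theorem mul_left (S : L2 ι →L[ℂ] L2 ι) (hT : IsHilbertSchmidt T) :
    IsHilbertSchmidt (S * T) := by
  refine Summable.of_nonneg_of_le (fun _ => by positivity) (fun i => ?_) (Summable.mul_left (‖S‖ ^ 2) hT)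
  rw [← mul_pow]
  gcongr
  exact S.le_opNorm _

theorem mul_right (hT : IsHilbertSchmidt T) (S : L2 ι →L[ℂ] L2 ι) :
    IsHilbertSchmidt (T * S) := by
  have := (hT.star.mul_left (Star.star S)).star
  rwa [star_mul, star_star, star_star] at this

theorem add (hT : IsHilbertSchmidt T) (hS : IsHilbertSchmidt S) : IsHilbertSchmidt (T + S) := by
  refine Summable.of_nonneg_of_le (fun _ => by positivity) (fun i => ?_)
    ((Summable.add hT hS).mul_left 2)
  have h1 : ‖(T + S) (basisVec i)‖ ≤ ‖T (basisVec i)‖ + ‖S (basisVec i)‖ := norm_add_le _ _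
  calc ‖(T + S) (basisVec i)‖ ^ 2 ≤ (‖T (basisVec i)‖ + ‖S (basisVec i)‖) ^ 2 := by gcongr
    _ ≤ _ := by nlinarith [sq_nonneg (‖T (basisVec i)‖ - ‖S (basisVec i)‖)]

theorem zero : IsHilbertSchmidt (0 : L2 ι →L[ℂ] L2 ι) := by
  simp [IsHilbertSchmidt, summable_zero]

theorem smul (z : ℂ) (hT : IsHilbertSchmidt T) : IsHilbertSchmidt (z • T) := by
  have := hT.mul_left (z • 1)
  rwa [smul_mul_assoc, one_mul] at this

theorem neg (hT : IsHilbertSchmidt T) : IsHilbertSchmidt (-T) := by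
  simpa using hT.smul (-1)

theorem hasSum_mul_apply (S T : L2 ι →L[ℂ] L2 ι) (i : ι) :
    HasSum (fun j => (S (basisVec j) : L2 ι) i * (T (basisVec i) : L2 ι) j)
      (((S * T) (basisVec i) : L2 ι) i) := by
  have h := lp.hasSum_inner (𝕜 := ℂ) (Star.star S (basisVec i)) (T (basisVec i))
  rw [ContinuousLinearMap.star_eq_adjoint, ContinuousLinearMap.adjoint_inner_left,
    inner_basisVec, ← ContinuousLinearMap.star_eq_adjoint] at h
  simp only [star_apply_basisVec] at h
  have h' : (fun j => inner ℂ (starRingEnd ℂ ((S (basisVec j) : L2 ι) i))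
      ((T (basisVec i) : L2 ι) j)) = fun j => (S (basisVec j) : L2 ι) i *
        (T (basisVec i) : L2 ι) j := by
    funext j
    simp [mul_comm]
  rw [h'] at h
  exact h

theorem summable_prod_mul (hS : IsHilbertSchmidt S) (hT : IsHilbertSchmidt T) :
    Summable fun p : ι × ι => (S (basisVec p.2) : L2 ι) p.1 * (T (basisVec p.1) : L2 ι) p.2 := by
  refine Summable.of_norm_bounded (hS.summable_prod.prod_symm.add hT.summable_prod) fun p => ?_
  rw [norm_mul]
  simp only [Prod.fst_swap, Prod.snd_swap]
  nlinarith [sq_nonneg (‖(S (basisVec p.2) : L2 ι) p.1‖ - ‖(T (basisVec p.1) : L2 ι) p.2‖),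
    sq_nonneg (‖(S (basisVec p.2) : L2 ι) p.1‖), sq_nonneg (‖(T (basisVec p.1) : L2 ι) p.2‖)]

theorem summable_trace (hS : IsHilbertSchmidt S) (hT : IsHilbertSchmidt T) :
    Summable fun i => ((S * T) (basisVec i) : L2 ι) i := by
  have h := (summable_prod_mul hS hT).prod
  have h' : (fun i => ∑' j, (S (basisVec j) : L2 ι) i * (T (basisVec i) : L2 ι) j) =
      fun i => ((S * T) (basisVec i) : L2 ι) i := funext fun i => (hasSum_mul_apply S T i).tsum_eq
  exact h' ▸ h

/-- The double series of products of entries converges absolutely, so the order of summation may be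
exchanged. -/
theorem tr_mul_comm (hS : IsHilbertSchmidt S) (hT : IsHilbertSchmidt T) :
    tr (S * T) = tr (T * S) := by
  have h1 : tr (S * T) = ∑' i, ∑' j, (S (basisVec j) : L2 ι) i * (T (basisVec i) : L2 ι) j :=
    tsum_congr fun i => (hasSum_mul_apply S T i).tsum_eq.symm
  have h2 : tr (T * S) = ∑' j, ∑' i, (S (basisVec j) : L2 ι) i * (T (basisVec i) : L2 ι) j :=
    tsum_congr fun j => by
      rw [← (hasSum_mul_apply T S j).tsum_eq]
      exact tsum_congr fun i => mul_comm _ _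
  rw [h1, h2]
  exact (Summable.prod_symm (summable_prod_mul hS hT)).tsum_comm

end IsHilbertSchmidt

end L2

/-! ### The algebra of operators with bounded commutator -/

section Commutators

variable {H : Type*} [NormedAddCommGroup H] [InnerProductSpace ℂ H]

/-- The bounded operator `a` preserves the domain of `D`, and `[D, a]` extends to a bounded
operator. -/
def HasBoundedCommutator (D : H →ₗ.[ℂ] H) (a : H →L[ℂ] H) : Prop :=
  ∃ T : H →L[ℂ] H, ∀ v : D.domain, ∃ h : a v ∈ D.domain, D ⟨a v, h⟩ - a (D v) = T v

namespace HasBoundedCommutator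

variable {D : H →ₗ.[ℂ] H} {a b : H →L[ℂ] H}

theorem add (ha : HasBoundedCommutator D a) (hb : HasBoundedCommutator D b) :
    HasBoundedCommutator D (a + b) := by
  obtain ⟨S, hS⟩ := ha
  obtain ⟨T, hT⟩ := hb
  refine ⟨S + T, fun v => ?_⟩
  obtain ⟨h1, e1⟩ := hS v
  obtain ⟨h2, e2⟩ := hT v
  refine ⟨D.domain.add_mem h1 h2, ?_⟩
  have : (⟨(a + b) v, D.domain.add_mem h1 h2⟩ : D.domain) = ⟨a v, h1⟩ + ⟨b v, h2⟩ := rfl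
  rw [this, D.map_add, add_apply, add_apply, ← e1, ← e2]
  abel

/-- Leibniz rule `[D, ab] = [D, a] b + a [D, b]`; the first term makes sense because `b` preserves
the domain. -/
theorem mul (ha : HasBoundedCommutator D a) (hb : HasBoundedCommutator D b) :
    HasBoundedCommutator D (a * b) := by
  obtain ⟨S, hS⟩ := ha
  obtain ⟨T, hT⟩ := hb
  refine ⟨S * b + a * T, fun v => ?_⟩
  obtain ⟨h2, e2⟩ := hT v
  obtain ⟨h1, e1⟩ := hS ⟨b v, h2⟩
  refine ⟨h1, ?_⟩
  change D ⟨a (b v), h1⟩ - a (b (D v)) = S (b v) + a (T v)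
  rw [← e1, ← e2, map_sub]
  abel

theorem algebraMap (D : H →ₗ.[ℂ] H) (z : ℂ) :
    HasBoundedCommutator D (algebraMap ℂ (H →L[ℂ] H) z) := by
  refine ⟨0, fun v => ⟨D.domain.smul_mem z v.2, ?_⟩⟩
  have : (⟨_, D.domain.smul_mem z v.2⟩ : D.domain) = z • v := rfl
  change D ⟨z • v, _⟩ - z • D v = 0
  rw [this, D.map_smul, sub_self]

end HasBoundedCommutator

end Commutators

/-! ### Diagonal operators: domain, self-adjointness, compact resolvent -/

section Diagonal

variable {ι : Type*} (d : ι → ℝ)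

theorem mem_diagOp_domain {v : L2 ι} :
    v ∈ (diagOp d).domain ↔ Memℓp (fun i => (d i : ℂ) * v i) 2 :=
  Iff.rfl

theorem diagOp_apply (v : (diagOp d).domain) (i : ι) :
    (diagOp d v : L2 ι) i = d i * (v : L2 ι) i :=
  rfl

/-- An `ℓ²` family equal to `d * v` shows that `v` is in the domain of `diagOp d`. -/
theorem diagOp_eq_of_forall {v w : L2 ι} (h : ∀ i, (d i : ℂ) * v i = w i) :
    ∃ hv : v ∈ (diagOp d).domain, diagOp d ⟨v, hv⟩ = w := by
  have hv : v ∈ (diagOp d).domain := by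
    rw [mem_diagOp_domain, funext h]
    exact lp.memℓp w
  refine ⟨hv, ?_⟩
  ext i
  exact h i

/-- The commutator is again a weighted shift, its weights multiplied by the jumps of the eigenvalue.
-/
theorem hasBoundedCommutator_weightedShift (r s : ι → ι) (hr : Function.Injective r)
    (hs : Function.Injective s) (c : ι → ℝ) (C : ℝ) (hc : ∀ k, |c k| ≤ C)
    (h : ∃ C', ∀ k, |c k * (d (s k) - d (r k))| ≤ C') :
    HasBoundedCommutator (diagOp d) (weightedShift r s hr hs c C hc) := by
  obtain ⟨C', hC'⟩ := h
  refine ⟨weightedShift r s hr hs _ C' hC', fun v => ?_⟩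
  -- Exhibiting the family `D T v` as `[D, T] v + T D v`, an element of `ℓ²`, is what puts `T v`
  -- into the maximal domain.
  obtain ⟨hv, e⟩ := diagOp_eq_of_forall d
    (v := weightedShift r s hr hs c C hc (v : L2 ι))
    (w := weightedShift r s hr hs _ C' hC' (v : L2 ι) +
      weightedShift r s hr hs c C hc (diagOp d v)) (fun i => by
    rw [lp.coeFn_add, Pi.add_apply]
    by_cases h : ∃ k, s k = i
    · obtain ⟨k, rfl⟩ := h
      rw [weightedShift_apply_image, weightedShift_apply_image, weightedShift_apply_image,
        diagOp_apply]
      push_cast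
      ring
    · rw [weightedShift_apply_of_notMem _ _ _ _ _ _ _ _ _ h,
        weightedShift_apply_of_notMem _ _ _ _ _ _ _ _ _ h,
        weightedShift_apply_of_notMem _ _ _ _ _ _ _ _ _ h]
      simp)
  exact ⟨hv, by rw [e, add_sub_cancel_right]⟩

variable [DecidableEq ι]

theorem basisVec_mem_diagOp_domain (i : ι) :
    ∃ h : basisVec i ∈ (diagOp d).domain,
      diagOp d ⟨basisVec i, h⟩ = (d i : ℂ) • basisVec i := by
  refine diagOp_eq_of_forall d fun j => ?_
  rw [lp.coeFn_smul, Pi.smul_apply, basisVec_apply]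
  by_cases h : j = i
  · subst h; simp
  · simp [h]

theorem dense_diagOp_domain : Dense ((diagOp d).domain : Set (L2 ι)) := by
  intro f
  refine mem_closure_of_tendsto (hasSum_basisVec f) (Filter.Eventually.of_forall fun s => ?_)
  exact Submodule.sum_mem _ fun i _ =>
    Submodule.smul_mem _ _ (basisVec_mem_diagOp_domain d i).1

/-- Testing against basis vectors determines the adjoint entry by entry, so its domain is no larger
than the maximal one. -/
theorem isSelfAdjoint_diagOp : IsSelfAdjoint (diagOp d) := by
  rw [LinearPMap.isSelfAdjoint_def]
  refine le_antisymm ?_ ?_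
  · have key : ∀ y : (diagOp d).adjoint.domain, ∀ i,
        (d i : ℂ) * (y : L2 ι) i = ((diagOp d).adjoint y : L2 ι) i := by
      intro y i
      obtain ⟨hi, e⟩ := basisVec_mem_diagOp_domain d i
      have h := (LinearPMap.adjoint_isFormalAdjoint (dense_diagOp_domain d)).symm ⟨basisVec i, hi⟩ y
      rw [e, inner_smul_left, inner_basisVec, inner_basisVec, Complex.conj_ofReal] at h
      exact h
    refine ⟨fun y hy => (diagOp_eq_of_forall d (key ⟨y, hy⟩)).1, ?_⟩
    rintro y z hyz
    ext i
    rw [diagOp_apply, ← hyz, key]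
  · refine LinearPMap.IsFormalAdjoint.le_adjoint (dense_diagOp_domain d) ?_
    intro x y
    rw [lp.inner_eq_tsum, lp.inner_eq_tsum]
    refine tsum_congr fun i => ?_
    rw [diagOp_apply, diagOp_apply]
    simp
    ring

theorem isCompactOperator_weightedShift_of_finite (r s : ι → ι) (hr : Function.Injective r)
    (hs : Function.Injective s) (c : ι → ℝ) (C : ℝ) (hc : ∀ k, |c k| ≤ C)
    (hfin : {k | c k ≠ 0}.Finite) :
    IsCompactOperator (weightedShift r s hr hs c C hc) := by
  have h : weightedShift r s hr hs c C hc = ∑ k ∈ hfin.toFinset,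
      (c k : ℂ) • (innerSL ℂ (basisVec (r k) : L2 ι)).smulRight (basisVec (s k) : L2 ι) := by
    refine ext_basisVec fun i => ?_
    rw [sum_apply]
    have h2 : ∀ k, ((c k : ℂ) • (innerSL ℂ (basisVec (r k) : L2 ι)).smulRight
        (basisVec (s k) : L2 ι)) (basisVec i) =
        if r k = i then (c k : ℂ) • basisVec (s k) else 0 := by
      intro k
      simp only [smul_apply, ContinuousLinearMap.smulRight_apply,
        innerSL_apply_apply, inner_basisVec, basisVec_apply]
      split_ifs <;> simp
    simp only [h2]
    by_cases hi : ∃ k, r k = i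
    · obtain ⟨k, rfl⟩ := hi
      rw [weightedShift_basisVec]
      simp only [hr.eq_iff, Finset.sum_ite_eq', Set.Finite.mem_toFinset, Set.mem_ofPred_eq]
      by_cases hk : c k = 0 <;> simp [hk]
    · push Not at hi
      rw [weightedShift_basisVec_of_notMem _ _ _ _ _ _ _ _ hi, Finset.sum_eq_zero]
      intro k _
      rw [if_neg (hi k)]
  rw [h]
  refine Submodule.sum_mem (compactOperator (RingHom.id ℂ) (L2 ι) (L2 ι)) fun k _ => ?_
  refine IsCompactOperator.smul ?_ (c k : ℂ)
  have : IsCompactOperator (innerSL ℂ (basisVec (r k) : L2 ι)) :=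
    isCompactOperator_of_locallyCompactSpace_dom (innerSL ℂ (basisVec (r k) : L2 ι))
  exact this.clm_comp (ContinuousLinearMap.toSpanSingleton ℂ (basisVec (s k) : L2 ι))

/-- Replacing the weights of modulus below `ε / 2` by zero leaves a finite rank operator at distance
at most `ε / 2`. -/
theorem isCompactOperator_weightedShift (r s : ι → ι) (hr : Function.Injective r)
    (hs : Function.Injective s) (c : ι → ℝ) (C : ℝ) (hc : ∀ k, |c k| ≤ C)
    (hlim : Filter.Tendsto c Filter.cofinite (nhds 0)) :
    IsCompactOperator (weightedShift r s hr hs c C hc) := by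
  refine isClosed_setOfPred_isCompactOperator.closure_subset ?_
  rw [Metric.mem_closure_iff]
  intro ε hε
  have hfin : {k | ¬ |c k| < ε / 2}.Finite := by
    have := Metric.tendsto_nhds.1 hlim (ε / 2) (by positivity)
    simpa [Real.dist_eq] using this
  have h1 : ∀ k, |if |c k| < ε / 2 then 0 else c k| ≤ C := fun k => by
    split_ifs
    · rw [abs_zero]; exact (abs_nonneg _).trans (hc k)
    · exact hc k
  refine ⟨weightedShift r s hr hs _ C h1, ?_, ?_⟩
  · refine isCompactOperator_weightedShift_of_finite r s hr hs _ C h1 (hfin.subset fun k hk => ?_)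
    simp only [Set.mem_ofPred_eq] at hk ⊢
    intro h
    simp [h] at hk
  · have h2 : ∀ k, |if |c k| < ε / 2 then c k else 0| ≤ ε / 2 := fun k => by
      split_ifs with h
      · exact h.le
      · rw [abs_zero]; positivity
    have h3 : weightedShift r s hr hs c C hc - weightedShift r s hr hs _ C h1 =
        weightedShift r s hr hs _ _ h2 := by
      refine ext_basisVec fun i => ?_
      rw [sub_apply]
      by_cases hi : ∃ k, r k = i
      · obtain ⟨k, rfl⟩ := hi
        rw [weightedShift_basisVec, weightedShift_basisVec, weightedShift_basisVec, ← sub_smul]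
        congr 1
        split_ifs <;> simp
      · push Not at hi
        rw [weightedShift_basisVec_of_notMem _ _ _ _ _ _ _ _ hi,
          weightedShift_basisVec_of_notMem _ _ _ _ _ _ _ _ hi,
          weightedShift_basisVec_of_notMem _ _ _ _ _ _ _ _ hi, sub_zero]
    rw [dist_eq_norm, h3]
    exact (weightedShift_norm_le _ _ _ _ _ _ _ (by positivity)).trans_lt (by linarith)

theorem compact_resolvent_diagOp (hd : Filter.Tendsto (fun i => |d i|) Filter.cofinite Filter.atTop)
    (z : ℂ) (hz : z.im ≠ 0) :
    ∃ R : L2 ι →L[ℂ] L2 ι, IsCompactOperator R ∧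
      (∀ v, ∃ h : R v ∈ (diagOp d).domain, diagOp d ⟨R v, h⟩ - z • R v = v) ∧
      ∀ v : (diagOp d).domain, R (diagOp d v - z • (v : L2 ι)) = v := by
  have hne : ∀ i, (d i : ℂ) - z ≠ 0 := fun i h => hz <| by
    have := congrArg Complex.im h
    simpa using this
  have hbound : ∀ i, ‖((d i : ℂ) - z)⁻¹‖ ≤ 1 / |z.im| := fun i => by
    rw [norm_inv, one_div]
    refine inv_anti₀ (abs_pos.2 hz) ?_
    have := Complex.abs_im_le_norm ((d i : ℂ) - z)
    simpa using this
  have hlim : Filter.Tendsto (fun i => ((d i : ℂ) - z)⁻¹) Filter.cofinite (nhds 0) := by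
    refine Filter.tendsto_inv₀_cobounded.comp ?_
    rw [← tendsto_norm_atTop_iff_cobounded]
    refine Filter.tendsto_atTop_mono (fun i => ?_)
      (Filter.tendsto_atTop_add_const_right _ (-‖z‖) hd)
    have := norm_sub_norm_le (d i : ℂ) z
    rw [Complex.norm_real, Real.norm_eq_abs] at this
    linarith
  -- Weighted shifts have real weights, so the resolvent is assembled from its real and imaginary
  -- parts.
  have hre : ∀ i, |(((d i : ℂ) - z)⁻¹).re| ≤ 1 / |z.im| := fun i =>
    (Complex.abs_re_le_norm _).trans (hbound i)
  have him : ∀ i, |(((d i : ℂ) - z)⁻¹).im| ≤ 1 / |z.im| := fun i =>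
    (Complex.abs_im_le_norm _).trans (hbound i)
  set R₁ : L2 ι →L[ℂ] L2 ι := weightedShift id id Function.injective_id Function.injective_id
    _ _ hre with hR₁
  set R₂ : L2 ι →L[ℂ] L2 ι := weightedShift id id Function.injective_id Function.injective_id
    _ _ him with hR₂
  have hR : ∀ (v : L2 ι) i, (R₁ + Complex.I • R₂) v i = ((d i : ℂ) - z)⁻¹ * v i := by
    intro v i
    have e1 : R₁ v i = ((((d i : ℂ) - z)⁻¹).re : ℂ) * v i :=
      weightedShift_apply_image id id Function.injective_id Function.injective_id _ _ hre v i
    have e2 : R₂ v i = ((((d i : ℂ) - z)⁻¹).im : ℂ) * v i :=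
      weightedShift_apply_image id id Function.injective_id Function.injective_id _ _ him v i
    rw [add_apply, smul_apply, lp.coeFn_add, lp.coeFn_smul, Pi.add_apply, Pi.smul_apply, e1, e2,
      smul_eq_mul]
    conv_rhs => rw [← Complex.re_add_im (((d i : ℂ) - z)⁻¹)]
    ring
  refine ⟨R₁ + Complex.I • R₂, ?_, fun v => ?_, fun v => ?_⟩
  · refine IsCompactOperator.add (isCompactOperator_weightedShift _ _ _ _ _ _ _ ?_)
      ((isCompactOperator_weightedShift _ _ _ _ _ _ _ ?_).smul Complex.I)
    · exact (Complex.continuous_re.tendsto 0).comp hlim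
    · exact (Complex.continuous_im.tendsto 0).comp hlim
  · obtain ⟨h, e⟩ := diagOp_eq_of_forall d (v := (R₁ + Complex.I • R₂) v)
      (w := v + z • (R₁ + Complex.I • R₂) v) (fun i => by
        rw [lp.coeFn_add, lp.coeFn_smul, Pi.add_apply, Pi.smul_apply, hR, smul_eq_mul]
        have := hne i
        field_simp
        ring)
    exact ⟨h, by rw [e, add_sub_cancel_right]⟩
  · ext i
    rw [hR, lp.coeFn_sub, lp.coeFn_smul, Pi.sub_apply, Pi.smul_apply, diagOp_apply, smul_eq_mul]
    have := hne i
    field_simp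

end Diagonal

/-! ### Integer labels and factorized coefficients -/

section Coefficients

/-- The basis vector with integer labels `(N, x, y)`, zero if the labels are out of range. -/
def ez (N x y : ℤ) : Hq :=
  if 0 ≤ x ∧ x ≤ N ∧ 0 ≤ y ∧ y ≤ N then e N.toNat x.toNat y.toNat else 0

theorem ez_of_not {N x y : ℤ} (h : ¬ (0 ≤ x ∧ x ≤ N ∧ 0 ≤ y ∧ y ≤ N)) : ez N x y = 0 :=
  if_neg h

theorem ez_natCast (p : Idx) : ez p.1.1 p.1.2.1 p.1.2.2 = basisVec p := by
  have := p.2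
  rw [ez, if_pos (by omega), e, dif_pos (by simpa using this)]
  rfl

theorem ez_induction {P : ℤ → ℤ → ℤ → Prop} (h : ∀ p : Idx, P p.1.1 p.1.2.1 p.1.2.2)
    {N x y : ℤ} (hr : 0 ≤ x ∧ x ≤ N ∧ 0 ≤ y ∧ y ≤ N) : P N x y := by
  have := h ⟨(N.toNat, x.toNat, y.toNat), ⟨by dsimp only; omega, by dsimp only; omega⟩⟩
  simpa [Int.toNat_of_nonneg hr.1, Int.toNat_of_nonneg hr.2.2.1,
    Int.toNat_of_nonneg (hr.1.trans hr.2.1)] using this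

/-- The formula extends to all integer labels because, by `h0`, the weight vanishes whenever an
out-of-range vector would be sent into the range. -/
theorem weightedShift_up_ez (u v : Fin 2) (c : Idx → ℝ) (C : ℝ) (hc : ∀ k, |c k| ≤ C)
    (f : ℤ → ℤ → ℤ → ℝ) (hf : ∀ p : Idx, c p = f p.1.1 p.1.2.1 p.1.2.2)
    (h0 : ∀ N x y : ℤ, ¬ (0 ≤ x ∧ x ≤ N ∧ 0 ≤ y ∧ y ≤ N) →
      0 ≤ x + u.1 ∧ x + u.1 ≤ N + 1 ∧ 0 ≤ y + v.1 ∧ y + v.1 ≤ N + 1 → f N x y = 0)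
    (N x y : ℤ) :
    weightedShift id (up u v) Function.injective_id (up_injective u v) c C hc (ez N x y) =
      (f N x y : ℂ) • ez (N + 1) (x + u.1) (y + v.1) := by
  by_cases hr : 0 ≤ x ∧ x ≤ N ∧ 0 ≤ y ∧ y ≤ N
  · refine ez_induction (P := fun N x y => weightedShift id (up u v) Function.injective_id
      (up_injective u v) c C hc (ez N x y) = (f N x y : ℂ) • ez (N + 1) (x + u.1) (y + v.1))
      (fun p => ?_) hr
    have h1 := weightedShift_basisVec id (up u v) Function.injective_id (up_injective u v) c C hc p
    rw [id, ← ez_natCast, ← ez_natCast, hf] at h1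
    simpa [up] using h1
  · rw [ez_of_not hr, map_zero]
    by_cases hr' : 0 ≤ x + u.1 ∧ x + u.1 ≤ N + 1 ∧ 0 ≤ y + v.1 ∧ y + v.1 ≤ N + 1
    · simp [h0 N x y hr hr']
    · rw [ez_of_not hr', smul_zero]

/-- No vanishing condition is needed here: the weight is indexed by the target, and multiplies zero
when the target is out of range. -/
theorem weightedShift_down_ez (u v : Fin 2) (c : Idx → ℝ) (C : ℝ) (hc : ∀ k, |c k| ≤ C)
    (f : ℤ → ℤ → ℤ → ℝ) (hf : ∀ p : Idx, c p = f p.1.1 p.1.2.1 p.1.2.2) (N x y : ℤ) :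
    weightedShift (up u v) id (up_injective u v) Function.injective_id c C hc (ez N x y) =
      (f (N - 1) (x - u.1) (y - v.1) : ℂ) • ez (N - 1) (x - u.1) (y - v.1) := by
  by_cases hr : 0 ≤ x - u.1 ∧ x - u.1 ≤ N - 1 ∧ 0 ≤ y - v.1 ∧ y - v.1 ≤ N - 1
  · have key := ez_induction (P := fun N x y => weightedShift (up u v) id (up_injective u v)
      Function.injective_id c C hc (ez (N + 1) (x + u.1) (y + v.1)) = (f N x y : ℂ) • ez N x y)
      (fun p => by
        have h1 := weightedShift_basisVec (up u v) id (up_injective u v) Function.injective_id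
          c C hc p
        rw [id, ← ez_natCast, ← ez_natCast, hf] at h1
        simpa [up] using h1) hr
    simpa using key
  · rw [ez_of_not hr, smul_zero]
    by_cases hr' : 0 ≤ x ∧ x ≤ N ∧ 0 ≤ y ∧ y ≤ N
    · refine ez_induction (P := fun N x y => ¬ (0 ≤ x - u.1 ∧ x - u.1 ≤ N - 1 ∧ 0 ≤ y - v.1 ∧
        y - v.1 ≤ N - 1) → weightedShift (up u v) id (up_injective u v)
        Function.injective_id c C hc (ez N x y) = 0) (fun p hp => ?_) hr' hr
      rw [ez_natCast]
      refine weightedShift_basisVec_of_notMem _ _ _ _ _ _ _ _ fun k hk => hp ?_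
      have := k.2
      rw [← hk]
      simp only [up]
      push_cast
      omega
    · rw [ez_of_not hr', map_zero]

variable (q : ℝ)

/-- `√(1 - q^{2m})`. -/
def qsqrt (m : ℤ) : ℝ := √(1 - q ^ (2 * m))

/-- The coefficient `a₊` with integer labels. -/
def zaPlus (N x y : ℤ) : ℝ :=
  q ^ (x + y + 1) * qsqrt q (N - y + 1) * qsqrt q (N - x + 1) /
    (qsqrt q (N + 1) * qsqrt q (N + 2))

/-- The coefficient `a₋` with integer labels. -/
def zaMinus (N x y : ℤ) : ℝ :=
  qsqrt q y * qsqrt q x / (qsqrt q N * qsqrt q (N + 1))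

/-- The coefficient `b₊` with integer labels. -/
def zbPlus (N x y : ℤ) : ℝ :=
  -(q ^ y * qsqrt q (N - y + 1) * qsqrt q (x + 1) / (qsqrt q (N + 1) * qsqrt q (N + 2)))

/-- The coefficient `b₋` with integer labels. -/
def zbMinus (N x y : ℤ) : ℝ :=
  q ^ x * qsqrt q y * qsqrt q (N - x) / (qsqrt q N * qsqrt q (N + 1))

variable {q}

theorem qsqrt_zero : qsqrt q 0 = 0 := by simp [qsqrt]

theorem one_sub_zpow_nonneg (hq : q ∈ Set.Ioo (0 : ℝ) 1) {m : ℤ} (hm : 0 ≤ m) :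
    0 ≤ 1 - q ^ (2 * m) := by
  lift m to ℕ using hm
  rw [← Nat.cast_ofNat, ← Nat.cast_mul, zpow_natCast]
  exact sub_nonneg.2 (pow_le_one₀ hq.1.le hq.2.le)

theorem qsqrt_sq (hq : q ∈ Set.Ioo (0 : ℝ) 1) {m : ℤ} (hm : 0 ≤ m) :
    qsqrt q m ^ 2 = 1 - (q ^ m) ^ 2 := by
  rw [qsqrt, Real.sq_sqrt (one_sub_zpow_nonneg hq hm), mul_comm, zpow_mul, zpow_ofNat]

theorem qsqrt_pos (hq : q ∈ Set.Ioo (0 : ℝ) 1) {m : ℤ} (hm : 0 < m) : 0 < qsqrt q m := by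
  refine Real.sqrt_pos.2 ?_
  lift m to ℕ using hm.le
  rw [← Nat.cast_ofNat, ← Nat.cast_mul, zpow_natCast]
  exact sub_pos.2 (pow_lt_one₀ hq.1.le hq.2 (by omega))

theorem qsqrt_natCast (m : ℕ) : qsqrt q m = √(1 - q ^ (2 * m)) := by
  rw [qsqrt, ← zpow_natCast]
  simp

/-- The common shape of the four coefficients. Splitting the root turns products of coefficients
into monomials in the `qsqrt`. -/
theorem sqrt_four (hq : q ∈ Set.Ioo (0 : ℝ) 1) (k a b c d : ℕ) :
    √(q ^ (2 * k) * ((1 - q ^ (2 * a)) * (1 - q ^ (2 * b))) /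
      ((1 - q ^ (2 * c)) * (1 - q ^ (2 * d)))) =
    q ^ (k : ℤ) * qsqrt q a * qsqrt q b / (qsqrt q c * qsqrt q d) := by
  have h : ∀ m : ℕ, 0 ≤ 1 - q ^ (2 * m) := fun m =>
    sub_nonneg.2 (pow_le_one₀ hq.1.le hq.2.le)
  have h0 : 0 ≤ q ^ (2 * k) := pow_nonneg hq.1.le _
  simp only [qsqrt_natCast]
  rw [Real.sqrt_div (mul_nonneg h0 (mul_nonneg (h a) (h b))), Real.sqrt_mul h0,
    Real.sqrt_mul (h a), Real.sqrt_mul (h c), mul_comm 2 k, pow_mul,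
    Real.sqrt_sq (pow_nonneg hq.1.le k), zpow_natCast, mul_assoc]

theorem aPlus_eq (hq : q ∈ Set.Ioo (0 : ℝ) 1) (p : Idx) :
    aPlus q p.1.1 p.1.2.1 p.1.2.2 = zaPlus q p.1.1 p.1.2.1 p.1.2.2 := by
  have := p.2
  have h := sqrt_four hq (p.1.2.1 + p.1.2.2 + 1) (p.1.1 - p.1.2.2 + 1) (p.1.1 - p.1.2.1 + 1)
    (p.1.1 + 1) (p.1.1 + 2)
  push_cast [Nat.cast_sub this.1, Nat.cast_sub this.2] at h
  rw [aPlus, zaPlus, ← h]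
  ring_nf

theorem aMinus_eq (hq : q ∈ Set.Ioo (0 : ℝ) 1) (N x y : ℕ) :
    aMinus q N x y = zaMinus q N x y := by
  have h := sqrt_four hq 0 y x N (N + 1)
  push_cast at h
  rw [aMinus, zaMinus]
  simp only [pow_zero, one_mul, zpow_zero] at h
  rw [← h]
  ring_nf

theorem bPlus_eq (hq : q ∈ Set.Ioo (0 : ℝ) 1) (p : Idx) :
    bPlus q p.1.1 p.1.2.1 p.1.2.2 = zbPlus q p.1.1 p.1.2.1 p.1.2.2 := by
  have := p.2
  have h := sqrt_four hq p.1.2.2 (p.1.1 - p.1.2.2 + 1) (p.1.2.1 + 1)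
    (p.1.1 + 1) (p.1.1 + 2)
  push_cast [Nat.cast_sub this.2] at h
  rw [bPlus, zbPlus, ← h]
  ring_nf

theorem bMinus_eq (hq : q ∈ Set.Ioo (0 : ℝ) 1) (N x y : ℕ) (hx : x ≤ N) :
    bMinus q N x y = zbMinus q N x y := by
  have h := sqrt_four hq x y (N - x) N (N + 1)
  push_cast [Nat.cast_sub hx] at h
  rw [bMinus, zbMinus, ← h]
  ring_nf

end Coefficients

/-! ### Action of the generators and their adjoints on integer labels -/

section Generators

variable (q : Set.Ioo (0 : ℝ) 1)

theorem qsqrt_eq_zero {q : ℝ} {m : ℤ} (h : m = 0) : qsqrt q m = 0 := by rw [h, qsqrt_zero]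

/-- At a label just outside the range one of the factors in the numerator is `qsqrt q 0`. -/
theorem zaPlus_eq_zero {q : ℝ} (N x y : ℤ) (h : ¬ (0 ≤ x ∧ x ≤ N ∧ 0 ≤ y ∧ y ≤ N))
    (h' : 0 ≤ x ∧ x ≤ N + 1 ∧ 0 ≤ y ∧ y ≤ N + 1) : zaPlus q N x y = 0 := by
  rw [zaPlus]
  rcases (by omega : N - y + 1 = 0 ∨ N - x + 1 = 0) with h | h <;> simp [qsqrt_eq_zero h]

theorem zaMinus_eq_zero {q : ℝ} (N x y : ℤ) (h : ¬ (0 ≤ x ∧ x ≤ N ∧ 0 ≤ y ∧ y ≤ N))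
    (h' : 0 ≤ x + 1 ∧ x + 1 ≤ N + 1 ∧ 0 ≤ y + 1 ∧ y + 1 ≤ N + 1) :
    zaMinus q (N + 1) (x + 1) (y + 1) = 0 := by
  rw [zaMinus]
  rcases (by omega : x + 1 = 0 ∨ y + 1 = 0) with h | h <;> simp [qsqrt_eq_zero h]

theorem zbPlus_eq_zero {q : ℝ} (N x y : ℤ) (h : ¬ (0 ≤ x ∧ x ≤ N ∧ 0 ≤ y ∧ y ≤ N))
    (h' : 0 ≤ x + 1 ∧ x + 1 ≤ N + 1 ∧ 0 ≤ y ∧ y ≤ N + 1) :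
    zbPlus q N x y = 0 := by
  rw [zbPlus]
  rcases (by omega : N - y + 1 = 0 ∨ x + 1 = 0) with h | h <;> simp [qsqrt_eq_zero h]

theorem zbMinus_eq_zero {q : ℝ} (N x y : ℤ) (h : ¬ (0 ≤ x ∧ x ≤ N ∧ 0 ≤ y ∧ y ≤ N))
    (h' : 0 ≤ x ∧ x ≤ N + 1 ∧ 0 ≤ y + 1 ∧ y + 1 ≤ N + 1) :
    zbMinus q (N + 1) x (y + 1) = 0 := by
  rw [zbMinus]
  rcases (by omega : N + 1 - x = 0 ∨ y + 1 = 0) with h | h <;> simp [qsqrt_eq_zero h]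

theorem alpha_ez (N x y : ℤ) : alpha q (ez N x y) =
    (zaPlus q N x y : ℂ) • ez (N + 1) x y + (zaMinus q N x y : ℂ) • ez (N - 1) (x - 1) (y - 1) := by
  rw [alpha, add_apply]
  congr 1
  · simpa using weightedShift_up_ez 0 0 _ _ _ (zaPlus q) (aPlus_eq q.2)
      (by simpa using zaPlus_eq_zero) N x y
  · simpa using weightedShift_down_ez 1 1 _ _ _ (fun N x y => zaMinus q (N + 1) (x + 1) (y + 1))
      (fun p => by rw [aMinus_eq q.2]; push_cast; rfl) N x y

theorem star_alpha_ez (N x y : ℤ) : star (alpha q) (ez N x y) =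
    (zaPlus q (N - 1) x y : ℂ) • ez (N - 1) x y +
      (zaMinus q (N + 1) (x + 1) (y + 1) : ℂ) • ez (N + 1) (x + 1) (y + 1) := by
  rw [alpha, star_add, star_weightedShift, star_weightedShift, add_apply]
  congr 1
  · simpa using weightedShift_down_ez 0 0 _ _ _ (zaPlus q) (aPlus_eq q.2) N x y
  · simpa using weightedShift_up_ez 1 1 _ _ _ (fun N x y => zaMinus q (N + 1) (x + 1) (y + 1))
      (fun p => by rw [aMinus_eq q.2]; push_cast; rfl) (by simpa using zaMinus_eq_zero) N x y

theorem beta_ez (N x y : ℤ) : beta q (ez N x y) =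
    (zbPlus q N x y : ℂ) • ez (N + 1) (x + 1) y + (zbMinus q N x y : ℂ) • ez (N - 1) x (y - 1) := by
  rw [beta, add_apply]
  congr 1
  · simpa using weightedShift_up_ez 1 0 _ _ _ (zbPlus q) (bPlus_eq q.2)
      (by simpa using zbPlus_eq_zero) N x y
  · simpa using weightedShift_down_ez 0 1 _ _ _ (fun N x y => zbMinus q (N + 1) x (y + 1))
      (fun p => by have := p.2; rw [bMinus_eq q.2 _ _ _ (by omega)]; push_cast; rfl) N x y

theorem star_beta_ez (N x y : ℤ) : star (beta q) (ez N x y) =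
    (zbPlus q (N - 1) (x - 1) y : ℂ) • ez (N - 1) (x - 1) y +
      (zbMinus q (N + 1) x (y + 1) : ℂ) • ez (N + 1) x (y + 1) := by
  rw [beta, star_add, star_weightedShift, star_weightedShift, add_apply]
  congr 1
  · simpa using weightedShift_down_ez 1 0 _ _ _ (zbPlus q) (bPlus_eq q.2) N x y
  · simpa using weightedShift_up_ez 0 1 _ _ _ (fun N x y => zbMinus q (N + 1) x (y + 1))
      (fun p => by have := p.2; rw [bMinus_eq q.2 _ _ _ (by omega)]; push_cast; rfl)
      (by simpa using zbMinus_eq_zero) N x y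

theorem ext_ez {T S : Hq →L[ℂ] Hq}
    (h : ∀ N x y : ℤ, 0 ≤ x ∧ x ≤ N ∧ 0 ≤ y ∧ y ≤ N → T (ez N x y) = S (ez N x y)) : T = S := by
  refine ext_basisVec fun p => ?_
  have := p.2
  rw [← ez_natCast]
  exact h _ _ _ (by omega)

end Generators

/-! ### The relations of `SU_q(2)` -/

section Relations

variable {q : ℝ}

theorem zpow_ne_one (hq : q ∈ Set.Ioo (0 : ℝ) 1) {m : ℤ} (hm : 0 < m) : 1 - (q ^ m) ^ 2 ≠ 0 := by
  rw [← qsqrt_sq hq hm.le]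
  exact pow_ne_zero 2 (qsqrt_pos hq hm).ne'

/-- The off-diagonal coefficients of `α*α` and `β*β` cancel. -/
theorem zaPlus_mul_zaMinus (hq : q ∈ Set.Ioo (0 : ℝ) 1) (N x y : ℤ) :
    zaPlus q N x y * zaMinus q (N + 2) (x + 1) (y + 1) =
      -(zbPlus q N x y * zbMinus q (N + 2) (x + 1) (y + 1)) := by
  rw [zaPlus, zaMinus, zbPlus, zbMinus, show N + 2 - (x + 1) = N - x + 1 by ring]
  simp only [zpow_add₀ hq.1.ne', zpow_one]
  ring

/-- The off-diagonal coefficients of `αα*` and `ββ*`. -/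
theorem zaPlus_mul_zaMinus_same (hq : q ∈ Set.Ioo (0 : ℝ) 1) (N x y : ℤ) :
    zaPlus q N x y * zaMinus q N x y = -(q ^ 2 * (zbPlus q N (x - 1) y * zbMinus q N (x - 1) y)) := by
  rw [zaPlus, zaMinus, zbPlus, zbMinus, show N - (x - 1) = N - x + 1 by ring, sub_add_cancel]
  simp only [zpow_add₀ hq.1.ne', zpow_sub₀ hq.1.ne', zpow_one]
  have := hq.1.ne'
  field_simp

/-- The off-diagonal coefficients of `β*β` and `ββ*`. -/
theorem zbPlus_mul_zbMinus (hq : q ∈ Set.Ioo (0 : ℝ) 1) (N x y : ℤ) :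
    zbPlus q N x y * zbMinus q (N + 2) (x + 1) (y + 1) =
      zbPlus q (N + 1) x (y + 1) * zbMinus q (N + 1) x (y + 1) := by
  simp only [zbPlus, zbMinus]
  rw [show N + 2 - (x + 1) = N - x + 1 by ring, show N + 1 - x = N - x + 1 by ring,
    show N + 1 - (y + 1) + 1 = N - y + 1 by ring, show N + 1 + 1 = N + 2 by ring,
    show N + 1 + 2 = N + 2 + 1 by ring]
  simp only [zpow_add₀ hq.1.ne', zpow_one]
  ring

section Squares

variable (hq : q ∈ Set.Ioo (0 : ℝ) 1) {N x y : ℤ}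
include hq

theorem zaPlus_sq (hx : x ≤ N + 1) (hy : y ≤ N + 1) (hN : 0 ≤ N + 1) :
    zaPlus q N x y ^ 2 = (q * q ^ x * q ^ y) ^ 2 * (1 - (q ^ N / q ^ y * q) ^ 2) *
      (1 - (q ^ N / q ^ x * q) ^ 2) / ((1 - (q ^ N * q) ^ 2) * (1 - (q ^ N * q ^ 2) ^ 2)) := by
  rw [zaPlus, div_pow, mul_pow, mul_pow, mul_pow (qsqrt _ _), qsqrt_sq hq (by omega),
    qsqrt_sq hq (by omega), qsqrt_sq hq (by omega), qsqrt_sq hq (by omega)]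
  simp only [zpow_add₀ hq.1.ne', zpow_sub₀ hq.1.ne', zpow_ofNat, pow_one]
  ring

theorem zaMinus_sq (hx : 0 ≤ x) (hy : 0 ≤ y) (hN : 0 ≤ N) :
    zaMinus q N x y ^ 2 = (1 - (q ^ y) ^ 2) * (1 - (q ^ x) ^ 2) /
      ((1 - (q ^ N) ^ 2) * (1 - (q ^ N * q) ^ 2)) := by
  rw [zaMinus, div_pow, mul_pow, mul_pow, qsqrt_sq hq (by omega),
    qsqrt_sq hq (by omega), qsqrt_sq hq (by omega), qsqrt_sq hq (by omega)]
  simp only [zpow_add₀ hq.1.ne', zpow_one]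

theorem zbPlus_sq (hx : 0 ≤ x + 1) (hy : y ≤ N + 1) (hN : 0 ≤ N + 1) :
    zbPlus q N x y ^ 2 = (q ^ y) ^ 2 * (1 - (q ^ N / q ^ y * q) ^ 2) *
      (1 - (q ^ x * q) ^ 2) / ((1 - (q ^ N * q) ^ 2) * (1 - (q ^ N * q ^ 2) ^ 2)) := by
  rw [zbPlus, neg_sq, div_pow, mul_pow, mul_pow, mul_pow (qsqrt _ _), qsqrt_sq hq (by omega),
    qsqrt_sq hq (by omega), qsqrt_sq hq (by omega), qsqrt_sq hq (by omega)]
  simp only [zpow_add₀ hq.1.ne', zpow_sub₀ hq.1.ne', zpow_ofNat, pow_one]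

theorem zbMinus_sq (hx : x ≤ N) (hy : 0 ≤ y) (hN : 0 ≤ N) :
    zbMinus q N x y ^ 2 = (q ^ x) ^ 2 * (1 - (q ^ y) ^ 2) * (1 - (q ^ N / q ^ x) ^ 2) /
      ((1 - (q ^ N) ^ 2) * (1 - (q ^ N * q) ^ 2)) := by
  rw [zbMinus, div_pow, mul_pow, mul_pow, mul_pow (qsqrt _ _), qsqrt_sq hq (by omega),
    qsqrt_sq hq (by omega), qsqrt_sq hq (by omega), qsqrt_sq hq (by omega)]
  simp only [zpow_add₀ hq.1.ne', zpow_sub₀ hq.1.ne', zpow_one]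

theorem denominators_ne_zero (hN : 0 ≤ N) :
    1 - (q ^ N * q) ^ 2 ≠ 0 ∧ 1 - (q ^ N * q ^ 2) ^ 2 ≠ 0 ∧ 1 - (q ^ N * q ^ 3) ^ 2 ≠ 0 := by
  have h1 := zpow_ne_one hq (m := N + 1) (by omega)
  have h2 := zpow_ne_one hq (m := N + 2) (by omega)
  have h3 := zpow_ne_one hq (m := N + 3) (by omega)
  simp only [zpow_add₀ hq.1.ne', zpow_ofNat, pow_one] at h1 h2 h3
  exact ⟨h1, h2, h3⟩

/-- The diagonal coefficient of `α*α + β*β`. -/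
theorem sum_squares (hr : 0 ≤ x ∧ x ≤ N ∧ 0 ≤ y ∧ y ≤ N) :
    zaPlus q N x y ^ 2 + zaMinus q N x y ^ 2 + zbPlus q N x y ^ 2 + zbMinus q N x y ^ 2 = 1 := by
  obtain ⟨h1, h2, -⟩ := denominators_ne_zero hq (N := N) (by omega)
  have hx := (zpow_pos hq.1 x).ne'
  have hy := (zpow_pos hq.1 y).ne'
  rw [zaPlus_sq hq, zaMinus_sq hq, zbPlus_sq hq, zbMinus_sq hq] <;> try omega
  -- At `N = 0` a denominator is zero; the quotients involved are then zero, in agreement with the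
  -- convention on `a₋` and `b₋`.
  rcases (by omega : N = 0 ∨ 0 < N) with rfl | hN
  · obtain rfl : x = 0 := by omega
    obtain rfl : y = 0 := by omega
    simp only [zpow_zero] at h1 h2 ⊢
    simp only [one_pow, sub_self, zero_mul, mul_zero, zero_div, add_zero, one_mul, mul_one,
      div_one] at h1 h2 ⊢
    generalize hd1 : 1 - q ^ 2 = d₁ at *
    generalize hd2 : 1 - (q ^ 2) ^ 2 = d₂ at *
    field_simp
    subst hd1 hd2
    ring
  · have h0 := zpow_ne_one hq hN
    generalize q ^ N = c at *
    generalize q ^ x = a at *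
    generalize q ^ y = b at *
    -- The denominators are made atoms while fractions are cleared, and put back for the final
    -- polynomial identity.
    generalize hd0 : 1 - c ^ 2 = d₀ at *
    generalize hd1 : 1 - (c * q) ^ 2 = d₁ at *
    generalize hd2 : 1 - (c * q ^ 2) ^ 2 = d₂ at *
    field_simp
    subst hd0 hd1 hd2
    ring

/-- The diagonal coefficient of `αα* + q²ββ*`. -/
theorem sum_squares' (hr : 0 ≤ x ∧ x ≤ N ∧ 0 ≤ y ∧ y ≤ N) :
    zaPlus q (N - 1) x y ^ 2 + zaMinus q (N + 1) (x + 1) (y + 1) ^ 2 +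
      q ^ 2 * (zbPlus q (N - 1) (x - 1) y ^ 2 + zbMinus q (N + 1) x (y + 1) ^ 2) = 1 := by
  obtain ⟨h1, h2, -⟩ := denominators_ne_zero hq (N := N) (by omega)
  have hx := (zpow_pos hq.1 x).ne'
  have hy := (zpow_pos hq.1 y).ne'
  have h := hq.1.ne'
  rw [zaPlus_sq hq, zaMinus_sq hq, zbPlus_sq hq, zbMinus_sq hq] <;> try omega
  simp only [zpow_add₀ hq.1.ne', zpow_sub₀ hq.1.ne', zpow_one]
  rcases (by omega : N = 0 ∨ 0 < N) with rfl | hN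
  · obtain rfl : x = 0 := by omega
    obtain rfl : y = 0 := by omega
    simp only [zpow_zero] at h1 h2 ⊢
    have h3 : 1 - (1 / q * q) ^ 2 = 0 := by field_simp; ring
    simp only [h3, one_pow, zero_mul, mul_zero, zero_div, zero_add, one_mul, mul_one, div_one]
      at h1 h2 ⊢
    rw [← sq q]
    generalize hd1 : 1 - q ^ 2 = d₁ at *
    generalize hd2 : 1 - (q ^ 2) ^ 2 = d₂ at *
    field_simp
    subst hd1 hd2
    ring
  · have h0 := zpow_ne_one hq hN
    have h3 : q ^ N / q * q = q ^ N := by field_simp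
    have h4 : q ^ N / q * q ^ 2 = q ^ N * q := by field_simp
    have h5 : q ^ N * q * q = q ^ N * q ^ 2 := by ring
    rw [h3, h4, h5]
    generalize q ^ N = c at *
    generalize q ^ x = a at *
    generalize q ^ y = b at *
    generalize hd0 : 1 - c ^ 2 = d₀ at *
    generalize hd1 : 1 - (c * q) ^ 2 = d₁ at *
    generalize hd2 : 1 - (c * q ^ 2) ^ 2 = d₂ at *
    field_simp
    subst hd0 hd1 hd2
    ring

/-- The diagonal coefficients of `β*β` and `ββ*`. -/
theorem sum_squares_normal (hr : 0 ≤ x ∧ x ≤ N ∧ 0 ≤ y ∧ y ≤ N) :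
    zbPlus q N x y ^ 2 + zbMinus q N x y ^ 2 =
      zbPlus q (N - 1) (x - 1) y ^ 2 + zbMinus q (N + 1) x (y + 1) ^ 2 := by
  obtain ⟨h1, h2, -⟩ := denominators_ne_zero hq (N := N) (by omega)
  have hx := (zpow_pos hq.1 x).ne'
  have hy := (zpow_pos hq.1 y).ne'
  have h := hq.1.ne'
  rw [zbPlus_sq hq, zbMinus_sq hq, zbPlus_sq hq, zbMinus_sq hq] <;> try omega
  simp only [zpow_add₀ hq.1.ne', zpow_sub₀ hq.1.ne', zpow_one]
  rcases (by omega : N = 0 ∨ 0 < N) with rfl | hN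
  · obtain rfl : x = 0 := by omega
    obtain rfl : y = 0 := by omega
    simp only [zpow_zero] at h1 h2 ⊢
    have h3 : 1 - (1 / q * q) ^ 2 = 0 := by field_simp; ring
    simp only [h3, one_pow, zero_mul, mul_zero, zero_div, zero_add, one_mul, div_one,
      sub_self, add_zero] at h1 h2 ⊢
    rw [← sq q]
  · have h0 := zpow_ne_one hq hN
    have h3 : q ^ N / q * q = q ^ N := by field_simp
    have h4 : q ^ N / q * q ^ 2 = q ^ N * q := by field_simp
    have h5 : q ^ N * q * q = q ^ N * q ^ 2 := by ring
    rw [h3, h4, h5]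
    generalize q ^ N = c at *
    generalize q ^ x = a at *
    generalize q ^ y = b at *
    generalize hd0 : 1 - c ^ 2 = d₀ at *
    generalize hd1 : 1 - (c * q) ^ 2 = d₁ at *
    generalize hd2 : 1 - (c * q ^ 2) ^ 2 = d₂ at *
    field_simp
    subst hd0 hd1 hd2
    ring

/-- The middle coefficients of `αβ` and `qβα`. -/
theorem middle_alpha_beta (hr : 0 ≤ x ∧ x ≤ N ∧ 0 ≤ y - 1 ∧ y ≤ N) :
    zbPlus q N x y * zaMinus q (N + 1) (x + 1) y + zbMinus q N x y * zaPlus q (N - 1) x (y - 1) =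
      q * (zaPlus q N x y * zbMinus q (N + 1) x y +
        zaMinus q N x y * zbPlus q (N - 1) (x - 1) (y - 1)) := by
  obtain ⟨h1, h2, -⟩ := denominators_ne_zero hq (N := N) (by omega)
  have h0 := zpow_ne_one hq (m := N) (by omega)
  have hx := (zpow_pos hq.1 x).ne'
  have hy := (zpow_pos hq.1 y).ne'
  have h := hq.1.ne'
  -- The unpaired roots form a common factor; in the cofactor every root occurs squared, so a
  -- rational identity remains.
  have e : zbPlus q N x y * zaMinus q (N + 1) (x + 1) y +
      zbMinus q N x y * zaPlus q (N - 1) x (y - 1) -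
      q * (zaPlus q N x y * zbMinus q (N + 1) x y +
        zaMinus q N x y * zbPlus q (N - 1) (x - 1) (y - 1)) =
      qsqrt q y * qsqrt q (N - y + 1) * (
        -q ^ y * qsqrt q (x + 1) ^ 2 / (qsqrt q (N + 1) ^ 2 * qsqrt q (N + 2) ^ 2) +
        q ^ x * (q ^ x * q ^ y) * qsqrt q (N - x) ^ 2 / (qsqrt q N ^ 2 * qsqrt q (N + 1) ^ 2)
        - q * (q ^ x * q ^ y * q * q ^ x * qsqrt q (N - x + 1) ^ 2 /
          (qsqrt q (N + 1) ^ 2 * qsqrt q (N + 2) ^ 2) -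
          q ^ y / q * qsqrt q x ^ 2 / (qsqrt q N ^ 2 * qsqrt q (N + 1) ^ 2))) := by
    simp only [zaPlus, zaMinus, zbPlus, zbMinus]
    rw [show N + 1 + 1 = N + 2 by ring, show N - 1 - (y - 1) + 1 = N - y + 1 by ring,
      show N - 1 - x + 1 = N - x by ring, show N - 1 + 1 = N by ring,
      show N - 1 + 2 = N + 1 by ring, show N + 1 - x = N - x + 1 by ring,
      show x + (y - 1) + 1 = x + y by ring, show x - 1 + 1 = x by ring]
    simp only [zpow_add₀ hq.1.ne', zpow_sub₀ hq.1.ne', zpow_one]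
    ring
  rw [← sub_eq_zero, e]
  refine mul_eq_zero_of_right _ ?_
  rw [qsqrt_sq hq (by omega), qsqrt_sq hq (by omega), qsqrt_sq hq (by omega),
    qsqrt_sq hq (by omega), qsqrt_sq hq (by omega), qsqrt_sq hq (by omega),
    qsqrt_sq hq (by omega)]
  simp only [zpow_add₀ hq.1.ne', zpow_sub₀ hq.1.ne', zpow_ofNat, pow_one]
  generalize q ^ N = c at *
  generalize q ^ x = a at *
  generalize q ^ y = b at *
  generalize hd0 : 1 - c ^ 2 = d₀ at *
  generalize hd1 : 1 - (c * q) ^ 2 = d₁ at *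
  generalize hd2 : 1 - (c * q ^ 2) ^ 2 = d₂ at *
  field_simp
  subst hd0 hd1 hd2
  ring

/-- The middle coefficients of `αβ*` and `qβ*α`. -/
theorem middle_alpha_star_beta (hr : 0 ≤ x - 1 ∧ x ≤ N ∧ 0 ≤ y ∧ y ≤ N) :
    zbPlus q (N - 1) (x - 1) y * zaPlus q (N - 1) (x - 1) y +
        zbMinus q (N + 1) x (y + 1) * zaMinus q (N + 1) x (y + 1) =
      q * (zaPlus q N x y * zbPlus q N (x - 1) y +
        zaMinus q N x y * zbMinus q N (x - 1) y) := by
  obtain ⟨h1, h2, -⟩ := denominators_ne_zero hq (N := N) (by omega)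
  have h0 := zpow_ne_one hq (m := N) (by omega)
  have hx := (zpow_pos hq.1 x).ne'
  have hy := (zpow_pos hq.1 y).ne'
  have h := hq.1.ne'
  have e : zbPlus q (N - 1) (x - 1) y * zaPlus q (N - 1) (x - 1) y +
        zbMinus q (N + 1) x (y + 1) * zaMinus q (N + 1) x (y + 1) -
      q * (zaPlus q N x y * zbPlus q N (x - 1) y +
        zaMinus q N x y * zbMinus q N (x - 1) y) =
      qsqrt q x * qsqrt q (N - x + 1) * (
        -q ^ y * (q ^ x * q ^ y) * qsqrt q (N - y) ^ 2 / (qsqrt q N ^ 2 * qsqrt q (N + 1) ^ 2) +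
        q ^ x * qsqrt q (y + 1) ^ 2 / (qsqrt q (N + 1) ^ 2 * qsqrt q (N + 2) ^ 2)
        - q * (-(q ^ x * q ^ y * q) * q ^ y * qsqrt q (N - y + 1) ^ 2 /
          (qsqrt q (N + 1) ^ 2 * qsqrt q (N + 2) ^ 2) +
          q ^ x / q * qsqrt q y ^ 2 / (qsqrt q N ^ 2 * qsqrt q (N + 1) ^ 2))) := by
    simp only [zaPlus, zaMinus, zbPlus, zbMinus]
    rw [show N + 1 + 1 = N + 2 by ring, show N - 1 - (x - 1) + 1 = N - x + 1 by ring,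
      show N - 1 - y + 1 = N - y by ring, show N - 1 + 1 = N by ring,
      show N - 1 + 2 = N + 1 by ring, show N + 1 - x = N - x + 1 by ring,
      show N - (x - 1) = N - x + 1 by ring,
      show x - 1 + y + 1 = x + y by ring, show x - 1 + 1 = x by ring]
    simp only [zpow_add₀ hq.1.ne', zpow_sub₀ hq.1.ne', zpow_one]
    ring
  rw [← sub_eq_zero, e]
  refine mul_eq_zero_of_right _ ?_
  rw [qsqrt_sq hq (by omega), qsqrt_sq hq (by omega), qsqrt_sq hq (by omega),
    qsqrt_sq hq (by omega), qsqrt_sq hq (by omega), qsqrt_sq hq (by omega),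
    qsqrt_sq hq (by omega)]
  simp only [zpow_add₀ hq.1.ne', zpow_sub₀ hq.1.ne', zpow_ofNat, pow_one]
  generalize q ^ N = c at *
  generalize q ^ x = a at *
  generalize q ^ y = b at *
  generalize hd0 : 1 - c ^ 2 = d₀ at *
  generalize hd1 : 1 - (c * q) ^ 2 = d₁ at *
  generalize hd2 : 1 - (c * q ^ 2) ^ 2 = d₂ at *
  field_simp
  subst hd0 hd1 hd2
  ring

end Squares

section Operators

variable (q : Set.Ioo (0 : ℝ) 1)

/-- Identities between coefficients need only be checked where the basis vector is nonzero. -/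
theorem smul_ez_congr {c d : ℝ} {N x y : ℤ}
    (h : 0 ≤ x ∧ x ≤ N ∧ 0 ≤ y ∧ y ≤ N → c = d) : (c : ℂ) • ez N x y = (d : ℂ) • ez N x y := by
  by_cases hr : 0 ≤ x ∧ x ≤ N ∧ 0 ≤ y ∧ y ≤ N
  · rw [h hr]
  · rw [ez_of_not hr, smul_zero, smul_zero]

theorem star_alpha_mul_alpha :
    star (alpha q) * alpha q + star (beta q) * beta q = 1 := by
  refine ext_ez fun N x y hr => ?_
  -- The components that raise `N` by two, lower it by two and keep it are compared separately.
  have h1 := smul_ez_congr (N := N + 2) (x := x + 1) (y := y + 1)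
    fun _ => zaPlus_mul_zaMinus q.2 N x y
  have h2 := smul_ez_congr (N := N - 2) (x := x - 1) (y := y - 1)
    fun _ => zaPlus_mul_zaMinus q.2 (N - 2) (x - 1) (y - 1)
  have h3 := smul_ez_congr (N := N) (x := x) (y := y) fun hr => sum_squares q.2 hr
  simp only [sub_add_cancel] at h2
  simp only [add_apply, mul_apply_eq_comp, one_apply_eq_self, alpha_ez, beta_ez, map_add,
    map_smul, star_alpha_ez, star_beta_ez, add_sub_cancel_right, sub_add_cancel,
    show N + 1 + 1 = N + 2 by ring, show N - 1 - 1 = N - 2 by ring]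
  push_cast at h1 h2 h3
  linear_combination (norm := module) h1 + h2 + h3

theorem alpha_mul_star_alpha :
    alpha q * star (alpha q) + (((q : ℝ) ^ 2 : ℝ) : ℂ) • (beta q * star (beta q)) = 1 := by
  refine ext_ez fun N x y hr => ?_
  have h1 := smul_ez_congr (N := N + 2) (x := x + 1) (y := y + 1)
    fun _ => zaPlus_mul_zaMinus_same q.2 (N + 1) (x + 1) (y + 1)
  have h2 := smul_ez_congr (N := N - 2) (x := x - 1) (y := y - 1)
    fun _ => zaPlus_mul_zaMinus_same q.2 (N - 1) x y
  have h3 := smul_ez_congr (N := N) (x := x) (y := y) fun hr => sum_squares' q.2 hr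
  simp only [add_sub_cancel_right] at h1
  simp only [add_apply, smul_apply, mul_apply_eq_comp, one_apply_eq_self, alpha_ez, beta_ez, map_add,
    map_smul, star_alpha_ez, star_beta_ez, add_sub_cancel_right, sub_add_cancel,
    show N + 1 + 1 = N + 2 by ring, show N - 1 - 1 = N - 2 by ring]
  push_cast at h1 h2 h3 ⊢
  linear_combination (norm := module) h1 + h2 + h3

theorem star_beta_mul_beta : star (beta q) * beta q = beta q * star (beta q) := by
  refine ext_ez fun N x y hr => ?_
  have h1 := smul_ez_congr (N := N + 2) (x := x + 1) (y := y + 1)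
    fun _ => zbPlus_mul_zbMinus q.2 N x y
  have h2 := smul_ez_congr (N := N - 2) (x := x - 1) (y := y - 1)
    fun _ => zbPlus_mul_zbMinus q.2 (N - 2) (x - 1) (y - 1)
  have h3 := smul_ez_congr (N := N) (x := x) (y := y) fun hr => sum_squares_normal q.2 hr
  simp only [sub_add_cancel, show N - 2 + 1 = N - 1 by ring] at h2
  simp only [mul_apply_eq_comp, beta_ez, map_add,
    map_smul, star_beta_ez, add_sub_cancel_right, sub_add_cancel,
    show N + 1 + 1 = N + 2 by ring, show N - 1 - 1 = N - 2 by ring]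
  push_cast at h1 h2 h3 ⊢
  linear_combination (norm := module) h1 + h2 + h3

theorem alpha_mul_beta : alpha q * beta q - ((q : ℝ) : ℂ) • (beta q * alpha q) = 0 := by
  refine ext_ez fun N x y hr => ?_
  have hq := q.2.1.ne'
  have h1 := smul_ez_congr (N := N + 2) (x := x + 1) (y := y) (c := zbPlus q N x y *
      zaPlus q (N + 1) (x + 1) y) (d := q * (zaPlus q N x y * zbPlus q (N + 1) x y)) fun _ => by
    simp only [zaPlus, zbPlus]
    rw [show N + 1 - (x + 1) + 1 = N - x + 1 by ring]
    simp only [zpow_add₀ hq, zpow_one]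
    ring
  have h2 := smul_ez_congr (N := N - 2) (x := x - 1) (y := y - 1 - 1) (c := zbMinus q N x y *
      zaMinus q (N - 1) x (y - 1)) (d := q * (zaMinus q N x y * zbMinus q (N - 1) (x - 1) (y - 1)))
      fun _ => by
    simp only [zaMinus, zbMinus]
    rw [show N - 1 - (x - 1) = N - x by ring]
    simp only [zpow_sub₀ hq, zpow_one]
    field_simp
  have h3 := smul_ez_congr (N := N) (x := x) (y := y - 1) fun hr' =>
    middle_alpha_beta q.2 (N := N) (x := x) (y := y) (by omega)
  simp only [sub_apply, smul_apply, zero_apply, mul_apply_eq_comp, beta_ez, alpha_ez, map_add,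
    map_smul, add_sub_cancel_right, sub_add_cancel,
    show N + 1 + 1 = N + 2 by ring, show N - 1 - 1 = N - 2 by ring]
  push_cast at h1 h2 h3 ⊢
  linear_combination (norm := module) h1 + h2 + h3

theorem alpha_mul_star_beta :
    alpha q * star (beta q) - ((q : ℝ) : ℂ) • (star (beta q) * alpha q) = 0 := by
  refine ext_ez fun N x y hr => ?_
  have hq := q.2.1.ne'
  have h1 := smul_ez_congr (N := N + 2) (x := x) (y := y + 1) (c := zbMinus q (N + 1) x (y + 1) *
      zaPlus q (N + 1) x (y + 1)) (d := q * (zaPlus q N x y * zbMinus q (N + 2) x (y + 1)))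
      fun _ => by
    simp only [zaPlus, zbMinus]
    rw [show N + 1 - (y + 1) + 1 = N - y + 1 by ring, show N + 1 - x + 1 = N + 2 - x by ring,
      show N + 1 - x = N - x + 1 by ring, show N + 1 + 1 = N + 2 by ring,
      show N + 1 + 2 = N + 2 + 1 by ring]
    simp only [zpow_add₀ hq, zpow_one]
    ring
  have h2 := smul_ez_congr (N := N - 2) (x := x - 1 - 1) (y := y - 1)
      (c := zbPlus q (N - 1) (x - 1) y * zaMinus q (N - 1) (x - 1) y)
      (d := q * (zaMinus q N x y * zbPlus q (N - 2) (x - 1 - 1) (y - 1)))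
      fun _ => by
    simp only [zaMinus, zbPlus]
    rw [show N - 2 - (y - 1) + 1 = N - y by ring, show N - 2 + 1 = N - 1 by ring,
      show N - 2 + 2 = N by ring, show N - 1 - y + 1 = N - y by ring,
      show N - 1 + 2 = N + 1 by ring, show x - 1 - 1 + 1 = x - 1 by ring, show N - 1 + 1 = N by ring, show x - 1 + 1 = x by ring]
    simp only [zpow_sub₀ hq, zpow_one]
    field_simp
  have h3 := smul_ez_congr (N := N) (x := x - 1) (y := y) fun hr' =>
    middle_alpha_star_beta q.2 (N := N) (x := x) (y := y) (by omega)
  simp only [sub_apply, smul_apply, zero_apply, mul_apply_eq_comp, star_beta_ez, alpha_ez, map_add,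
    map_smul, add_sub_cancel_right, sub_add_cancel,
    show N + 1 + 1 = N + 2 by ring, show N - 1 - 1 = N - 2 by ring]
  push_cast at h1 h2 h3 ⊢
  linear_combination (norm := module) h1 + h2 + h3

theorem relations : SUqRelations (q : ℝ) (alpha q) (beta q) where
  star_a_a := star_alpha_mul_alpha q
  a_star_a := alpha_mul_star_alpha q
  a_b := alpha_mul_beta q
  a_star_b := alpha_mul_star_beta q
  normal_b := star_beta_mul_beta q

end Operators

end Relations

/-! ### Contracting neighbouring letters in words -/

section Words

variable {R : Type*} [Ring R]

theorem alternating_telescope (n : ℕ) (v : Fin (n + 2) → ℂ) :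
    ∑ j : Fin (n + 1), (-1 : ℂ) ^ (j : ℕ) * (v j.castSucc + v j.succ) =
      v 0 + (-1) ^ n * v (Fin.last (n + 1)) := by
  induction n with
  | zero => simp
  | succ n ih =>
    rw [Fin.sum_univ_castSucc]
    have := ih fun j => v j.castSucc
    simp only [Fin.val_castSucc, Fin.castSucc_zero, Fin.succ_castSucc, Fin.val_last,
      Fin.succ_last] at this ⊢
    rw [this]
    ring

/-- Viewing a contraction as an update of the word with one letter deleted lets multilinearity act
on the contracted slot. -/
theorem contractNth_eq_update {n : ℕ} (j : Fin (n + 1)) (a : Fin (n + 2) → R) :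
    Fin.contractNth j.castSucc (· * ·) a =
      Function.update (fun i => a (j.castSucc.succAbove i)) j (a j.castSucc * a j.succ) := by
  funext i
  rcases lt_trichotomy (i : ℕ) j with h | h | h
  · rw [Fin.contractNth_apply_of_lt _ _ _ _ (by simpa using h),
      Function.update_of_ne (by rintro rfl; omega), Fin.succAbove_of_castSucc_lt _ _
        (show i.castSucc < j.castSucc from h)]
  · obtain rfl : i = j := Fin.ext h
    rw [Fin.contractNth_apply_of_eq _ _ _ _ (by simp), Function.update_self]
  · rw [Fin.contractNth_apply_of_gt _ _ _ _ (by simpa using h),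
      Function.update_of_ne (by rintro rfl; omega), Fin.succAbove_of_le_castSucc _ _
        (show j.castSucc ≤ i.castSucc from h.le)]

theorem update_succAbove_castSucc {S : Type*} {n : ℕ} (j : Fin (n + 1)) (a : Fin (n + 2) → S) :
    Function.update (fun i => a (j.castSucc.succAbove i)) j (a j.succ) =
      fun i => a (j.castSucc.succAbove i) := by
  rw [Function.update_eq_self_iff]
  simp

theorem update_succAbove_succ {S : Type*} {n : ℕ} (j : Fin (n + 1)) (a : Fin (n + 2) → S) :
    Function.update (fun i => a (j.castSucc.succAbove i)) j (a j.castSucc) =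
      fun i => a (j.succ.succAbove i) := by
  funext i
  rcases lt_trichotomy (i : ℕ) j with h | h | h
  · rw [Function.update_of_ne (by rintro rfl; omega), 
      Fin.succAbove_of_castSucc_lt _ _ (show i.castSucc < j.castSucc from h),
      Fin.succAbove_of_castSucc_lt _ _ (show (i : ℕ) < j + 1 by omega)]
  · obtain rfl : i = j := Fin.ext h
    simp
  · rw [Function.update_of_ne (by rintro rfl; omega), 
      Fin.succAbove_of_le_castSucc _ _ (show j.castSucc ≤ i.castSucc from h.le),
      Fin.succAbove_of_le_castSucc _ _ (show (j + 1 : ℕ) ≤ i by omega)]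

/-- Contracting neighbours `x, y` with `xy = -(x + y)`. -/
theorem map_contractNth [Algebra ℂ R] {n : ℕ} (ψ : MultilinearMap ℂ (fun _ : Fin (n + 1) => R) ℂ)
    (j : Fin (n + 1)) (a : Fin (n + 2) → R)
    (h : a j.castSucc * a j.succ = -(a j.castSucc + a j.succ)) :
    ψ (Fin.contractNth j.castSucc (· * ·) a) =
      -(ψ (fun i => a (j.castSucc.succAbove i)) + ψ fun i => a (j.succ.succAbove i)) := by
  rw [contractNth_eq_update, h, ← neg_one_smul ℂ (a j.castSucc + a j.succ),
    ψ.map_update_smul, ψ.map_update_add, update_succAbove_castSucc, update_succAbove_succ,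
    neg_one_smul, add_comm]

end Words

/-! ### Pairing cochains with the Chern character of an invertible element -/

section Pairing

variable {R : Type*} [Ring R] (X Y : R)

/-- The alternating word `X, Y, X, Y, …`. -/
def altWord (m : ℕ) (i : Fin m) : R := if Even (i : ℕ) then X else Y

/-- The word `1, Y, X, Y, …, X, Y`. -/
def unitWord (m : ℕ) : Fin (m + 1) → R := Fin.cons 1 (altWord Y X m)

variable {X Y}

theorem altWord_mul (hXY : X * Y = -(X + Y)) (hYX : Y * X = -(X + Y)) {n : ℕ} (j : Fin n) :
    altWord X Y (n + 1) j.castSucc * altWord X Y (n + 1) j.succ =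
      -(altWord X Y (n + 1) j.castSucc + altWord X Y (n + 1) j.succ) := by
  simp only [altWord, Fin.val_castSucc, Fin.val_succ, Nat.even_add_one]
  by_cases h : Even (j : ℕ) <;> simp [h, hXY, hYX, add_comm]

/-- Each contraction is minus a sum of two words with one letter deleted, so the alternating sum
telescopes to its two ends. The end with the last letter deleted cancels against the `X` half of the
cyclic term `YX = -(X + Y)`. -/
theorem hochschild_altWord (hXY : X * Y = -(X + Y)) (hYX : Y * X = -(X + Y)) (k : ℕ)
    [Algebra ℂ R] (ψ : MultilinearMap ℂ (fun _ : Fin (2 * k + 1) => R) ℂ) :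
    hochschild (n := 2 * k) ψ (altWord X Y (2 * k + 2)) =
      ψ (Fin.cons Y (altWord Y X (2 * k))) - ψ (altWord Y X (2 * k + 1)) := by
  rw [hochschild]
  simp only [map_contractNth ψ _ _ (altWord_mul hXY hYX _)]
  have h1 := alternating_telescope (2 * k)
    fun j => ψ fun i => altWord X Y (2 * k + 2) (j.succAbove i)
  have h2 : (fun i => altWord X Y (2 * k + 2) ((0 : Fin (2 * k + 2)).succAbove i)) =
      altWord Y X (2 * k + 1) := by
    funext i
    simp only [altWord, Fin.zero_succAbove, Fin.val_succ, Nat.even_add_one]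
    by_cases h : Even (i : ℕ) <;> simp [h]
  have h3 : (fun i => altWord X Y (2 * k + 2) ((Fin.last (2 * k + 1)).succAbove i)) =
      Fin.cons X (altWord Y X (2 * k)) := by
    funext i
    refine Fin.cases ?_ (fun i => ?_) i
    · simp [altWord]
    · simp only [altWord, Fin.succAbove_last, Fin.val_castSucc, Fin.val_succ, Fin.cons_succ,
        Nat.even_add_one]
      by_cases h : Even (i : ℕ) <;> simp [h]
  have h4 : (fun i : Fin (2 * k) => altWord X Y (2 * k + 2) i.castSucc.succ) =
      altWord Y X (2 * k) := by
    funext i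
    simp only [altWord, Fin.val_castSucc, Fin.val_succ, Nat.even_add_one]
    by_cases h : Even (i : ℕ) <;> simp [h]
  have h5 : altWord X Y (2 * k + 2) (Fin.last (2 * k + 1)) = Y := by
    simp [altWord]
  have h6 : altWord X Y (2 * k + 2) 0 = X := by simp [altWord]
  have h7 : ψ (Fin.cons (-(X + Y)) (altWord Y X (2 * k))) =
      -(ψ (Fin.cons X (altWord Y X (2 * k))) + ψ (Fin.cons Y (altWord Y X (2 * k)))) := by
    rw [← ψ.cons_add, ← neg_one_smul ℂ (X + Y), ψ.cons_smul, neg_one_smul]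
  rw [h2, h3] at h1
  rw [h4, h5, h6, hYX, h7]
  simp only [mul_neg, Finset.sum_neg_distrib]
  rw [h1]
  simp [pow_succ]
  ring

theorem unitWord_mul (hXY : X * Y = -(X + Y)) (hYX : Y * X = -(X + Y)) {n : ℕ} (j : Fin n) :
    unitWord X Y (n + 1) j.succ.castSucc * unitWord X Y (n + 1) j.succ.succ =
      -(unitWord X Y (n + 1) j.succ.castSucc + unitWord X Y (n + 1) j.succ.succ) := by
  simp only [unitWord, ← Fin.succ_castSucc, Fin.cons_succ]
  exact altWord_mul (by rw [hYX, add_comm]) (by rw [hXY, add_comm]) j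

/-- The Hochschild coboundary on the word `1, Y, X, …, X, Y`. -/
theorem hochschild_unitWord (hXY : X * Y = -(X + Y)) (hYX : Y * X = -(X + Y)) (k : ℕ)
    [Algebra ℂ R] (ψ : MultilinearMap ℂ (fun _ : Fin (2 * (k + 1) + 1) => R) ℂ) :
    hochschild (n := 2 * (k + 1)) ψ (unitWord X Y (2 * (k + 1) + 1)) =
      ψ (altWord Y X (2 * (k + 1) + 1)) - ψ (Fin.cons Y (altWord Y X (2 * (k + 1)))) +
      ψ (Fin.cons 1 (altWord X Y (2 * (k + 1)))) - ψ (Fin.cons 1 (altWord Y X (2 * (k + 1)))) := by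
  rw [hochschild, Fin.sum_univ_succ]
  -- Contraction with the leading `1` merely erases it; the remaining contractions telescope.
  have h0 : Fin.contractNth (Fin.castSucc 0) (· * ·) (unitWord X Y (2 * (k + 1) + 1)) =
      altWord Y X (2 * (k + 1) + 1) := by
    rw [contractNth_eq_update]
    simp [unitWord]
  have h1 := alternating_telescope (2 * k + 1)
    fun j => ψ fun i => unitWord X Y (2 * (k + 1) + 1) (j.succ.succAbove i)
  have h2 : (fun i => unitWord X Y (2 * (k + 1) + 1) ((Fin.succ 0).succAbove i)) =
      Fin.cons 1 (altWord X Y (2 * (k + 1))) := by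
    funext i
    refine Fin.cases ?_ (fun i => ?_) i
    · simp [unitWord]
    · simp only [unitWord, altWord, Fin.succ_succAbove_succ, Fin.cons_succ, Fin.zero_succAbove,
        Fin.val_succ, Nat.even_add_one]
      by_cases h : Even (i : ℕ) <;> simp [h]
  have h3 : (fun i => unitWord X Y (2 * (k + 1) + 1)
      ((Fin.last (2 * k + 1 + 1)).succ.succAbove i)) = Fin.cons 1 (altWord Y X (2 * (k + 1))) := by
    funext i
    refine Fin.cases ?_ (fun i => ?_) i
    · simp [unitWord]
    · simp [unitWord, altWord]
  have h4 : (fun i : Fin (2 * (k + 1)) => unitWord X Y (2 * (k + 1) + 1) i.castSucc.succ) =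
      altWord Y X (2 * (k + 1)) := by
    funext i
    simp [unitWord, altWord]
  have h5 : unitWord X Y (2 * (k + 1) + 1) (Fin.last (2 * (k + 1) + 1)) = Y := by
    rw [← Fin.succ_last]
    simp [unitWord, altWord]
  have h6 : unitWord X Y (2 * (k + 1) + 1) 0 = 1 := by simp [unitWord]
  have h8 := h1.trans (congrArg₂ (· + ·) (congrArg ψ h2)
    (congrArg (fun t => (-1 : ℂ) ^ (2 * k + 1) * t) (congrArg ψ h3)))
  rw [h0, h4, h5, h6, mul_one]
  have h7 : ∀ j : Fin (2 * (k + 1)),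
      ψ (Fin.contractNth j.succ.castSucc (· * ·) (unitWord X Y (2 * (k + 1) + 1))) =
      -(ψ (fun i => unitWord X Y (2 * (k + 1) + 1) (j.castSucc.succ.succAbove i)) +
        ψ fun i => unitWord X Y (2 * (k + 1) + 1) (j.succ.succ.succAbove i)) := fun j => by
    rw [map_contractNth ψ _ _ (unitWord_mul hXY hYX j)]
    rfl
  simp only [h7, Fin.val_succ, pow_succ (-1 : ℂ) (Fin.val _), mul_neg, mul_one, neg_mul, neg_neg]
  refine Eq.trans (congrArg₂ _ (congrArg₂ _ rfl h8) rfl) ?_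
  simp [pow_succ]
  ring

theorem unitWord_add_one (k : ℕ) :
    (fun i => unitWord X Y (2 * k + 1) (i + 1)) = Fin.snoc (altWord Y X (2 * k + 1)) 1 := by
  funext i
  refine Fin.lastCases ?_ (fun i => ?_) i
  · simp [unitWord]
  · rw [Fin.coeSucc_eq_succ]
    simp [unitWord]

theorem snocWord_mul (hXY : X * Y = -(X + Y)) (hYX : Y * X = -(X + Y)) {n : ℕ} (j : Fin n) :
    (Fin.snoc (altWord Y X (n + 1)) 1 : Fin (n + 2) → R) j.castSucc.castSucc *
      (Fin.snoc (altWord Y X (n + 1)) 1 : Fin (n + 2) → R) j.castSucc.succ =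
      -((Fin.snoc (altWord Y X (n + 1)) 1 : Fin (n + 2) → R) j.castSucc.castSucc +
      (Fin.snoc (altWord Y X (n + 1)) 1 : Fin (n + 2) → R) j.castSucc.succ) := by
  rw [Fin.succ_castSucc, Fin.snoc_castSucc (α := fun _ => R), Fin.snoc_castSucc (α := fun _ => R)]
  exact altWord_mul (by rw [hYX, add_comm]) (by rw [hXY, add_comm]) j

/-- The Hochschild coboundary on the word `Y, X, …, X, Y, 1`. -/
theorem hochschild_snocWord (hXY : X * Y = -(X + Y)) (hYX : Y * X = -(X + Y)) (k : ℕ)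
    [Algebra ℂ R] (ψ : MultilinearMap ℂ (fun _ : Fin (2 * (k + 1) + 1) => R) ℂ) :
    hochschild (n := 2 * (k + 1)) ψ (Fin.snoc (altWord Y X (2 * (k + 1) + 1)) 1) =
      ψ (Fin.snoc (altWord Y X (2 * (k + 1))) 1) - ψ (Fin.snoc (altWord X Y (2 * (k + 1))) 1) := by
  rw [hochschild, Fin.sum_univ_castSucc]
  set a : Fin (2 * (k + 1) + 2) → R := Fin.snoc (altWord Y X (2 * (k + 1) + 1)) 1 with ha
  have a_cast : ∀ i, a (Fin.castSucc i) = altWord Y X (2 * (k + 1) + 1) i := fun i => by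
    rw [ha, Fin.snoc_castSucc (α := fun _ => R)]
  have a_last : a (Fin.last _) = 1 := by rw [ha, Fin.snoc_last]
  have h0 : Fin.contractNth (Fin.castSucc (Fin.last _)) (· * ·) a =
      altWord Y X (2 * (k + 1) + 1) := by
    rw [contractNth_eq_update, Fin.succ_last, a_last, mul_one, update_succAbove_succ, Fin.succ_last]
    funext i
    rw [Fin.succAbove_last, a_cast]
  have h1 := alternating_telescope (2 * k + 1)
    fun j => ψ fun i => a (j.castSucc.succAbove i)
  have h2 : (fun i => a ((Fin.castSucc 0).succAbove i)) =
      Fin.snoc (altWord X Y (2 * (k + 1))) 1 := by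
    funext i
    refine Fin.lastCases ?_ (fun i => ?_) i
    · simp [ha]
    · rw [Fin.snoc_castSucc (α := fun _ => R), Fin.castSucc_zero, Fin.zero_succAbove,
        Fin.succ_castSucc, a_cast]
      simp only [altWord, Fin.val_succ, Nat.even_add_one]
      by_cases h : Even (i : ℕ) <;> simp [h]
  have h3 : (fun i => a ((Fin.last (2 * k + 1 + 1)).castSucc.succAbove i)) =
      Fin.snoc (altWord Y X (2 * (k + 1))) 1 := by
    funext i
    refine Fin.lastCases ?_ (fun i => ?_) i
    · rw [Fin.snoc_last, ← a_last]
      congr 1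
      exact Fin.succAbove_of_le_castSucc _ _ (Fin.castSucc_le_castSucc_iff.2 (Fin.le_last _))
    · rw [Fin.snoc_castSucc (α := fun _ => R), Fin.castSucc_succAbove_castSucc, a_cast]
      simp [altWord]
  have h5 : (Fin.cons (a (Fin.last (2 * (k + 1) + 1)) * a 0)
      fun i : Fin (2 * (k + 1)) => a i.castSucc.succ) = altWord Y X (2 * (k + 1) + 1) := by
    funext i
    refine Fin.cases ?_ (fun i => ?_) i
    · rw [a_last, one_mul, Fin.cons_zero, ← Fin.castSucc_zero, a_cast]
    · rw [Fin.cons_succ, Fin.succ_castSucc, a_cast]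
  have h8 := h1.trans (congrArg₂ (· + ·) (congrArg ψ h2)
    (congrArg (fun t => (-1 : ℂ) ^ (2 * k + 1) * t) (congrArg ψ h3)))
  have h7 : ∀ j : Fin (2 * (k + 1)),
      ψ (Fin.contractNth j.castSucc.castSucc (· * ·) a) =
      -(ψ (fun i => a (j.castSucc.castSucc.succAbove i)) +
        ψ fun i => a (j.succ.castSucc.succAbove i)) := fun j => by
    rw [map_contractNth ψ _ _ (snocWord_mul hXY hYX j)]
    rfl
  rw [h0, h5]
  simp only [h7, Fin.val_castSucc, mul_neg, Finset.sum_neg_distrib]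
  refine Eq.trans (congrArg₂ _ (congrArg₂ _ (congrArg _ h8) rfl) rfl) ?_
  simp [pow_succ]
  ring

/-- `B` is a signed sum over a cyclic group, so rotating the argument reindexes the sum at the cost
of one sign. -/
theorem connesB_rotate {n : ℕ} (φ : (Fin (n + 2) → R) → ℂ) (a : Fin (n + 1) → R) :
    connesB φ (fun i => a (i + 1)) = (-1) ^ n * connesB φ a := by
  have h : ∀ s : Fin (n + 1), (-1 : ℂ) ^ (n * (s : ℕ)) =
      (-1) ^ n * (-1) ^ (n * ((s + 1 : Fin (n + 1)) : ℕ)) := by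
    intro s
    rw [Fin.val_add_one]
    split_ifs with hs
    -- At the wrap-around the exponent is `n²`, which has the parity of `n`.
    · subst hs
      rw [mul_zero, pow_zero, mul_one, Fin.val_last, ← sq, neg_one_pow_congr]
      exact Nat.even_pow' two_ne_zero
    · rw [mul_add, pow_add, mul_one, mul_left_comm, ← mul_pow]
      simp
  have h1 := Equiv.sum_comp (Equiv.addRight (1 : Fin (n + 1)))
    fun s => (-1) ^ n * ((-1 : ℂ) ^ (n * (s : ℕ)) * connesB₀ φ fun i => a (i + s))
  rw [connesB, connesB, Finset.mul_sum, ← h1]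
  refine Finset.sum_congr rfl fun s _ => ?_
  rw [Equiv.coe_addRight, ← mul_assoc, ← h s]
  simp only [add_assoc]

theorem sum_range_even_odd (u v : ℂ) (k : ℕ) :
    (∑ m ∈ Finset.range (2 * k + 2), if Even m then u else -v) = (k + 1) * (u - v) := by
  induction k with
  | zero => simp [Finset.sum_range_succ]; ring
  | succ k ih =>
    rw [show 2 * (k + 1) + 2 = 2 * k + 2 + 1 + 1 by ring, Finset.sum_range_succ,
      Finset.sum_range_succ, ih]
    have h1 : Even (2 * k + 2) := ⟨k + 1, by ring⟩
    have h2 : ¬ Even (2 * k + 2 + 1) := by rw [Nat.even_add_one]; exact not_not.2 h1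
    rw [if_pos h1, if_neg h2]
    push_cast
    ring

/-- Rotation by `s` fixes the alternating word or exchanges its letters, according to the parity of
`s`, and carries the sign `(-1)^s` since the degree is odd. The `2k + 2` rotations split into two
classes of equal size. -/
theorem connesB_altWord (k : ℕ) (φ : (Fin (2 * k + 1 + 2) → R) → ℂ) :
    connesB φ (altWord X Y (2 * k + 2)) =
      (k + 1) * (connesB₀ φ (altWord X Y (2 * k + 2)) - connesB₀ φ (altWord Y X (2 * k + 2))) := by
  have h : ∀ s : Fin (2 * k + 2), (fun i => altWord X Y (2 * k + 2) (i + s)) =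
      if Even (s : ℕ) then altWord X Y (2 * k + 2) else altWord Y X (2 * k + 2) := by
    intro s
    funext i
    have : Even (((i + s : Fin (2 * k + 2)) : ℕ)) ↔ Even ((i : ℕ) + s) := by
      rw [Fin.val_add, Nat.even_iff, Nat.mod_mod_of_dvd _ (by omega), ← Nat.even_iff]
    simp only [altWord, this, Nat.even_add]
    by_cases h1 : Even (s : ℕ) <;> by_cases h2 : Even (i : ℕ) <;> simp [h1, h2, altWord]
  rw [connesB]
  simp only [h]
  have h3 : ∀ s : Fin (2 * k + 2), (-1 : ℂ) ^ ((2 * k + 1) * (s : ℕ)) * connesB₀ φ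
      (if Even (s : ℕ) then altWord X Y (2 * k + 2) else altWord Y X (2 * k + 2)) =
      (fun m : ℕ => if Even m then connesB₀ φ (altWord X Y (2 * k + 2)) else
        -connesB₀ φ (altWord Y X (2 * k + 2))) s := by
    intro s
    by_cases h1 : Even (s : ℕ)
    · simp [h1, (h1.mul_left _).neg_one_pow]
    · have h4 : Odd ((2 * k + 1) * (s : ℕ)) :=
        Odd.mul (odd_two_mul_add_one k) (Nat.not_even_iff_odd.1 h1)
      simp [h1, h4.neg_one_pow]
  simp only [h3]
  rw [Fin.sum_univ_eq_sum_range (fun m : ℕ => if Even m then connesB₀ φ (altWord X Y (2 * k + 2))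
    else -connesB₀ φ (altWord Y X (2 * k + 2)))]
  exact sum_range_even_odd _ _ k

/-- Evaluation of a cochain on the odd Chern character of the invertible element `1 + Y` with
inverse `1 + X`, in degree `2k + 1`. -/
def chernPairing (X Y : R) (k : ℕ) (φ : (Fin (2 * k + 2) → R) → ℂ) : ℂ :=
  φ (altWord X Y (2 * k + 2)) + φ (unitWord X Y (2 * k + 1)) +
    φ fun i => unitWord X Y (2 * k + 1) (i + 1)

/-- The two words containing `1` are rotations of each other; in odd degree this changes the sign of
`B`, so they cancel. -/
theorem chernPairing_connesB (k : ℕ) (φ : (Fin (2 * k + 1 + 2) → R) → ℂ) :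
    chernPairing X Y k (connesB φ) = connesB φ (altWord X Y (2 * k + 2)) := by
  rw [chernPairing, connesB_rotate, (odd_two_mul_add_one k).neg_one_pow]
  ring

/-- In the lowest degree the two boundary terms of the alternating word coincide, and the letters of
a unit word have product `Y` in either order. -/
theorem chernPairing_hochschild_zero (hXY : X * Y = -(X + Y)) (hYX : Y * X = -(X + Y))
    [Algebra ℂ R] (ψ : MultilinearMap ℂ (fun _ : Fin (2 * 0 + 1) => R) ℂ) :
    chernPairing X Y 0 (hochschild (n := 2 * 0) ψ) = 0 := by
  rw [chernPairing, hochschild_altWord hXY hYX, unitWord_add_one]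
  have h1 : (Fin.cons Y (altWord Y X (2 * 0)) : Fin (2 * 0 + 1) → R) =
      altWord Y X (2 * 0 + 1) := by
    funext i
    fin_cases i
    simp [altWord]
  have h2 : ∀ a : Fin (2 * 0 + 2) → R, a 0 * a 1 = Y → a 1 * a 0 = Y →
      hochschild (n := 2 * 0) ψ a = 0 := by
    intro a h h'
    rw [hochschild]
    have e1 : ∀ j : Fin (2 * 0 + 1), Fin.contractNth j.castSucc (· * ·) a = fun _ => Y := by
      intro j
      fin_cases j
      funext i
      fin_cases i
      simpa [Fin.contractNth] using h
    have e2 : (Fin.cons (a (Fin.last (2 * 0 + 1)) * a 0) fun i : Fin (2 * 0) => a i.castSucc.succ :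
        Fin (2 * 0 + 1) → R) = fun _ => Y := by
      funext i
      fin_cases i
      simpa using h'
    rw [e2]
    simp [e1]
  rw [h1, h2 (unitWord X Y _), h2 (Fin.snoc _ 1)]
  · simp
  · simp [Fin.snoc, altWord]
  · simp [Fin.snoc, altWord]
  · simp [unitWord, altWord]
  · simp [unitWord, altWord]

/-- The unit words absorb the boundary terms of the alternating word, as cochains are not assumed to
vanish on `1`. What is left is `B₀ψ` antisymmetrized in `X` and `Y`, which the cyclic sum in `B`
repeats `k + 1` times. -/
theorem chernPairing_hochschild_succ (hXY : X * Y = -(X + Y)) (hYX : Y * X = -(X + Y)) (k : ℕ)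
    [Algebra ℂ R] (ψ : MultilinearMap ℂ (fun _ : Fin (2 * (k + 1) + 1) => R) ℂ) :
    (k + 1) * chernPairing X Y (k + 1) (hochschild (n := 2 * (k + 1)) ψ) =
      chernPairing X Y k (connesB (n := 2 * k + 1) ψ) := by
  rw [chernPairing_connesB, connesB_altWord, chernPairing, hochschild_altWord hXY hYX,
    hochschild_unitWord hXY hYX, unitWord_add_one, hochschild_snocWord hXY hYX]
  congr 1
  simp only [connesB₀]
  have : (-1 : ℂ) ^ (2 * k + 1 + 1) = 1 := (show Even (2 * k + 1 + 1) from ⟨k + 1, by ring⟩).neg_one_pow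
  rw [this, one_mul, one_mul]
  change _ = ψ (Fin.cons 1 (altWord X Y (2 * (k + 1)))) -
    ψ (Fin.snoc (altWord X Y (2 * (k + 1))) 1) - (ψ (Fin.cons 1 (altWord Y X (2 * (k + 1)))) -
    ψ (Fin.snoc (altWord Y X (2 * (k + 1))) 1))
  ring

/-- A coboundary which vanishes on the Chern character in degrees above one pairs to zero in
degree one. -/
theorem chernPairing_coboundary (hXY : X * Y = -(X + Y)) (hYX : Y * X = -(X + Y))
    (φ : ∀ k : ℕ, (Fin (2 * k + 2) → R) → ℂ)
    [Algebra ℂ R] (ψ : ∀ k : ℕ, MultilinearMap ℂ (fun _ : Fin (2 * k + 1) => R) ℂ)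
    (hfin : ∃ K, ∀ k ≥ K, ψ k = 0)
    (h : ∀ k a, φ k a = hochschild (n := 2 * k) (ψ k) a + connesB (n := 2 * k + 1) (ψ (k + 1)) a)
    (hφ : ∀ k, chernPairing X Y (k + 1) (φ (k + 1)) = 0) :
    chernPairing X Y 0 (φ 0) = 0 := by
  have hadd : ∀ k, chernPairing X Y k (φ k) =
      chernPairing X Y k (hochschild (n := 2 * k) (ψ k)) +
        chernPairing X Y k (connesB (n := 2 * k + 1) (ψ (k + 1))) := fun k => by
    simp only [chernPairing, h]
    ring
  -- Vanishing of the pairing in degree `2k + 3` makes these numbers satisfy `p (k + 1) = -p k / (k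
  -- + 1)`.
  have key : ∀ k, chernPairing X Y k (connesB (n := 2 * k + 1) (ψ (k + 1))) =
      (-1) ^ k * (k.factorial : ℂ)⁻¹ * chernPairing X Y 0 (φ 0) := by
    intro k
    induction k with
    | zero =>
      have := hadd 0
      rw [chernPairing_hochschild_zero hXY hYX, zero_add] at this
      simp [this]
    | succ k ih =>
      have h1 := hadd (k + 1)
      rw [hφ, eq_comm, add_comm, add_eq_zero_iff_eq_neg] at h1
      have h2 := chernPairing_hochschild_succ hXY hYX k (ψ (k + 1))
      rw [ih] at h2
      have hk : (k + 1 : ℂ) ≠ 0 := Nat.cast_add_one_ne_zero k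
      have hf : (k.factorial : ℂ) ≠ 0 := Nat.cast_ne_zero.2 k.factorial_ne_zero
      rw [h1, Nat.factorial_succ]
      push_cast
      rw [← mul_right_inj' hk, mul_neg, h2]
      field_simp
      ring
  obtain ⟨K, hK⟩ := hfin
  -- Finite support makes the left side vanish at `K`, while the coefficient `(-1)^K / K!` does not.
  have h1 := key K
  have h2 : chernPairing X Y K (connesB (n := 2 * K + 1) (ψ (K + 1))) = 0 := by
    rw [hK (K + 1) (by omega)]
    simp [chernPairing, connesB, connesB₀]
  rw [h2, eq_comm, mul_eq_zero] at h1
  refine h1.resolve_left (mul_ne_zero (pow_ne_zero _ (by norm_num)) (inv_ne_zero ?_))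
  exact Nat.cast_ne_zero.2 K.factorial_ne_zero

end Pairing

/-! ### Extension of cochains to matrices by the generalized trace -/

section MatrixTrace

variable {A : Type*} {κ : Type*}

/-- The word of entries `(M_0)_{i_0 i_1}, (M_1)_{i_1 i_2}, …, (M_n)_{i_n i_0}`. -/
def entries {n : ℕ} (M : Fin (n + 1) → Matrix κ κ A) (i : Fin (n + 1) → κ) (l : Fin (n + 1)) : A :=
  M l (i l) (i (l + 1))

theorem entries_rotate {n : ℕ} (M : Fin (n + 1) → Matrix κ κ A) (i : Fin (n + 1) → κ)
    (s : Fin (n + 1)) :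
    entries (fun l => M (l + s)) (fun l => i (l + s)) = fun l => entries M i (l + s) := by
  funext l
  simp only [entries]
  rw [add_right_comm]

variable [Ring A] [Fintype κ]

/-- The extension of a cochain to matrices by the generalized trace. -/
def matrixCochain {n : ℕ} (φ : (Fin (n + 1) → A) → ℂ) (M : Fin (n + 1) → Matrix κ κ A) : ℂ :=
  ∑ i : Fin (n + 1) → κ, φ (entries M i)

/-- The extension of a multilinear functional to matrices by the generalized trace. -/
def matrixTrace [Algebra ℂ A] {n : ℕ} (ψ : MultilinearMap ℂ (fun _ : Fin (n + 1) => A) ℂ) :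
    MultilinearMap ℂ (fun _ : Fin (n + 1) => Matrix κ κ A) ℂ :=
  ∑ i : Fin (n + 1) → κ,
    ψ.compLinearMap fun l => Matrix.entryLinearMap ℂ A (i l) (i (l + 1))

theorem coe_matrixTrace [Algebra ℂ A] {n : ℕ}
    (ψ : MultilinearMap ℂ (fun _ : Fin (n + 1) => A) ℂ) :
    ⇑(matrixTrace (κ := κ) ψ) = matrixCochain ψ := by
  funext M
  rw [matrixTrace, sum_apply]
  rfl

theorem sum_rotate {n : ℕ} (f : (Fin (n + 1) → κ) → ℂ) (s : Fin (n + 1)) :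
    ∑ i, f i = ∑ i : Fin (n + 1) → κ, f fun l => i (l + s) :=
  (Equiv.sum_comp ((Equiv.addRight s).symm.arrowCongr (Equiv.refl κ)) f).symm

theorem matrixCochain_rotate {n : ℕ} (φ : (Fin (n + 1) → A) → ℂ)
    (M : Fin (n + 1) → Matrix κ κ A) (s : Fin (n + 1)) :
    matrixCochain φ (fun l => M (l + s)) = ∑ i, φ fun l => entries M i (l + s) := by
  rw [matrixCochain, sum_rotate _ s]
  simp only [entries_rotate]

variable [DecidableEq κ]

/-- A matrix product at place `j` is a sum over one more index, inserted at position `j + 1` of the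
cyclic index tuple. -/
theorem matrixCochain_contractNth [Algebra ℂ A] {n : ℕ}
    (ψ : MultilinearMap ℂ (fun _ : Fin (n + 1) => A) ℂ) (j : Fin (n + 1))
    (M : Fin (n + 2) → Matrix κ κ A) :
    matrixCochain ψ (Fin.contractNth j.castSucc (· * ·) M) =
      ∑ i, ψ (Fin.contractNth j.castSucc (· * ·) (entries M i)) := by
  rw [← Equiv.sum_comp (Fin.insertNthEquiv (fun _ => κ) j.succ), Fintype.sum_prod_type,
    Finset.sum_comm, matrixCochain]
  refine Finset.sum_congr rfl fun i _ => ?_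
  have hE : ∀ k, Fin.insertNthEquiv (fun _ => κ) j.succ (k, i) = j.succ.insertNth k i :=
    fun _ => rfl
  have hval : ∀ (k : κ) (l : Fin (n + 1)), (l : ℕ) ≤ j →
      (j.succ.insertNth k i : Fin (n + 2) → κ) l.castSucc = i l := by
    intro k l hl
    have := Fin.insertNth_apply_succAbove (α := fun _ => κ) j.succ k i l
    rwa [Fin.succAbove_of_castSucc_lt _ _ (show (l : ℕ) < j + 1 by omega)] at this
  have hval' : ∀ (k : κ) (l : Fin (n + 1)), (j : ℕ) < l →
      (j.succ.insertNth k i : Fin (n + 2) → κ) l.succ = i l := by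
    intro k l hl
    have := Fin.insertNth_apply_succAbove (α := fun _ => κ) j.succ k i l
    rwa [Fin.succAbove_of_le_castSucc _ _ (show (j + 1 : ℕ) ≤ l by omega)] at this
  -- The column index of the last letter wraps around to the first index, which precedes the
  -- inserted one.
  have hnext : ∀ (k : κ) (l : Fin (n + 1)), (j : ℕ) ≤ l →
      (j.succ.insertNth k i : Fin (n + 2) → κ) (l.succ + 1) = i (l + 1) := by
    intro k l hl
    rcases Fin.eq_castSucc_or_eq_last l with ⟨m, rfl⟩ | rfl
    · obtain ⟨n, rfl⟩ : ∃ p, n = p + 1 := ⟨n - 1, by have := m.2; omega⟩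
      rw [Fin.coeSucc_eq_succ, Fin.succ_castSucc, Fin.coeSucc_eq_succ]
      exact hval' k m.succ (by simpa using Nat.lt_succ_of_le hl)
    · rw [Fin.succ_last, Fin.last_add_one, Fin.last_add_one]
      exact hval k 0 (Nat.zero_le _)
  have h1 : ∀ k, Fin.contractNth j.castSucc (· * ·)
      (entries M (Fin.insertNthEquiv (fun _ => κ) j.succ (k, i))) =
      Function.update (entries (Fin.contractNth j.castSucc (· * ·) M) i) j
        (M j.castSucc (i j) k * M j.succ k (i (j + 1))) := by
    intro k
    funext l
    rw [hE]
    rcases lt_trichotomy (l : ℕ) j with h | h | h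
    · rw [Fin.contractNth_apply_of_lt _ _ _ _ (by simpa using h),
        Function.update_of_ne (by rintro rfl; omega)]
      simp only [entries]
      rw [Fin.contractNth_apply_of_lt _ _ _ _ (by simpa using h), Fin.coeSucc_eq_succ,
        hval k l h.le]
      obtain ⟨m, rfl⟩ : ∃ m : Fin n, l = m.castSucc :=
        ⟨⟨l, by have := j.2; omega⟩, rfl⟩
      obtain ⟨n, rfl⟩ : ∃ p, n = p + 1 := ⟨n - 1, by have := m.2; omega⟩
      rw [Fin.coeSucc_eq_succ, Fin.succ_castSucc, hval k m.succ (by simpa using h)]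
    · obtain rfl : l = j := Fin.ext h
      rw [Fin.contractNth_apply_of_eq _ _ _ _ (by simp), Function.update_self]
      simp only [entries]
      rw [Fin.coeSucc_eq_succ, hval k l le_rfl, hnext k l le_rfl, Fin.insertNth_apply_same]
    · rw [Fin.contractNth_apply_of_gt _ _ _ _ (by simpa using h),
        Function.update_of_ne (by rintro rfl; omega)]
      simp only [entries]
      rw [Fin.contractNth_apply_of_gt _ _ _ _ (by simpa using h), hval' k l h, hnext k l h.le]
  simp only [h1]
  rw [← ψ.map_update_sum]
  congr 1
  rw [eq_comm, Function.update_eq_self_iff, entries,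
    Fin.contractNth_apply_of_eq _ _ _ _ (by simp), Matrix.mul_apply]

/-- The cyclic term of the Hochschild coboundary becomes a contraction of a rotated word and needs
no separate treatment for matrices. -/
theorem cons_last_mul {S : Type*} [Mul S] {n : ℕ} (a : Fin (n + 2) → S) :
    (Fin.cons (a (Fin.last (n + 1)) * a 0) fun i : Fin n => a i.castSucc.succ) =
      Fin.contractNth (Fin.castSucc 0) (· * ·) fun l => a (l + Fin.last (n + 1)) := by
  have h : ∀ l : Fin (n + 1), l.succ + Fin.last (n + 1) = l.castSucc := by
    intro l
    ext
    rw [Fin.val_add, Fin.val_succ, Fin.val_last, Fin.val_castSucc,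
      show (l : ℕ) + 1 + (n + 1) = l + (n + 2) by ring, Nat.add_mod_right,
      Nat.mod_eq_of_lt (by omega)]
  funext i
  refine Fin.cases ?_ (fun i => ?_) i
  · rw [Fin.contractNth_apply_of_eq _ _ _ _ (by simp), h]
    simp
  · rw [Fin.contractNth_apply_of_gt _ _ _ _ (by simp), h]
    simp

theorem hochschild_matrixCochain [Algebra ℂ A] {n : ℕ}
    (ψ : MultilinearMap ℂ (fun _ : Fin (n + 1) => A) ℂ) (M : Fin (n + 2) → Matrix κ κ A) :
    hochschild (matrixCochain (κ := κ) ψ) M = ∑ i, hochschild ψ (entries M i) := by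
  simp only [hochschild, Finset.sum_add_distrib, cons_last_mul, matrixCochain_contractNth]
  congr 1
  · rw [Finset.sum_comm]
    simp only [Finset.mul_sum]
  · rw [← Finset.mul_sum, sum_rotate _ (Fin.last (n + 1))]
    simp only [entries_rotate]

/-- The entries of the identity matrix force the first two indices to agree; in every other term the
first letter is zero. -/
theorem sum_entries_cons_one {n : ℕ} (f : (Fin (n + 2) → A) → ℂ)
    (hf : ∀ a, a 0 = 0 → f a = 0) (M : Fin (n + 1) → Matrix κ κ A) :
    ∑ i, f (entries (Fin.cons 1 M : Fin (n + 2) → Matrix κ κ A) i) =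
      ∑ i, f (Fin.cons 1 (entries M i)) := by
  rw [← Equiv.sum_comp (Fin.insertNthEquiv (fun _ => κ) 0), Fintype.sum_prod_type,
    Finset.sum_comm]
  refine Finset.sum_congr rfl fun i _ => ?_
  have hE : ∀ k, Fin.insertNthEquiv (fun _ => κ) 0 (k, i) = (Fin.cons k i : Fin (n + 2) → κ) :=
    fun k => Fin.insertNth_zero' k i
  simp only [hE]
  rw [Finset.sum_eq_single (i 0)]
  · congr 1
    funext l
    refine Fin.cases ?_ (fun l => ?_) l
    · simp only [entries, Fin.cons_zero, zero_add]
      rw [← Fin.succ_zero_eq_one, Fin.cons_succ, Matrix.one_apply_eq]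
    · simp only [entries, Fin.cons_succ]
      congr 1
      rcases Fin.eq_castSucc_or_eq_last l with ⟨m, rfl⟩ | rfl
      · obtain ⟨n, rfl⟩ : ∃ p, n = p + 1 := ⟨n - 1, by have := m.2; omega⟩
        rw [Fin.succ_castSucc, Fin.coeSucc_eq_succ, Fin.coeSucc_eq_succ, Fin.cons_succ]
      · rw [Fin.succ_last, Fin.last_add_one, Fin.last_add_one, Fin.cons_zero]
  · intro k _ hk
    refine hf _ ?_
    simp only [entries, Fin.cons_zero, zero_add]
    rw [← Fin.succ_zero_eq_one, Fin.cons_succ, Matrix.one_apply_ne hk]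
  · simp

theorem snoc_eq_cons_rotate {S : Type*} {n : ℕ} (a : Fin (n + 1) → S) (x : S) :
    (Fin.snoc a x : Fin (n + 2) → S) = fun l => (Fin.cons x a : Fin (n + 2) → S) (l + 1) := by
  funext l
  refine Fin.lastCases ?_ (fun l => ?_) l
  · simp
  · rw [Fin.snoc_castSucc (α := fun _ => S), Fin.coeSucc_eq_succ, Fin.cons_succ]

theorem connesB₀_matrixCochain [Algebra ℂ A] {n : ℕ}
    (ψ : MultilinearMap ℂ (fun _ : Fin (n + 2) => A) ℂ) (M : Fin (n + 1) → Matrix κ κ A) :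
    connesB₀ (matrixCochain (κ := κ) ψ) M = ∑ i, connesB₀ ψ (entries M i) := by
  simp only [connesB₀, Finset.sum_sub_distrib, snoc_eq_cons_rotate, ← Finset.mul_sum]
  congr 1
  · exact sum_entries_cons_one ψ (fun a ha => ψ.map_coord_zero 0 ha) M
  · congr 1
    rw [matrixCochain_rotate]
    refine sum_entries_cons_one (fun a => ψ fun l => a (l + 1)) (fun a ha => ?_) M
    exact ψ.map_coord_zero (Fin.last _) (by rw [Fin.last_add_one, ha])

theorem connesB_matrixCochain [Algebra ℂ A] {n : ℕ}
    (ψ : MultilinearMap ℂ (fun _ : Fin (n + 2) => A) ℂ) (M : Fin (n + 1) → Matrix κ κ A) :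
    connesB (matrixCochain (κ := κ) ψ) M = ∑ i, connesB ψ (entries M i) := by
  simp only [connesB]
  rw [Finset.sum_comm]
  refine Finset.sum_congr rfl fun s _ => ?_
  rw [connesB₀_matrixCochain, ← Finset.mul_sum, sum_rotate _ s]
  simp only [entries_rotate]

/-- The extension of a coboundary to matrices is a coboundary. -/
theorem matrixCochain_coboundary [Algebra ℂ A] {φ : ∀ k : ℕ, (Fin (2 * k + 2) → A) → ℂ}
    {ψ : ∀ k : ℕ, MultilinearMap ℂ (fun _ : Fin (2 * k + 1) => A) ℂ}
    (h : ∀ k a, φ k a = hochschild (n := 2 * k) (ψ k) a + connesB (n := 2 * k + 1) (ψ (k + 1)) a)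
    (k : ℕ) (M : Fin (2 * k + 2) → Matrix κ κ A) :
    matrixCochain (φ k) M = hochschild (n := 2 * k) (matrixTrace (κ := κ) (ψ k)) M +
      connesB (n := 2 * k + 1) (matrixTrace (κ := κ) (ψ (k + 1))) M := by
  rw [coe_matrixTrace, hochschild_matrixCochain]
  have := connesB_matrixCochain (n := 2 * k + 1) (ψ (k + 1)) M
  rw [← coe_matrixTrace] at this
  refine Eq.trans ?_ (congrArg₂ (· + ·) rfl this.symm)
  rw [← Finset.sum_add_distrib]
  exact Finset.sum_congr rfl fun i _ => h k _

/-- A cocycle concentrated in degree one which is a coboundary pairs trivially with every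
invertible matrix `1 + Y`, with inverse `1 + X`. -/
theorem matrixCochain_pairing_eq_zero [Algebra ℂ A] {φ : ∀ k : ℕ, (Fin (2 * k + 2) → A) → ℂ}
    (hφ : ∀ k, φ (k + 1) = 0) (hco : IsOddPeriodicCoboundary φ) {X Y : Matrix κ κ A}
    (hXY : X * Y = -(X + Y)) (hYX : Y * X = -(X + Y)) :
    chernPairing X Y 0 (matrixCochain (n := 2 * 0 + 1) (φ 0)) = 0 := by
  obtain ⟨ψ, ⟨K, hK⟩, h⟩ := hco
  refine chernPairing_coboundary hXY hYX (fun k => matrixCochain (n := 2 * k + 1) (φ k))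
    (fun k => matrixTrace (ψ k)) ⟨K, fun k hk => ?_⟩ (matrixCochain_coboundary h) fun k => ?_
  · refine MultilinearMap.ext fun M => ?_
    rw [coe_matrixTrace, hK k hk]
    simp [matrixCochain]
  · simp [hφ, chernPairing, matrixCochain]

end MatrixTrace

/-! ### Jumps of the eigenvalue and decay of the weights -/

section Estimates

/-- Raising `N` without raising `x` always lands off the line `x = N`. -/
theorem diracEigenvalue_up_zero (v : Fin 2) (p : Idx) :
    diracEigenvalue (up 0 v p) = p.1.1 + 2 := by
  have := p.2.1
  rw [diracEigenvalue, if_neg (by simp [up]; omega)]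
  simp [up]
  ring

theorem diracEigenvalue_up_one (v : Fin 2) (p : Idx) :
    diracEigenvalue (up 1 v p) = if p.1.2.1 = p.1.1 then -((p.1.1 : ℝ) + 2) else p.1.1 + 2 := by
  rw [diracEigenvalue]
  simp only [up]
  have : p.1.2.1 + ((1 : Fin 2) : ℕ) = p.1.1 + 1 ↔ p.1.2.1 = p.1.1 := by simp
  simp only [this]
  split_ifs <;> push_cast <;> ring

theorem sign_diracEigenvalue (p : Idx) :
    Real.sign (diracEigenvalue p) = if p.1.2.1 = p.1.1 then -1 else 1 := by
  rw [diracEigenvalue]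
  split_ifs
  · rw [Real.sign_of_neg]; linarith [(p.1.1.cast_nonneg : (0 : ℝ) ≤ _)]
  · rw [Real.sign_of_pos]; positivity

variable (q : Set.Ioo (0 : ℝ) 1)

/-- The factor `q^{2x}` leaves the root as `q^x`, and the rest is bounded uniformly. -/
theorem sqrt_ratio_le_pow (x m u v k l : ℕ) (hk : 2 ≤ k) (hl : 2 ≤ l) :
    |√((q : ℝ) ^ (2 * x + m) * ((1 - (q : ℝ) ^ u) * (1 - (q : ℝ) ^ v)) /
      ((1 - (q : ℝ) ^ k) * (1 - (q : ℝ) ^ l)))| ≤ 1 / (1 - (q : ℝ) ^ 2) * (q : ℝ) ^ x := by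
  have h0 : (0 : ℝ) ≤ q := q.2.1.le
  rw [pow_add, mul_comm 2 x, pow_mul, mul_assoc, mul_div_assoc, Real.sqrt_mul (by positivity),
    Real.sqrt_sq (by positivity), abs_mul, abs_of_nonneg (pow_nonneg h0 x), mul_comm]
  gcongr
  exact sqrt_ratio_le q.2 m u v k l hk hl

theorem aPlus_le_pow (N x y : ℕ) : |aPlus q N x y| ≤ 1 / (1 - (q : ℝ) ^ 2) * (q : ℝ) ^ x := by
  rw [aPlus, add_assoc]
  exact sqrt_ratio_le_pow q x (2 * y + 2) _ _ _ _ (by omega) (by omega)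

theorem bMinus_le_pow (N x y : ℕ) :
    |bMinus q (N + 1) x y| ≤ 1 / (1 - (q : ℝ) ^ 2) * (q : ℝ) ^ x :=
  sqrt_ratio_le_pow q x 0 _ _ _ _ (by omega) (by omega)

theorem exists_linear_mul_pow_le : ∃ C : ℝ, 1 ≤ C ∧ ∀ n : ℕ, (2 * n + 3) * (q : ℝ) ^ n ≤ C := by
  have h1 := tendsto_self_mul_const_pow_of_lt_one q.2.1.le q.2.2
  have h2 := tendsto_pow_atTop_nhds_zero_of_lt_one q.2.1.le q.2.2
  have h3 := ((h1.const_mul 2).add (h2.const_mul 3)).bddAbove_range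
  obtain ⟨C, hC⟩ := h3
  refine ⟨C ⊔ 1, le_sup_right, fun n => le_sup_of_le_left ?_⟩
  have := hC ⟨n, rfl⟩
  dsimp only at this
  linarith

theorem one_div_one_sub_pos : 0 < 1 / (1 - (q : ℝ) ^ 2) := by
  have := q.2.1
  have := q.2.2
  have : 0 < 1 - (q : ℝ) ^ 2 := by nlinarith
  positivity

/-- Weights which decay like `q^x` and jumps of the eigenvalues which are bounded off the line
`x = N`. -/
theorem exists_commutator_bound (c j : Idx → ℝ)
    (hc : ∀ p, |c p| ≤ 1 / (1 - (q : ℝ) ^ 2) * (q : ℝ) ^ p.1.2.1)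
    (hj : ∀ p, |j p| ≤ if p.1.2.1 = p.1.1 then 2 * (p.1.1 : ℝ) + 3 else 1) :
    ∃ C, ∀ p, |c p * j p| ≤ C := by
  obtain ⟨C, hC1, hC⟩ := exists_linear_mul_pow_le q
  have hM := one_div_one_sub_pos q
  have h0 := q.2.1
  refine ⟨1 / (1 - (q : ℝ) ^ 2) * C, fun p => ?_⟩
  rw [abs_mul]
  refine (mul_le_mul (hc p) (hj p) (abs_nonneg _) (by positivity)).trans ?_
  rw [mul_assoc]
  gcongr
  split_ifs with h
  · rw [h, mul_comm]
    exact hC _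
  · rw [mul_one]
    exact (pow_le_one₀ h0.le q.2.2.le).trans hC1

theorem exists_commutator_bound' (c j : Idx → ℝ) (hc : ∀ p, |c p| ≤ 1 / (1 - (q : ℝ) ^ 2))
    (hj : ∀ p, |j p| ≤ 1) : ∃ C, ∀ p, |c p * j p| ≤ C :=
  ⟨1 / (1 - (q : ℝ) ^ 2), fun p => by
    rw [abs_mul]
    exact (mul_le_mul (hc p) (hj p) (abs_nonneg _) (one_div_one_sub_pos q).le).trans
      (mul_one _).le⟩

end Estimates

/-! ### The odd spectral triple -/

section SpectralTriple

variable (q : Set.Ioo (0 : ℝ) 1)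

/-- The part `a₊` can leave the line `x = N`, where the jump is `2N + 3` but the weight is `O(q^N)`;
the part `a₋` preserves `N - x`, so that its jumps have modulus one. -/
theorem alpha_commutator_bounds :
    (∃ C, ∀ p : Idx, |aPlus q p.1.1 p.1.2.1 p.1.2.2 *
      (diracEigenvalue (up 0 0 p) - diracEigenvalue p)| ≤ C) ∧
    ∃ C, ∀ p : Idx, |aMinus q (p.1.1 + 1) (p.1.2.1 + 1) (p.1.2.2 + 1) *
      (diracEigenvalue p - diracEigenvalue (up 1 1 p))| ≤ C := by
  refine ⟨exists_commutator_bound q _ _ (fun p => aPlus_le_pow q _ _ _) fun p => ?_,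
    exists_commutator_bound' q _ _ (fun p => aMinus_le q _ _ _) fun p => ?_⟩
  · rw [diracEigenvalue_up_zero, diracEigenvalue]
    split_ifs
    · rw [abs_of_nonneg (by linarith [(p.1.1.cast_nonneg : (0 : ℝ) ≤ _)])]; linarith
    · rw [abs_of_nonneg (by linarith)]; linarith
  · rw [diracEigenvalue_up_one, diracEigenvalue]
    split_ifs
    · rw [abs_of_nonneg (by linarith)]; linarith
    · rw [abs_of_nonpos (by linarith)]; linarith

/-- The roles are exchanged: `b₊` preserves `N - x`, and `b₋` is the part that decays. -/
theorem beta_commutator_bounds :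
    (∃ C, ∀ p : Idx, |bPlus q p.1.1 p.1.2.1 p.1.2.2 *
      (diracEigenvalue (up 1 0 p) - diracEigenvalue p)| ≤ C) ∧
    ∃ C, ∀ p : Idx, |bMinus q (p.1.1 + 1) p.1.2.1 (p.1.2.2 + 1) *
      (diracEigenvalue p - diracEigenvalue (up 0 1 p))| ≤ C := by
  refine ⟨exists_commutator_bound' q _ _ (fun p => bPlus_le q _ _ _) fun p => ?_,
    exists_commutator_bound q _ _ (fun p => bMinus_le_pow q _ _ _) fun p => ?_⟩
  · rw [diracEigenvalue_up_one, diracEigenvalue]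
    split_ifs
    · rw [abs_of_nonpos (by linarith)]; linarith
    · rw [abs_of_nonneg (by linarith)]; linarith
  · rw [diracEigenvalue_up_zero, diracEigenvalue]
    split_ifs
    · rw [abs_of_nonpos (by linarith [(p.1.1.cast_nonneg : (0 : ℝ) ≤ _)])]; linarith
    · rw [abs_of_nonpos (by linarith)]; linarith

theorem bound_neg_commutator {ι : Type*} {r s : ι → ι} {c d : ι → ℝ}
    (h : ∃ C, ∀ p, |c p * (d (s p) - d (r p))| ≤ C) :
    ∃ C, ∀ p, |c p * (d (r p) - d (s p))| ≤ C := by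
  obtain ⟨C, hC⟩ := h
  refine ⟨C, fun p => ?_⟩
  rw [← neg_sub, mul_neg, abs_neg]
  exact hC p

theorem hasBoundedCommutator_generator {a : Hq →L[ℂ] Hq}
    (ha : a ∈ ({alpha q, beta q} : Set (Hq →L[ℂ] Hq)) ∪ star {alpha q, beta q}) :
    HasBoundedCommutator dirac a := by
  have hA := alpha_commutator_bounds q
  have hB := beta_commutator_bounds q
  rcases ha with (rfl | rfl) | ha
  · exact (hasBoundedCommutator_weightedShift _ _ _ _ _ _ _ _ hA.1).add
      (hasBoundedCommutator_weightedShift _ _ _ _ _ _ _ _ hA.2)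
  · exact (hasBoundedCommutator_weightedShift _ _ _ _ _ _ _ _ hB.1).add
      (hasBoundedCommutator_weightedShift _ _ _ _ _ _ _ _ hB.2)
  · rcases Set.mem_star.1 ha with h | h
    · obtain rfl : a = star (alpha q) := by rw [← h, star_star]
      rw [alpha, star_add, star_weightedShift, star_weightedShift]
      exact (hasBoundedCommutator_weightedShift _ _ _ _ _ _ _ _ (bound_neg_commutator hA.1)).add
        (hasBoundedCommutator_weightedShift _ _ _ _ _ _ _ _ (bound_neg_commutator hA.2))
    · obtain rfl : a = star (beta q) := by rw [← Set.mem_singleton_iff.1 h, star_star]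
      rw [beta, star_add, star_weightedShift, star_weightedShift]
      exact (hasBoundedCommutator_weightedShift _ _ _ _ _ _ _ _ (bound_neg_commutator hB.1)).add
        (hasBoundedCommutator_weightedShift _ _ _ _ _ _ _ _ (bound_neg_commutator hB.2))

theorem hasBoundedCommutator_of_mem_Af {a : Hq →L[ℂ] Hq} (ha : a ∈ Af q) :
    HasBoundedCommutator dirac a := by
  -- The adjoints are taken among the generators of a plain algebra, which avoids proving closure of
  -- bounded commutators under adjoints.
  have ha' : a ∈ Algebra.adjoin ℂ
      (({alpha q, beta q} : Set (Hq →L[ℂ] Hq)) ∪ star {alpha q, beta q}) := ha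
  induction ha' using Algebra.adjoin_induction with
  | mem x hx => exact hasBoundedCommutator_generator q hx
  | algebraMap z => exact HasBoundedCommutator.algebraMap _ z
  | add x y hx hy h1 h2 => exact (h1 hx).add (h2 hy)
  | mul x y hx hy h1 h2 => exact (h1 hx).mul (h2 hy)

theorem abs_diracEigenvalue (p : Idx) : |diracEigenvalue p| = p.1.1 + 1 := by
  have : (0 : ℝ) ≤ p.1.1 + 1 := by positivity
  rw [diracEigenvalue]
  split_ifs
  · rw [abs_neg, abs_of_nonneg this]
  · rw [abs_of_nonneg this]

/-- Only finitely many labels share a given `N`. -/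
theorem tendsto_abs_diracEigenvalue :
    Filter.Tendsto (fun p => |diracEigenvalue p|) Filter.cofinite Filter.atTop := by
  simp only [abs_diracEigenvalue]
  refine Filter.tendsto_atTop_add_const_right _ _ (tendsto_natCast_atTop_atTop.comp ?_)
  rw [← Nat.cofinite_eq_atTop]
  refine Filter.Tendsto.cofinite_of_finite_preimage_singleton fun N => ?_
  refine Set.Finite.of_injOn (t := (Set.Iic N ×ˢ Set.Iic N : Set (ℕ × ℕ)))
    (f := fun p : Idx => p.1.2) ?_ ?_ ((Set.finite_Iic N).prod (Set.finite_Iic N))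
  · rintro p hp
    have := p.2
    simp only [Set.mem_preimage, Set.mem_singleton_iff] at hp
    rw [hp] at this
    exact Set.mk_mem_prod this.1 this.2
  · rintro p hp p' hp' h
    simp only [Set.mem_preimage, Set.mem_singleton_iff] at hp hp'
    exact Subtype.ext (Prod.ext (hp.trans hp'.symm) h)

theorem isOddSpectralTriple : IsOddSpectralTriple (Af q) dirac where
  dense_domain := dense_diagOp_domain _
  isSelfAdjoint := isSelfAdjoint_diagOp _
  compact_resolvent := compact_resolvent_diagOp _ tendsto_abs_diracEigenvalue
  bounded_commutators _ ha := hasBoundedCommutator_of_mem_Af q ha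

end SpectralTriple

/-! ### Equivariance of `D` -/

section Equivariance

/-- The restriction of the Dirac operator to the core. -/
def diracCore : Module.End ℂ Core :=
  Finsupp.linearCombination ℂ fun p : Idx => (diracEigenvalue p : ℂ) • Finsupp.single p 1

theorem diracCore_eCore {N x y : ℕ} :
    diracCore (eCore N x y) = ((if x = N then -((N : ℝ) + 1) else N + 1 : ℝ) : ℂ) • eCore N x y := by
  rw [eCore]
  split_ifs with h h' h'
  all_goals simp_all [diracCore, diracEigenvalue]

/-- The eigenvalue depends on `N` and `x` only, so any operator that changes just `y` commutes with
`D`; targets out of range are zero on both sides. -/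
theorem commute_diracCore (f : Idx → ℂ) (g : Idx → ℕ) :
    Commute diracCore (Finsupp.linearCombination ℂ fun p : Idx =>
      f p • eCore p.1.1 p.1.2.1 (g p)) := by
  refine Finsupp.lhom_ext' fun p => LinearMap.ext_ring ?_
  have h1 : diracCore (Finsupp.single p 1) = (diracEigenvalue p : ℂ) • Finsupp.single p 1 := by
    simp [diracCore]
  simp only [LinearMap.comp_apply, Finsupp.lsingle_apply, Module.End.mul_apply, h1, map_smul,
    Finsupp.linearCombination_single, one_smul, diracCore_eCore]
  rw [smul_comm]
  rfl

theorem isEquivariant_dirac (q : ℝ) : IsEquivariant q dirac := by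
  refine ⟨diracCore, fun v => ?_, commute_diracCore _ _, commute_diracCore _ _, ?_⟩
  · suffices h : ∃ h : Core.toHq v ∈ dirac.domain,
        (dirac ⟨Core.toHq v, h⟩ : Hq) = Core.toHq (diracCore v) from h
    induction v using Finsupp.induction_linear with
    | zero =>
      have h : Core.toHq 0 ∈ dirac.domain := by rw [map_zero]; exact dirac.domain.zero_mem
      have h' : (⟨Core.toHq 0, h⟩ : dirac.domain) = 0 := Subtype.ext (map_zero _)
      exact ⟨h, by rw [h', LinearPMap.map_zero, map_zero, map_zero]⟩
    | add v w hv hw =>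
      obtain ⟨h1, e1⟩ := hv
      obtain ⟨h2, e2⟩ := hw
      have h3 : Core.toHq (v + w) ∈ dirac.domain := by
        rw [map_add]; exact dirac.domain.add_mem h1 h2
      refine ⟨h3, ?_⟩
      have : (⟨Core.toHq (v + w), h3⟩ : dirac.domain) = ⟨_, h1⟩ + ⟨_, h2⟩ :=
        Subtype.ext (map_add _ _ _)
      rw [this, LinearPMap.map_add, e1, e2, map_add, map_add]
    | single p z =>
      have e : Core.toHq (Finsupp.single p z) = z • basisVec p := by
        simp [Core.toHq]
      obtain ⟨h1, e1⟩ := basisVec_mem_diagOp_domain diracEigenvalue p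
      have h3 : Core.toHq (Finsupp.single p z) ∈ dirac.domain := by
        rw [e]; exact dirac.domain.smul_mem z h1
      refine ⟨h3, ?_⟩
      have : (⟨Core.toHq (Finsupp.single p z), h3⟩ : dirac.domain) = z • ⟨_, h1⟩ :=
        Subtype.ext e
      rw [this, LinearPMap.map_smul]
      refine (congrArg (z • ·) e1).trans ?_
      rw [diracCore, Finsupp.linearCombination_single, map_smul, map_smul, Core.toHq,
        Finsupp.linearCombination_single, one_smul]
  · have h : A₁star q = Finsupp.linearCombination ℂ fun p : Idx =>
        (if p.1.2.2 = 0 then 0 else (nCoeff q p.1.1 (p.1.2.2 - 1) : ℂ)) •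
          eCore p.1.1 p.1.2.1 (p.1.2.2 - 1) := by
      rw [A₁star]
      congr 1
      funext p
      split_ifs
      · rw [zero_smul]
      · rfl
    rw [h]
    exact commute_diracCore _ _

end Equivariance

/-! ### Commutators with the sign operator -/

section Commutators

variable {ι : Type*}

theorem signOp_apply (d : ι → ℝ) (f : L2 ι) (i : ι) :
    signOp d f i = (Real.sign (d i) : ℂ) * f i :=
  weightedShift_apply_image id id Function.injective_id Function.injective_id _ _ _ f i

theorem signOp_mul_sub_mul_signOp (d : ι → ℝ) (r s : ι → ι) (hr : Function.Injective r)
    (hs : Function.Injective s) (c : ι → ℝ) (C : ℝ) (hc : ∀ k, |c k| ≤ C) (C' : ℝ)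
    (hc' : ∀ k, |c k * (Real.sign (d (s k)) - Real.sign (d (r k)))| ≤ C') :
    signOp d * weightedShift r s hr hs c C hc - weightedShift r s hr hs c C hc * signOp d =
      weightedShift r s hr hs _ C' hc' := by
  ext f i
  rw [sub_apply, mul_apply_eq_comp, mul_apply_eq_comp, lp.coeFn_sub, Pi.sub_apply, signOp_apply]
  by_cases h : ∃ k, s k = i
  · obtain ⟨k, rfl⟩ := h
    rw [weightedShift_apply_image, weightedShift_apply_image, weightedShift_apply_image,
      signOp_apply]
    push_cast
    ring
  · rw [weightedShift_apply_of_notMem _ _ _ _ _ _ _ _ _ h,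
      weightedShift_apply_of_notMem _ _ _ _ _ _ _ _ _ h,
      weightedShift_apply_of_notMem _ _ _ _ _ _ _ _ _ h]
    simp

theorem star_signOp (d : ι → ℝ) : star (signOp d) = signOp d := star_weightedShift _ _ _ _ _ _ _

theorem signOp_mul_self (d : ι → ℝ) (hd : ∀ i, d i ≠ 0) : signOp d * signOp d = 1 := by
  ext f i
  rw [mul_apply_eq_comp, signOp_apply, signOp_apply, one_apply_eq_self, ← mul_assoc,
    ← Complex.ofReal_mul]
  rcases lt_or_gt_of_ne (hd i) with h | h
  · simp [Real.sign_of_neg h]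
  · simp [Real.sign_of_pos h]

theorem isHilbertSchmidt_weightedShift [DecidableEq ι] (r s : ι → ι) (hr : Function.Injective r)
    (hs : Function.Injective s) (c : ι → ℝ) (C : ℝ) (hc : ∀ k, |c k| ≤ C)
    (h : Summable fun k => c k ^ 2) : IsHilbertSchmidt (weightedShift r s hr hs c C hc) := by
  have h1 : (fun i => ‖weightedShift r s hr hs c C hc (basisVec i)‖ ^ 2) =
      Function.extend r (fun k => c k ^ 2) 0 := by
    funext i
    by_cases hi : ∃ k, r k = i
    · obtain ⟨k, rfl⟩ := hi
      rw [weightedShift_basisVec, hr.extend_apply, norm_smul, norm_basisVec, mul_one,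
        Complex.norm_real, Real.norm_eq_abs, sq_abs]
    · rw [Function.extend_apply' _ _ _ hi, weightedShift_basisVec_of_notMem]
      · simp
      · exact fun k hk => hi ⟨k, hk⟩
  rw [IsHilbertSchmidt, h1]
  exact ((hasSum_extend_zero hr).2 h.hasSum).summable

end Commutators

/-! ### The 2-summable Fredholm module -/

section FredholmModule

variable (q : Set.Ioo (0 : ℝ) 1)

/-- On the line the squares are at most `K² q^{2N} ≤ K² q^N q^y`, because `y ≤ N`, and a double
geometric series dominates. -/
theorem summable_sq_of_le_line (c : Idx → ℝ) (K : ℝ)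
    (hc : ∀ p, |c p| ≤ if p.1.2.1 = p.1.1 then K * (q : ℝ) ^ p.1.1 else 0) :
    Summable fun p => c p ^ 2 := by
  have h0 := q.2.1.le
  have hg := summable_geometric_of_lt_one h0 q.2.2
  have h1 : Summable fun z : ℕ × ℕ => K ^ 2 * ((q : ℝ) ^ z.1 * (q : ℝ) ^ z.2) :=
    (hg.mul_of_nonneg hg (fun _ => by positivity) (fun _ => by positivity)).mul_left _
  let i : {z : ℕ × ℕ // z.2 ≤ z.1} → Idx := fun z => ⟨(z.1.1, z.1.1, z.1.2), le_rfl, z.2⟩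
  have hi : Function.Injective i := by
    rintro ⟨⟨a, b⟩, h⟩ ⟨⟨a', b'⟩, h'⟩ e
    simp only [i, Subtype.mk.injEq, Prod.mk.injEq] at e
    simp [e.1, e.2.2]
  have hz : ∀ p ∉ Set.range i, c p ^ 2 = 0 := by
    intro p hp
    have : ¬ p.1.2.1 = p.1.1 := fun h => hp ⟨⟨(p.1.1, p.1.2.2), p.2.2⟩, by
      refine Subtype.ext (Prod.ext rfl (Prod.ext h.symm rfl))⟩
    have h2 := hc p
    rw [if_neg this] at h2
    simp [abs_nonpos_iff.1 h2]
  rw [← hi.summable_iff hz]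
  refine Summable.of_nonneg_of_le (fun _ => by simp only [Function.comp]; positivity) (fun z => ?_)
    (h1.subtype {z | z.2 ≤ z.1})
  have h2 := hc (i z)
  rw [if_pos rfl] at h2
  simp only [Function.comp]
  rw [← sq_abs]
  refine (pow_le_pow_left₀ (abs_nonneg _) h2 2).trans ?_
  rw [mul_pow, sq ((q : ℝ) ^ _)]
  have h3 : (q : ℝ) ^ z.1.1 ≤ (q : ℝ) ^ z.1.2 := pow_le_pow_of_le_one h0 q.2.2.le z.2
  simp only [i]
  gcongr

theorem sign_up_zero (v : Fin 2) (p : Idx) : Real.sign (diracEigenvalue (up 0 v p)) = 1 := by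
  rw [diracEigenvalue_up_zero]
  exact Real.sign_of_pos (by positivity)

theorem sign_up_one (v : Fin 2) (p : Idx) :
    Real.sign (diracEigenvalue (up 1 v p)) = Real.sign (diracEigenvalue p) := by
  rw [sign_diracEigenvalue, sign_diracEigenvalue]
  simp [up]

theorem alpha_sign_bound (p : Idx) : |aPlus q p.1.1 p.1.2.1 p.1.2.2 *
    (Real.sign (diracEigenvalue (up 0 0 p)) - Real.sign (diracEigenvalue p))| ≤
      if p.1.2.1 = p.1.1 then 1 / (1 - (q : ℝ) ^ 2) * 2 * (q : ℝ) ^ p.1.1 else 0 := by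
  rw [sign_up_zero, sign_diracEigenvalue]
  split_ifs with h
  · have := aPlus_le_pow q p.1.1 p.1.2.1 p.1.2.2
    rw [show (q : ℝ) ^ p.1.2.1 = (q : ℝ) ^ p.1.1 by rw [h]] at this
    rw [abs_mul]
    norm_num
    norm_num at this
    linarith
  · simp

theorem beta_sign_bound (p : Idx) : |bMinus q (p.1.1 + 1) p.1.2.1 (p.1.2.2 + 1) *
    (Real.sign (diracEigenvalue p) - Real.sign (diracEigenvalue (up 0 1 p)))| ≤
      if p.1.2.1 = p.1.1 then 1 / (1 - (q : ℝ) ^ 2) * 2 * (q : ℝ) ^ p.1.1 else 0 := by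
  rw [sign_up_zero, sign_diracEigenvalue]
  split_ifs with h
  · have := bMinus_le_pow q p.1.1 p.1.2.1 (p.1.2.2 + 1)
    rw [show (q : ℝ) ^ p.1.2.1 = (q : ℝ) ^ p.1.1 by rw [h]] at this
    rw [abs_mul]
    norm_num
    norm_num at this
    linarith
  · simp

theorem line_bound_le {c : ℝ} {p : Idx}
    (h : |c| ≤ if p.1.2.1 = p.1.1 then 1 / (1 - (q : ℝ) ^ 2) * 2 * (q : ℝ) ^ p.1.1 else 0) :
    |c| ≤ 1 / (1 - (q : ℝ) ^ 2) * 2 := by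
  have := one_div_one_sub_pos q
  refine h.trans ?_
  split_ifs
  · exact mul_le_of_le_one_right (by positivity) (pow_le_one₀ q.2.1.le q.2.2.le)
  · positivity

/-- The part `a₋` preserves `N - x` and commutes with the sign; its commutator is a weighted shift
of bound `0`. -/
theorem signDirac_alpha : signDirac * alpha q - alpha q * signDirac =
    weightedShift id (up 0 0) Function.injective_id (up_injective 0 0) _ _
      (fun p => line_bound_le q (alpha_sign_bound q p)) := by
  rw [alpha, mul_add, add_mul, add_sub_add_comm]
  have h2 : ∀ p : Idx, |aMinus q (p.1.1 + 1) (p.1.2.1 + 1) (p.1.2.2 + 1) *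
      (Real.sign (diracEigenvalue p) - Real.sign (diracEigenvalue (up 1 1 p)))| ≤ 0 := fun p => by
    rw [sign_up_one]; simp
  refine (congrArg₂ (· + ·) (signOp_mul_sub_mul_signOp _ _ _ _ _ _ _ _ _
    (fun p => line_bound_le q (alpha_sign_bound q p)))
    (signOp_mul_sub_mul_signOp _ _ _ _ _ _ _ _ _ h2)).trans ?_
  exact add_eq_left.2 (norm_le_zero_iff.1 (weightedShift_norm_le _ _ _ _ _ _ _ le_rfl))

theorem signDirac_beta : signDirac * beta q - beta q * signDirac =
    weightedShift (up 0 1) id (up_injective 0 1) Function.injective_id _ _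
      (fun p => line_bound_le q (beta_sign_bound q p)) := by
  rw [beta, mul_add, add_mul, add_sub_add_comm]
  have h2 : ∀ p : Idx, |bPlus q p.1.1 p.1.2.1 p.1.2.2 *
      (Real.sign (diracEigenvalue (up 1 0 p)) - Real.sign (diracEigenvalue p))| ≤ 0 := fun p => by
    rw [sign_up_one]; simp
  refine (congrArg₂ (· + ·) (signOp_mul_sub_mul_signOp _ _ _ _ _ _ _ _ _ h2)
    (signOp_mul_sub_mul_signOp _ _ _ _ _ _ _ _ _
      (fun p => line_bound_le q (beta_sign_bound q p)))).trans ?_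
  exact add_eq_right.2 (norm_le_zero_iff.1 (weightedShift_norm_le _ _ _ _ _ _ _ le_rfl))

theorem signDirac_mul_self : signDirac * signDirac = 1 :=
  signOp_mul_self _ fun p h => by
    have := abs_diracEigenvalue p
    rw [h, abs_zero] at this
    linarith [(p.1.1.cast_nonneg : (0 : ℝ) ≤ _)]

/-- Hilbert–Schmidt operators form a two-sided ideal closed under adjoints, so by the Leibniz rule
the generators suffice. -/
theorem isHilbertSchmidt_commutator {a : Hq →L[ℂ] Hq} (ha : a ∈ Af q) :
    IsHilbertSchmidt (signDirac * a - a * signDirac) := by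
  induction ha using StarAlgebra.adjoin_induction with
  | mem a ha =>
    rcases ha with rfl | rfl
    · rw [signDirac_alpha]
      exact isHilbertSchmidt_weightedShift _ _ _ _ _ _ _
        (summable_sq_of_le_line q _ _ (alpha_sign_bound q))
    · rw [signDirac_beta]
      exact isHilbertSchmidt_weightedShift _ _ _ _ _ _ _
        (summable_sq_of_le_line q _ _ (beta_sign_bound q))
  | algebraMap z => simpa [Algebra.commutes] using IsHilbertSchmidt.zero
  | add a b _ _ h1 h2 =>
    convert h1.add h2 using 1
    noncomm_ring
  | mul a b _ _ h1 h2 =>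
    convert (h1.mul_right b).add (h2.mul_left a) using 1
    noncomm_ring
  | star a _ h =>
    convert h.star.neg using 1
    rw [star_sub, star_mul, star_mul, signDirac, star_signOp]
    noncomm_ring

theorem isSummableFredholmModule : IsSummableFredholmModule (Af q) signDirac 0 where
  isSelfAdjoint := star_signOp _
  sq_eq_one := signDirac_mul_self
  summable _ ha := (isSchattenEven_one_iff _).2 (isHilbertSchmidt_commutator q ha)

end FredholmModule

/-! ### The character of the Fredholm module is a cocycle -/

section Character

variable {ι : Type*}

theorem commutator_anticomm {F : L2 ι →L[ℂ] L2 ι} (hF : F * F = 1) (a : L2 ι →L[ℂ] L2 ι) :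
    (F * a - a * F) * F = -(F * (F * a - a * F)) := by
  simp only [mul_sub, sub_mul, mul_assoc, hF, mul_one, ← mul_assoc F F a, one_mul]
  abel

variable [DecidableEq ι]

theorem tr_add_mul {S₁ T₁ S₂ T₂ : L2 ι →L[ℂ] L2 ι} (h₁ : IsHilbertSchmidt S₁)
    (h₂ : IsHilbertSchmidt T₁) (h₃ : IsHilbertSchmidt S₂) (h₄ : IsHilbertSchmidt T₂) :
    tr (S₁ * T₁ + S₂ * T₂) = tr (S₁ * T₁) + tr (S₂ * T₂) :=
  (h₁.summable_trace h₂).tsum_add (h₃.summable_trace h₄)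

theorem tr_smul (z : ℂ) (T : L2 ι →L[ℂ] L2 ι) : tr (z • T) = z * tr T := tsum_mul_left

theorem tr_neg (T : L2 ι →L[ℂ] L2 ι) : tr (-T) = -tr T := by
  simpa using tr_smul (-1) T

/-- The unnormalized character `Tr (F [F, a] [F, b])`. -/
def trChar (F a b : L2 ι →L[ℂ] L2 ι) : ℂ := tr (F * ((F * a - a * F) * (F * b - b * F)))

variable {F : L2 ι →L[ℂ] L2 ι}

/-- Cyclicity of the trace, followed by anticommutation of `F` with `[F, b]`. -/
theorem trChar_antisymm (hF : F * F = 1) {a b : L2 ι →L[ℂ] L2 ι}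
    (ha : IsHilbertSchmidt (F * a - a * F)) (hb : IsHilbertSchmidt (F * b - b * F)) :
    trChar F a b = -trChar F b a := by
  rw [trChar, ← mul_assoc, IsHilbertSchmidt.tr_mul_comm (ha.mul_left F) hb, ← mul_assoc,
    commutator_anticomm hF b, neg_mul, tr_neg, mul_assoc, trChar]

theorem trChar_add_left {a a' b : L2 ι →L[ℂ] L2 ι} (ha : IsHilbertSchmidt (F * a - a * F))
    (ha' : IsHilbertSchmidt (F * a' - a' * F)) (hb : IsHilbertSchmidt (F * b - b * F)) :
    trChar F (a + a') b = trChar F a b + trChar F a' b := by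
  simp only [trChar, ← mul_assoc F]
  rw [← tr_add_mul (ha.mul_left F) hb (ha'.mul_left F) hb]
  congr 1
  noncomm_ring

theorem trChar_add_right {a b b' : L2 ι →L[ℂ] L2 ι} (ha : IsHilbertSchmidt (F * a - a * F))
    (hb : IsHilbertSchmidt (F * b - b * F)) (hb' : IsHilbertSchmidt (F * b' - b' * F)) :
    trChar F a (b + b') = trChar F a b + trChar F a b' := by
  simp only [trChar, ← mul_assoc F (F * a - a * F)]
  rw [← tr_add_mul (ha.mul_left F) hb (ha.mul_left F) hb']
  congr 1
  noncomm_ring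

theorem trChar_smul_left (z : ℂ) (a b : L2 ι →L[ℂ] L2 ι) :
    trChar F (z • a) b = z * trChar F a b := by
  rw [trChar, trChar, ← tr_smul]
  simp only [mul_smul_comm, smul_mul_assoc, ← smul_sub]

theorem trChar_smul_right (z : ℂ) (a b : L2 ι →L[ℂ] L2 ι) :
    trChar F a (z • b) = z * trChar F a b := by
  rw [trChar, trChar, ← tr_smul]
  simp only [mul_smul_comm, smul_mul_assoc, ← smul_sub]

theorem trChar_one_left (b : L2 ι →L[ℂ] L2 ι) : trChar F 1 b = 0 := by simp [trChar, tr]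

theorem trChar_one_right (a : L2 ι →L[ℂ] L2 ι) : trChar F a 1 = 0 := by simp [trChar, tr]

theorem trChar_zero_left (b : L2 ι →L[ℂ] L2 ι) : trChar F 0 b = 0 := by simp [trChar, tr]

theorem trChar_zero_right (a : L2 ι →L[ℂ] L2 ι) : trChar F a 0 = 0 := by simp [trChar, tr]

theorem trChar_neg_neg (a b : L2 ι →L[ℂ] L2 ι) : trChar F (-a) (-b) = trChar F a b := by
  rw [← neg_one_smul ℂ a, ← neg_one_smul ℂ b, trChar_smul_left, trChar_smul_right]
  ring

theorem trChar_sub_one_left (a b : L2 ι →L[ℂ] L2 ι) : trChar F (a - 1) b = trChar F a b := by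
  simp [trChar, mul_sub, sub_mul]

theorem trChar_sub_one_right (a b : L2 ι →L[ℂ] L2 ι) : trChar F a (b - 1) = trChar F a b := by
  simp [trChar, mul_sub, sub_mul]

/-- Conjugation by `F` reverses the sign of a product of three commutators but preserves its trace.
-/
theorem tr_mul_mul_commutators (hF : F * F = 1) {a b c : L2 ι →L[ℂ] L2 ι}
    (ha : IsHilbertSchmidt (F * a - a * F)) (hb : IsHilbertSchmidt (F * b - b * F)) :
    tr ((F * a - a * F) * ((F * b - b * F) * (F * c - c * F))) = 0 := by
  have h1 := IsHilbertSchmidt.tr_mul_comm (ha.mul_left F)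
    ((hb.mul_right (F * c - c * F)).mul_right F)
  have h2 := IsHilbertSchmidt.tr_mul_comm ha (hb.mul_right (F * c - c * F))
  have e1 : F * (F * a - a * F) * ((F * b - b * F) * (F * c - c * F) * F) =
      -((F * a - a * F) * ((F * b - b * F) * (F * c - c * F))) := by
    rw [mul_assoc (F * b - b * F), commutator_anticomm hF c, mul_neg, ← mul_assoc _ F,
      commutator_anticomm hF b, neg_mul, neg_neg, ← mul_assoc _ (F * _), ← mul_assoc _ F,
      mul_assoc F _ F, commutator_anticomm hF a, mul_neg, ← mul_assoc F, hF, one_mul, neg_mul,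
      neg_mul, mul_assoc]
  have e2 : (F * b - b * F) * (F * c - c * F) * F * (F * (F * a - a * F)) =
      (F * b - b * F) * (F * c - c * F) * (F * a - a * F) := by
    rw [mul_assoc, ← mul_assoc F F, hF, one_mul]
  rw [e1, e2, tr_neg] at h1
  rw [h2] at h1 ⊢
  exact self_eq_neg.1 h1.symm

/-- The Leibniz rule expands each term into two traces. Cyclicity and anticommutation match these up
to traces of three commutators, which vanish. -/
theorem trChar_cocycle (hF : F * F = 1) {a b c : L2 ι →L[ℂ] L2 ι}
    (ha : IsHilbertSchmidt (F * a - a * F)) (hb : IsHilbertSchmidt (F * b - b * F))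
    (hc : IsHilbertSchmidt (F * c - c * F)) :
    trChar F (a * b) c - trChar F a (b * c) + trChar F (c * a) b = 0 := by
  have e1 : trChar F (a * b) c = tr (F * (F * a - a * F) * (b * (F * c - c * F))) +
      tr (F * a * (F * b - b * F) * (F * c - c * F)) := by
    rw [← tr_add_mul (ha.mul_left F) (hc.mul_left b) (hb.mul_left (F * a)) hc, trChar]
    congr 1
    noncomm_ring
  have e2 : trChar F a (b * c) = tr (F * (F * a - a * F) * ((F * b - b * F) * c)) +
      tr (F * (F * a - a * F) * (b * (F * c - c * F))) := by
    rw [← tr_add_mul (ha.mul_left F) (hb.mul_right c) (ha.mul_left F) (hc.mul_left b), trChar]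
    congr 1
    noncomm_ring
  have e3 : trChar F (c * a) b = tr (F * (F * c - c * F) * (a * (F * b - b * F))) +
      tr (F * c * (F * a - a * F) * (F * b - b * F)) := by
    rw [← tr_add_mul (hc.mul_left F) (hb.mul_left a) (ha.mul_left (F * c)) hb, trChar]
    congr 1
    noncomm_ring
  have e4 : tr (F * (F * a - a * F) * ((F * b - b * F) * c)) =
      tr (c * F * (F * a - a * F) * (F * b - b * F)) := by
    rw [IsHilbertSchmidt.tr_mul_comm (ha.mul_left F) (hb.mul_right c),
      IsHilbertSchmidt.tr_mul_comm (ha.mul_left (c * F)) hb]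
    simp only [mul_assoc]
  have e5 : tr (F * (F * c - c * F) * (a * (F * b - b * F))) =
      -tr (a * F * (F * b - b * F) * (F * c - c * F)) := by
    rw [IsHilbertSchmidt.tr_mul_comm (hc.mul_left F) (hb.mul_left a), ← tr_neg,
      ← mul_assoc _ F, mul_assoc a _ F, commutator_anticomm hF b]
    congr 1
    simp only [mul_neg, neg_mul, mul_assoc]
  have e6 : tr (F * c * (F * a - a * F) * (F * b - b * F)) =
      tr ((F * c - c * F) * ((F * a - a * F) * (F * b - b * F))) +
        tr (c * F * (F * a - a * F) * (F * b - b * F)) := by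
    rw [← tr_add_mul hc (ha.mul_right _) (ha.mul_left (c * F)) hb]
    congr 1
    noncomm_ring
  have e7 : tr (F * a * (F * b - b * F) * (F * c - c * F)) =
      tr ((F * a - a * F) * ((F * b - b * F) * (F * c - c * F))) +
        tr (a * F * (F * b - b * F) * (F * c - c * F)) := by
    rw [← tr_add_mul ha (hb.mul_right _) (hb.mul_left (a * F)) hc]
    congr 1
    noncomm_ring
  rw [e1, e2, e3, e4, e5, e6, e7, tr_mul_mul_commutators hF ha hb,
    tr_mul_mul_commutators hF hc ha]
  ring

/-- The constant `λ₁ / 2`. -/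
def characterConst : ℂ :=
  (2 * Complex.I) ^ (1 / 2 : ℂ) * Complex.Gamma (3 / 2) * (1 / 2)

theorem characterConst_ne_zero : characterConst ≠ 0 := by
  refine mul_ne_zero (mul_ne_zero ?_ (Complex.Gamma_ne_zero_of_re_pos (by norm_num))) (by norm_num)
  rw [Ne, Complex.cpow_eq_zero_iff]
  simp

variable {A : StarSubalgebra ℂ (L2 ι →L[ℂ] L2 ι)}

theorem chernCharacter_zero (a : Fin (2 * 0 + 2) → A) :
    chernCharacter A F 0 0 a = characterConst * trChar F (a 0) (a 1) := by
  rw [chernCharacter, if_pos rfl, character, characterConst, trChar]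
  have : (List.ofFn fun i => F * (a i : L2 ι →L[ℂ] L2 ι) - a i * F) =
      [F * (a 0 : L2 ι →L[ℂ] L2 ι) - a 0 * F, F * (a 1 : L2 ι →L[ℂ] L2 ι) - a 1 * F] := by
    simp [List.ofFn_succ]
  rw [this]
  simp only [List.prod_cons, List.prod_nil, mul_one]
  norm_num
  ring

theorem matrixCochain_chernCharacter (M : Fin (2 * 0 + 2) → Matrix (Fin 2) (Fin 2) A) :
    matrixCochain (n := 2 * 0 + 1) (chernCharacter A F 0 0) M =
      characterConst * ∑ i, ∑ j, trChar F (M 0 i j) (M 1 j i) := by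
  rw [matrixCochain, Finset.mul_sum]
  refine (Fintype.sum_equiv (finTwoArrowEquiv (Fin 2)) _
    (fun p => characterConst * trChar F (M 0 p.1 p.2) (M 1 p.2 p.1)) fun i => ?_).trans ?_
  · rw [chernCharacter_zero]
    rfl
  · rw [Fintype.sum_prod_type]
    simp only [Finset.mul_sum]

theorem chernCharacter_succ (k : ℕ) : chernCharacter A F 0 (k + 1) = 0 := by
  funext a
  rw [chernCharacter, if_neg k.succ_ne_zero]
  rfl

/-- The Chern character in degree one, as a multilinear functional. -/
def chernMultilinear (hA : ∀ a ∈ A, IsHilbertSchmidt (F * a - a * F)) :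
    MultilinearMap ℂ (fun _ : Fin (2 * 0 + 2) => A) ℂ where
  toFun a := characterConst * trChar F (a 0) (a 1)
  map_update_add' m i x y := by
    rcases (Fin.forall_fin_two (p := fun i => i = 0 ∨ i = 1)).2 ⟨Or.inl rfl, Or.inr rfl⟩ i with rfl | rfl
    · simp [trChar_add_left (hA x x.2) (hA y y.2) (hA (m 1) (m 1).2), mul_add]
    · simp [trChar_add_right (hA (m 0) (m 0).2) (hA x x.2) (hA y y.2), mul_add]
  map_update_smul' m i z x := by
    rcases (Fin.forall_fin_two (p := fun i => i = 0 ∨ i = 1)).2 ⟨Or.inl rfl, Or.inr rfl⟩ i with rfl | rfl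
    · simp [trChar_smul_left]; ring
    · simp [trChar_smul_right]; ring

/-- `bτ = 0` is `trChar_cocycle`, and `Bτ = 0` because `[F, 1] = 0`. -/
theorem isOddPeriodicCocycle_chernCharacter (hF : F * F = 1)
    (hA : ∀ a ∈ A, IsHilbertSchmidt (F * a - a * F)) :
    IsOddPeriodicCocycle (chernCharacter A F 0) where
  multilinear k := by
    rcases k with _ | k
    · exact ⟨chernMultilinear hA, funext fun a => (chernCharacter_zero a).symm⟩
    · exact ⟨0, (chernCharacter_succ k).symm⟩
  finite := ⟨1, fun k hk => by
    obtain ⟨k, rfl⟩ := Nat.exists_eq_add_of_le' hk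
    exact chernCharacter_succ k⟩
  zero_degree a := by
    have h1 : ∀ a : Fin 1 → A, chernCharacter A F 0 0 (Fin.cons 1 a) = 0 := fun a => by
      rw [chernCharacter_zero]
      simp [trChar_one_left]
    have h2 : ∀ a : Fin 1 → A, chernCharacter A F 0 0 (Fin.snoc a 1) = 0 := fun a => by
      rw [chernCharacter_zero]
      have : (Fin.snoc a 1 : Fin 2 → A) 1 = 1 := Fin.snoc_last (n := 1) _ _
      rw [this, OneMemClass.coe_one, trChar_one_right, mul_zero]
    simp [connesB, connesB₀, h1, h2]
  pos_degree k a := by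
    have h0 : connesB (n := 2 * k + 2) (chernCharacter A F 0 (k + 1)) a = 0 := by
      rw [chernCharacter_succ]
      simp [connesB, connesB₀]
    rw [h0, add_zero]
    rcases k with _ | k
    · have h := trChar_cocycle hF (hA _ (a 0).2) (hA _ (a 1).2) (hA _ (a 2).2)
      simp only [hochschild, chernCharacter_zero]
      rw [Fin.sum_univ_two]
      simp [Fin.contractNth]
      linear_combination characterConst * h
    · rw [chernCharacter_succ]
      simp [hochschild]

end Character

/-! ### The Chern character pairs nontrivially with the fundamental corepresentation -/

section Nonvanishing

variable (q : Set.Ioo (0 : ℝ) 1)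

/-- The generator `α` as an element of `A_f`. -/
def afAlpha : Af q := ⟨alpha q, StarAlgebra.subset_adjoin ℂ _ (Set.mem_insert _ _)⟩

/-- The generator `β` as an element of `A_f`. -/
def afBeta : Af q :=
  ⟨beta q, StarAlgebra.subset_adjoin ℂ _ (Set.mem_insert_of_mem _ (Set.mem_singleton _))⟩

theorem relations_Af : SUqRelations (q : ℝ) (afAlpha q) (afBeta q) where
  star_a_a := Subtype.ext (relations q).star_a_a
  a_star_a := Subtype.ext (relations q).a_star_a
  a_b := Subtype.ext (relations q).a_b
  a_star_b := Subtype.ext (relations q).a_star_b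
  normal_b := Subtype.ext (relations q).normal_b

variable {R : Type*} [Ring R] [StarRing R] [Algebra ℂ R] [StarModule ℂ R]

/-- The fundamental corepresentation `u`, as a matrix with entries in the algebra. -/
def fundamentalMatrix (z : ℂ) (a b : R) : Matrix (Fin 2) (Fin 2) R :=
  !![a, -(z • star b); b, star a]

/-- The adjoint `u*` of the fundamental corepresentation. -/
def fundamentalMatrixStar (z : ℂ) (a b : R) : Matrix (Fin 2) (Fin 2) R :=
  !![star a, star b; -(z • b), a]

variable {t : ℝ} {a b : R}

theorem SUqRelations.star_a_b (h : SUqRelations t a b) :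
    b * star a = (t : ℂ) • (star a * b) := by
  have h2 := congrArg star (sub_eq_zero.1 h.a_star_b)
  rw [star_mul, star_smul, star_mul, star_star] at h2
  exact h2.trans (by rw [Complex.star_def, Complex.conj_ofReal])

theorem SUqRelations.star_b_star_a (h : SUqRelations t a b) :
    star b * star a = (t : ℂ) • (star a * star b) := by
  have h2 := congrArg star (sub_eq_zero.1 h.a_b)
  rw [star_mul, star_smul, star_mul] at h2
  exact h2.trans (by rw [Complex.star_def, Complex.conj_ofReal])

theorem fundamentalMatrix_mul_star (h : SUqRelations t a b) :
    fundamentalMatrix t a b * fundamentalMatrixStar t a b = 1 := by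
  have e1 : a * star a + -((t : ℂ) • star b) * -((t : ℂ) • b) = 1 := by
    rw [neg_mul_neg, smul_mul_smul_comm, h.normal_b, ← sq, ← Complex.ofReal_pow, h.a_star_a]
  have e2 : a * star b + -((t : ℂ) • star b) * a = 0 := by
    rw [neg_mul, smul_mul_assoc, ← sub_eq_add_neg, h.a_star_b]
  have e3 : b * star a + star a * -((t : ℂ) • b) = 0 := by
    rw [h.star_a_b, mul_neg, mul_smul_comm, add_neg_cancel]
  have e4 : b * star b + star a * a = 1 := by
    rw [← h.normal_b, add_comm, h.star_a_a]
  rw [fundamentalMatrix, fundamentalMatrixStar, Matrix.mul_fin_two, e1, e2, e3, e4,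
    Matrix.one_fin_two]

theorem fundamentalMatrixStar_mul (h : SUqRelations t a b) :
    fundamentalMatrixStar t a b * fundamentalMatrix t a b = 1 := by
  have e1 : star a * a + star b * b = 1 := h.star_a_a
  have e2 : star a * -((t : ℂ) • star b) + star b * star a = 0 := by
    rw [h.star_b_star_a, mul_neg, mul_smul_comm, neg_add_cancel]
  have e3 : -((t : ℂ) • b) * a + a * b = 0 := by
    rw [neg_mul, smul_mul_assoc, neg_add_eq_sub, h.a_b]
  have e4 : -((t : ℂ) • b) * -((t : ℂ) • star b) + a * star a = 1 := by
    rw [neg_mul_neg, smul_mul_smul_comm, ← sq, ← Complex.ofReal_pow, add_comm, h.a_star_a]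
  rw [fundamentalMatrix, fundamentalMatrixStar, Matrix.mul_fin_two, e1, e2, e3, e4,
    Matrix.one_fin_two]

/-- For `W = [F, β]` one has `[F, β*] = -W*`, and `W` kills every basis vector on which `F` is `-1`.
The trace is thus minus the squared Hilbert–Schmidt norm of `W`. -/
theorem trChar_beta_ne_zero : trChar signDirac (star (beta q)) (beta q) ≠ 0 := by
  set W := signDirac * beta q - beta q * signDirac with hW
  have hF : signDirac * signDirac = 1 := signDirac_mul_self
  have hHS : IsHilbertSchmidt W :=
    isHilbertSchmidt_commutator q (afBeta q).2
  have h1 : signDirac * star (beta q) - star (beta q) * signDirac = -star W := by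
    rw [hW, star_sub, star_mul, star_mul, signDirac, star_signOp, neg_sub]
  have h2 : trChar signDirac (star (beta q)) (beta q) =
      -((∑' i, ‖W (basisVec i)‖ ^ 2 : ℝ) : ℂ) := by
    rw [trChar, h1, ← hW, neg_mul, mul_neg, tr_neg, tr, Complex.ofReal_tsum]
    congr 1
    refine tsum_congr fun i => ?_
    rw [mul_apply_eq_comp, signDirac, signOp_apply, star_mul_self_apply]
    by_cases hi : i.1.2.1 = i.1.1
    · have : W (basisVec i) = 0 := by
        rw [hW, signDirac_beta]
        refine weightedShift_basisVec_of_notMem _ _ _ _ _ _ _ _ fun k hk => ?_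
        have := k.2
        rw [← hk] at hi
        simp [up] at hi
        omega
      simp [this]
    · rw [sign_diracEigenvalue, if_neg hi]
      simp
  rw [h2, neg_ne_zero, Complex.ofReal_ne_zero]
  -- The witness is the entry from `(1, 0, 1)` to `(0, 0, 0)`: the weight `b₋` is positive there,
  -- and the target lies on the line `x = N` while the source does not.
  refine (hHS.tsum_pos (fun _ => by positivity) (up 0 1 ⟨(0, 0, 0), le_rfl, le_rfl⟩) ?_).ne'
  rw [hW, signDirac_beta, weightedShift_basisVec, norm_smul, norm_basisVec, mul_one, sign_up_zero,
    sign_diracEigenvalue]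
  have h0 := q.2.1
  have hq := q.2.2
  have h3 : 0 < 1 - (q : ℝ) ^ 2 := by nlinarith
  have h4 : 0 < 1 - (q : ℝ) ^ 4 := by nlinarith
  have h5 : 0 < bMinus q 1 0 1 := by
    rw [bMinus]
    norm_num
    positivity
  norm_num
  positivity

/-- Unit words contribute nothing since `[F, 1] = 0`. In the alternating word the two terms in `α`
cancel by antisymmetry, and the two terms in `β`, one of which carries `q²`, combine to the factor
`1 - q²`. -/
theorem representsNonzeroClass :
    RepresentsNonzeroClass (chernCharacter (Af q) signDirac 0) := by
  have hHS : ∀ a ∈ Af q, IsHilbertSchmidt (signDirac * a - a * signDirac) :=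
    fun a ha => isHilbertSchmidt_commutator q ha
  refine ⟨isOddPeriodicCocycle_chernCharacter signDirac_mul_self hHS, fun hco => ?_⟩
  set φ := chernCharacter (Af q) signDirac 0 with hφ
  set U := fundamentalMatrix ((q : ℝ) : ℂ) (afAlpha q) (afBeta q) with hU
  set V := fundamentalMatrixStar ((q : ℝ) : ℂ) (afAlpha q) (afBeta q) with hV
  have h1 : U * V = 1 := fundamentalMatrix_mul_star (relations_Af q)
  have h2 : V * U = 1 := fundamentalMatrixStar_mul (relations_Af q)
  have h := matrixCochain_pairing_eq_zero (fun k => chernCharacter_succ k) hco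
    (X := V - 1) (Y := U - 1)
    (by rw [sub_mul, mul_sub, mul_sub, h2]; simp; abel)
    (by rw [sub_mul, mul_sub, mul_sub, h1]; simp; abel)
  have hA := hHS _ (afAlpha q).2
  have hA' := hHS _ (star (afAlpha q)).2
  have hB := hHS _ (afBeta q).2
  have hB' := hHS _ (star (afBeta q)).2
  have e1 := trChar_antisymm signDirac_mul_self hA hA'
  have e2 := trChar_antisymm signDirac_mul_self hB hB'
  rw [chernPairing, matrixCochain_chernCharacter, matrixCochain_chernCharacter,
    matrixCochain_chernCharacter] at h
  simp only [altWord, unitWord, hU, hV, fundamentalMatrix, fundamentalMatrixStar,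
    Fin.sum_univ_two] at h
  simp [-Complex.coe_smul, trChar_sub_one_left, trChar_sub_one_right, trChar_one_left,
    trChar_one_right, trChar_zero_left, trChar_zero_right, trChar_neg_neg, trChar_smul_left,
    trChar_smul_right, characterConst_ne_zero] at h e1 e2
  have hb : (afBeta q : Hq →L[ℂ] Hq) = beta q := rfl
  rw [e1, e2, hb] at h
  have h3 : (1 - (q : ℂ) ^ 2) * trChar signDirac (star (beta q)) (beta q) = 0 := by
    linear_combination h
  refine mul_ne_zero ?_ (trChar_beta_ne_zero q) h3
  have h0 := q.2.1
  have hq := q.2.2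
  have h4 : 1 - (q : ℝ) ^ 2 ≠ 0 := by nlinarith
  exact_mod_cast h4

end Nonvanishing

/-! ### Spectrum of `β*β` and invertibility of `γ_r` -/

section Invertibility

/-- `a*a = 1 - b*b` and `aa* = 1 - t² b*b` have the same nonzero spectrum, so a spectral value `w ≠
1` of `b*b` yields the spectral value `w / t²`. The orbit of a nonzero value leaves the bounded
spectrum unless it hits `1`. -/
theorem exists_pow_of_mem_spectrum {R : Type*} [NormedRing R] [NormedAlgebra ℂ R] [CompleteSpace R]
    [StarRing R] {t : ℝ} {a b : R} (h : SUqRelations t a b) (h0 : 0 < t) (h1 : t < 1) {z : ℂ}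
    (hz : z ∈ spectrum ℂ (star b * b)) (hz0 : z ≠ 0) : ∃ k : ℕ, z = ((t ^ 2 : ℝ) : ℂ) ^ k := by
  set s : ℂ := ((t ^ 2 : ℝ) : ℂ) with hs
  have hs0 : s ≠ 0 := by
    rw [hs]; exact_mod_cast (pow_pos h0 2).ne'
  have hst : star a * a = algebraMap ℂ R 1 - star b * b := by
    rw [map_one, ← h.star_a_a, add_sub_cancel_right]
  have hts : a * star a = algebraMap ℂ R 1 - s • (star b * b) := by
    rw [map_one, ← h.a_star_a, h.normal_b, add_sub_cancel_right]
  have step : ∀ w ∈ spectrum ℂ (star b * b), w ≠ 1 → w / s ∈ spectrum ℂ (star b * b) := by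
    intro w hw hw1
    have e1 : 1 - w ∈ spectrum ℂ (star a * a) \ {0} := by
      refine ⟨?_, fun h => hw1 (sub_eq_zero.1 h).symm⟩
      rw [hst, ← spectrum.singleton_sub_eq]
      exact Set.sub_mem_sub rfl hw
    rw [spectrum.nonzero_mul_comm, hts, ← spectrum.singleton_sub_eq] at e1
    obtain ⟨x, rfl, y, hy, hxy⟩ := Set.mem_sub.1 e1.1
    have hyw : y = w := sub_right_injective hxy
    subst hyw
    have := spectrum.unit_smul_eq_smul (star b * b) (Units.mk0 s hs0)
    rw [Units.smul_def, Units.val_mk0] at this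
    rw [this] at hy
    obtain ⟨x, hx, hxy⟩ := hy
    have hxy : s * x = y := hxy
    rwa [← hxy, mul_div_cancel_left₀ _ hs0]
  by_contra! hne
  have hall : ∀ k : ℕ, z / s ^ k ∈ spectrum ℂ (star b * b) := by
    intro k
    induction k with
    | zero => simpa using hz
    | succ k ih =>
      rw [pow_succ, ← div_div]
      refine step _ ih fun h => hne k ?_
      exact (div_eq_one_iff_eq (pow_ne_zero k hs0)).1 h
  have hns : ‖s‖ = t ^ 2 := by
    rw [hs, Complex.norm_real, Real.norm_eq_abs, abs_of_nonneg (by positivity)]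
  have hlim := (tendsto_pow_atTop_nhds_zero_of_lt_one (r := t ^ 2) (by positivity)
    (by nlinarith)).const_mul (‖star b * b‖ * ‖(1 : R)‖)
  rw [mul_zero] at hlim
  refine hz0 (norm_le_zero_iff.1 (ge_of_tendsto' hlim fun k => ?_))
  have := spectrum.norm_le_norm_mul_of_mem (hall k)
  rwa [norm_div, norm_pow, hns, div_le_iff₀ (by positivity)] at this

/-- By functional calculus for the normal `b` it suffices that the function has no zero on the
spectrum. At `z = 0` it is `1`. Otherwise `|z|² = t^{2k}`: for `k = 0` its value is `z`, and for `k
≥ 1` it differs from `1` by at most `2 t^{2r} < 1`. -/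
theorem isUnit_gam_of_relations {R : Type*} [CStarAlgebra R] {t : ℝ} {a b : R}
    (h : SUqRelations t a b) (h0 : 0 < t) (h1 : t < 1) {r : ℕ} (hr : t ^ (2 * r) < 1 / 2) :
    IsUnit ((star b * b) ^ r * (b - 1) + 1) := by
  have hb : IsStarNormal b := ⟨h.normal_b⟩
  have hc : cfc (fun z : ℂ => star z * z) b = star b * b := by
    rw [cfc_mul (fun z => star z) (fun z => z) b, cfc_star_id (R := ℂ) b, cfc_id' ℂ b]
  have hg : cfc (fun z : ℂ => (star z * z) ^ r * (z - 1) + 1) b =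
      (star b * b) ^ r * (b - 1) + 1 := by
    rw [cfc_add_const (1 : ℂ) (fun z => (star z * z) ^ r * (z - 1)) b,
      cfc_mul (fun z => (star z * z) ^ r) (fun z => z - 1) b,
      cfc_pow (fun z => star z * z) r b, hc, cfc_sub (fun z => z) (fun _ => 1) b, cfc_id' ℂ b,
      cfc_const_one ℂ b, map_one]
  rw [← hg, isUnit_cfc_iff _ _]
  intro z hz hzero
  -- For `r = 0` the function would vanish at `z = 0`; the bound on `t ^ (2 * r)` excludes this.
  have hr0 : r ≠ 0 := by
    rintro rfl
    norm_num at hr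
  have hzc : star z * z ∈ spectrum ℂ (star b * b) := by
    rw [← hc, cfc_map_spectrum (fun z : ℂ => star z * z) b]
    exact Set.mem_image_of_mem _ hz
  have hne : star z * z ≠ 0 := fun h => by
    rw [h, zero_pow hr0] at hzero
    simp at hzero
  obtain ⟨k, hk⟩ := exists_pow_of_mem_spectrum h h0 h1 hzc hne
  rcases Nat.eq_zero_or_pos k with rfl | hk0
  · rw [hk, pow_zero, one_pow, one_mul, sub_add_cancel] at hzero
    simp [hzero] at hne
  have ht : ‖((t ^ 2 : ℝ) : ℂ)‖ = t ^ 2 := by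
    rw [Complex.norm_real, Real.norm_eq_abs, abs_of_nonneg (by positivity)]
  have hn : ‖z‖ * ‖z‖ = (t ^ 2) ^ k := by
    have := congrArg norm hk
    rwa [norm_mul, norm_star, norm_pow, ht] at this
  have ht1 : t ^ 2 ≤ 1 := by nlinarith
  have hle : (t ^ 2) ^ k ≤ t ^ 2 := pow_le_of_le_one (by positivity) ht1 hk0.ne'
  have hz1 : ‖z‖ ≤ 1 := by nlinarith [norm_nonneg z]
  have hz2 : ‖z - 1‖ ≤ 2 := (norm_sub_le _ _).trans (by rw [norm_one]; linarith)
  have e1 := congrArg norm (eq_neg_of_add_eq_zero_left hzero)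
  rw [norm_mul, norm_pow, norm_mul, norm_star, hn, norm_neg, norm_one] at e1
  have e2 : ((t ^ 2) ^ k) ^ r ≤ t ^ (2 * r) := by
    rw [pow_mul t]
    exact pow_le_pow_left₀ (by positivity) hle r
  have e3 : ((t ^ 2) ^ k) ^ r * ‖z - 1‖ ≤ t ^ (2 * r) * 2 :=
    mul_le_mul e2 hz2 (norm_nonneg _) (by positivity)
  linarith

theorem gam_mem_Af (q : Set.Ioo (0 : ℝ) 1) (r : ℕ) : gam q r ∈ Af q :=
  add_mem (mul_mem (pow_mem (mul_mem (star_mem (afBeta q).2) (afBeta q).2) r)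
    (sub_mem (afBeta q).2 (one_mem _))) (one_mem _)

theorem exists_inverse_gam (q : Set.Ioo (0 : ℝ) 1) {r : ℕ} (hr : (q : ℝ) ^ (2 * r) < 1 / 2) :
    ∃ g ∈ CSUq q, gam q r * g = 1 ∧ g * gam q r = 1 := by
  have hu : IsUnit (gam q r) := isUnit_gam_of_relations (relations q) q.2.1 q.2.2 hr
  have hmem : gam q r ∈ CSUq q := (Af q).le_topologicalClosure (gam_mem_Af q r)
  have : IsClosed (CSUq q : Set (Hq →L[ℂ] Hq)) := (Af q).isClosed_topologicalClosure
  -- Spectral permanence: the inverse stays in the closed `*`-subalgebra.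
  have hu' : IsUnit (⟨gam q r, hmem⟩ : CSUq q) := (StarSubalgebra.coe_isUnit _).1 hu
  obtain ⟨⟨u, v, huv, hvu⟩, rfl : u = _⟩ := hu'
  exact ⟨v, v.2, congrArg Subtype.val huv, congrArg Subtype.val hvu⟩

end Invertibility

/-! ### Index of an invertible operator times a shift -/

section Index

variable {E : Type*} [NormedAddCommGroup E] [NormedSpace ℂ E]

/-- An operator `b v`, with `b` invertible and `v` an injection onto the kernel of a nonzero
functional `φ`, is Fredholm of index `-1`. -/
theorem isFredholm_and_index_of_factorization {C b b' v z : E →L[ℂ] E} {φ : E →L[ℂ] ℂ} {e₀ : E}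
    (hC : C = b * v) (hb : b * b' = 1) (hb' : b' * b = 1) (hzv : z * v = 1)
    (hvz : ∀ x, v (z x) = x - φ x • e₀) (hφ : φ e₀ = 1) :
    C.IsFredholm ∧ fredholmIndex C = -1 := by
  have he : e₀ ≠ 0 := fun h => by simp [h] at hφ
  have hφv : ∀ y, φ (v y) = 0 := fun y => by
    have h := hvz (v y)
    have h2 : z (v y) = y := congrArg (fun T : E →L[ℂ] E => T y) hzv
    rw [h2, eq_comm, sub_eq_self] at h
    exact (smul_eq_zero.1 h).resolve_right he
  have hbb : ∀ x, b (b' x) = x := fun x => congrArg (fun T : E →L[ℂ] E => T x) hb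
  have hbb' : ∀ x, b' (b x) = x := fun x => congrArg (fun T : E →L[ℂ] E => T x) hb'
  have hzvx : ∀ x, z (v x) = x := fun x => congrArg (fun T : E →L[ℂ] E => T x) hzv
  have hCx : ∀ x, C x = b (v x) := fun x => by rw [hC]; rfl
  constructor
  -- `z b'` is a left inverse of `C`, and a right inverse up to an operator of rank one.
  · refine ContinuousLinearMap.IsFredholm.of_isQuasiInverse (v := z * b') ⟨?_, ?_⟩
    · have h : ((z * b' : E →L[ℂ] E) : E →ₗ[ℂ] E) ∘ₗ (C : E →ₗ[ℂ] E) = LinearMap.id := by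
        ext x
        change z (b' (C x)) = x
        rw [hCx, hbb', hzvx]
      rw [LinearMap.IsLeftQuasiInverse, h]
    · rw [LinearMap.IsRightQuasiInverse, LinearMap.FiniteRangeSetoid.equiv_iff_hasNoetherianRange]
      have h : (C : E →ₗ[ℂ] E) ∘ₗ ((z * b' : E →L[ℂ] E) : E →ₗ[ℂ] E) - LinearMap.id =
          LinearMap.toSpanSingleton ℂ E (-(b e₀)) ∘ₗ (φ ∘L b').toLinearMap := by
        ext x
        change C (z (b' x)) - x = φ (b' x) • -(b e₀)
        rw [hCx, hvz, map_sub, map_smul, hbb]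
        module
      rw [h]
      exact LinearMap.HasNoetherianRange.comp_right .of_isNoetherian_dom _
  · have hker : C.ker = ⊥ := by
      rw [LinearMap.ker_eq_bot]
      refine Function.LeftInverse.injective (g := fun x => z (b' x)) fun x => ?_
      change z (b' (C x)) = x
      rw [hCx, hbb', hzvx]
    -- As the kernel of a nonzero functional, the range has codimension one.
    have hran : C.range = LinearMap.ker ((φ ∘L b').toLinearMap) := by
      ext x
      constructor
      · rintro ⟨y, rfl⟩
        change φ (b' (C y)) = 0
        rw [hCx, hbb', hφv]
      · intro hx
        have hx : φ (b' x) = 0 := hx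
        refine ⟨z (b' x), ?_⟩
        change C _ = x
        rw [hCx, hvz, hx, zero_smul, sub_zero, hbb]
    have hsurj : LinearMap.range ((φ ∘L b').toLinearMap) = ⊤ := by
      rw [LinearMap.range_eq_top]
      intro c
      refine ⟨c • b e₀, ?_⟩
      change φ (b' (c • b e₀)) = c
      rw [map_smul, map_smul, hbb', hφ, smul_eq_mul, mul_one]
    rw [fredholmIndex, hker, hran,
      ((φ ∘L b').toLinearMap.quotKerEquivOfSurjective (LinearMap.range_eq_top.1 hsurj)).finrank_eq]
    simp

end Index

/-! ### Compressions to the range of a projection -/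

section Compression

variable {H : Type*} [NormedAddCommGroup H] [InnerProductSpace ℂ H] {P : H →L[ℂ] H}

theorem coe_compression (T : H →L[ℂ] H) (x : P.range) :
    (compression P T x : H) = P (T (P x)) := rfl

theorem compression_mul (hP : P * P = P) {S T : H →L[ℂ] H} (hT : Commute P T) :
    compression P (S * T) = compression P S * compression P T := by
  ext x
  rw [mul_apply_eq_comp, coe_compression, coe_compression, coe_compression]
  have h := congrArg (fun T : H →L[ℂ] H => T (P x)) hT.eq
  have h2 := congrArg (fun T : H →L[ℂ] H => T x) hP
  have h3 := congrArg (fun P : H →L[ℂ] H => P (T (P x))) hP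
  simp only [mul_apply_eq_comp] at h h2 h3 ⊢
  rw [h2] at h h3
  rw [h3, h]

theorem compression_one (hP : P * P = P) : compression P (1 : H →L[ℂ] H) = 1 := by
  ext ⟨_, y, rfl⟩
  have h2 := congrArg (fun T : H →L[ℂ] H => T y) hP
  have h3 := congrArg (fun T : H →L[ℂ] H => T (P y)) hP
  simp only [mul_apply_eq_comp] at h2 h3
  rw [coe_compression, one_apply_eq_self, one_apply_eq_self]
  change P (P (P y)) = P y
  rw [h3, h2]

theorem compression_congr {S T : H →L[ℂ] H} (h : P * S * P = P * T * P) :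
    compression P S = compression P T := by
  ext x
  exact congrArg (fun T : H →L[ℂ] H => T x) h

/-- The index of a compression `P T P` which factors through operators commuting with `P`. -/
theorem isFredholm_and_index_compression (hP : P * P = P) {T V Z : H →L[ℂ] H}
    (B : (H →L[ℂ] H)ˣ) (hB : Commute P B) (hV : Commute P V) {φ : H →L[ℂ] ℂ} {e₀ : H}
    (he₀ : P e₀ = e₀) (hT : P * T * P = P * (B * V) * P) (hZV : Z * V = 1)
    (hVZ : ∀ x, V (Z x) = x - φ x • e₀) (hφ : φ e₀ = 1) (hZ : Commute P Z) :
    (compression P T).IsFredholm ∧ fredholmIndex (compression P T) = -1 := by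
  refine isFredholm_and_index_of_factorization (b := compression P B)
    (b' := compression P (↑B⁻¹ : H →L[ℂ] H)) (v := compression P V) (z := compression P Z)
    (φ := φ ∘L P.range.subtypeL) (e₀ := ⟨e₀, e₀, he₀⟩) ?_ ?_ ?_ ?_ ?_ hφ
  · rw [compression_congr hT, compression_mul hP hV]
  · rw [← compression_mul hP hB.units_inv_right, Units.mul_inv, compression_one hP]
  · rw [← compression_mul hP hB, Units.inv_mul, compression_one hP]
  · rw [← compression_mul hP hV, hZV, compression_one hP]
  · intro x
    rw [← mul_apply_eq_comp, ← compression_mul hP hZ]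
    ext1
    obtain ⟨_, y, rfl⟩ := x
    rw [coe_compression, mul_apply_eq_comp, hVZ]
    have h2 := congrArg (fun T : H →L[ℂ] H => T y) hP
    simp only [mul_apply_eq_comp] at h2
    change P (P (P y) - φ (P (P y)) • e₀) = P y - φ (P y) • e₀
    rw [h2, map_sub, map_smul, he₀, h2]

end Compression

/-! ### Invertible diagonal operators and rescaling -/

section Diagonal

variable {ι : Type*} [DecidableEq ι]

theorem weightedShift_id_basisVec (s : ι → ι) (hs : Function.Injective s) (c : ι → ℝ) (C : ℝ)
    (hc : ∀ k, |c k| ≤ C) (k : ι) :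
    weightedShift id s Function.injective_id hs c C hc (basisVec k) = (c k : ℂ) • basisVec (s k) :=
  weightedShift_basisVec id s Function.injective_id hs c C hc k

theorem isUnit_diagonal (c : ι → ℝ) (C : ℝ) (hc : ∀ k, |c k| ≤ C) {δ : ℝ} (hδ : 0 < δ)
    (h : ∀ k, δ ≤ |c k|) :
    IsUnit (weightedShift id id Function.injective_id Function.injective_id c C hc) := by
  have hne : ∀ k, (c k : ℂ) ≠ 0 := fun k h0 => by
    have := h k
    rw [Complex.ofReal_eq_zero.1 h0, abs_zero] at this
    exact this.not_gt hδ
  have hc' : ∀ k, |(c k)⁻¹| ≤ δ⁻¹ := fun k => by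
    rw [abs_inv]
    exact inv_anti₀ hδ (h k)
  refine ⟨⟨weightedShift id id Function.injective_id Function.injective_id c C hc,
    weightedShift id id Function.injective_id Function.injective_id _ _ hc', ext_basisVec fun k => ?_,
    ext_basisVec fun k => ?_⟩, rfl⟩
  all_goals
    rw [mul_apply_eq_comp, weightedShift_id_basisVec, map_smul, id, weightedShift_id_basisVec,
      smul_smul, Complex.ofReal_inv, one_apply_eq_self, id]
  · rw [inv_mul_cancel₀ (hne k), one_smul]
  · rw [mul_inv_cancel₀ (hne k), one_smul]

/-- A diagonal conjugation by `w` makes all weights `κ` small, including the finitely many large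
ones. It is geometric of ratio `ε / D`, with `D` a bound for `|κ|`, up to the place from which `|κ|
≤ ε`, and constant afterwards; thus it is bounded below. -/
theorem exists_rescaling {κ : ℕ → ℝ} (hκ : Filter.Tendsto κ Filter.atTop (nhds 0)) {ε : ℝ}
    (hε : 0 < ε) : ∃ (w : ℕ → ℝ) (δ : ℝ), 0 < δ ∧ (∀ N, δ ≤ w N ∧ w N ≤ 1) ∧
      ∀ N, |κ N| * w (N + 1) ≤ ε * w N := by
  obtain ⟨M, hM⟩ : ∃ M, ∀ N ≥ M, |κ N| ≤ ε := by
    have := (Metric.tendsto_atTop.1 hκ) ε hε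
    obtain ⟨M, hM⟩ := this
    exact ⟨M, fun N hN => by simpa [Real.dist_eq] using (hM N hN).le⟩
  obtain ⟨C, hC⟩ := hκ.abs.bddAbove_range
  set D := max C ε with hD
  have hD0 : 0 < D := lt_max_of_lt_right hε
  have hx1 : ε / D ≤ 1 := div_le_one_of_le₀ (le_max_right _ _) hD0.le
  have hx0 : 0 < ε / D := by positivity
  refine ⟨fun N => (ε / D) ^ min N M, (ε / D) ^ M, by positivity, fun N => ⟨?_, ?_⟩, fun N => ?_⟩
  · exact pow_le_pow_of_le_one hx0.le hx1 (min_le_right _ _)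
  · exact pow_le_one₀ hx0.le hx1
  · dsimp only
    rcases lt_or_ge N M with h | h
    · rw [min_eq_left h.le, min_eq_left h, pow_succ]
      have h1 : |κ N| ≤ D := (hC ⟨N, rfl⟩).trans (le_max_left _ _)
      calc |κ N| * ((ε / D) ^ N * (ε / D)) ≤ D * ((ε / D) ^ N * (ε / D)) := by gcongr
        _ = ε * (ε / D) ^ N := by field_simp
    · rw [min_eq_right h, min_eq_right (by omega)]
      have := hM N h
      gcongr

end Diagonal

/-! ### Bidiagonal operators on the chains `(N, N, y)` -/

section Bidiagonal

/-- The labels `(N, N, 0)`. -/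
def corner (N : ℕ) : Idx := ⟨(N, N, 0), le_rfl, N.zero_le⟩

/-- The label `p` is one of the `(N, N, 0)`. -/
def IsCorner (p : Idx) : Prop := p.1.2.1 = p.1.1 ∧ p.1.2.2 = 0

instance : DecidablePred IsCorner := fun _ => inferInstanceAs (Decidable (_ ∧ _))

theorem isCorner_iff {p : Idx} : IsCorner p ↔ p = corner p.1.1 := by
  constructor
  · rintro ⟨h1, h2⟩
    exact Subtype.ext (Prod.ext rfl (Prod.ext h1 h2))
  · intro h
    rw [h]
    exact ⟨rfl, rfl⟩

theorem isCorner_corner (N : ℕ) : IsCorner (corner N) := ⟨rfl, rfl⟩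

theorem up_corner (N : ℕ) : up 1 0 (corner N) = corner (N + 1) := rfl

theorem isCorner_up {p : Idx} : IsCorner (up 1 0 p) ↔ IsCorner p := by
  simp [IsCorner, up]

/-- The injection of labels which moves `(N, N, 0)` to `(N + 1, N + 1, 0)`. -/
def cornerShift (p : Idx) : Idx := if IsCorner p then up 1 0 p else p

theorem cornerShift_injective : Function.Injective cornerShift := by
  intro p p' h
  by_cases h1 : IsCorner p <;> by_cases h2 : IsCorner p' <;>
    simp only [cornerShift, h1, h2, if_true, if_false] at h
  · exact up_injective 1 0 h
  · exact absurd (h ▸ isCorner_up.2 h1) h2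
  · exact absurd (h ▸ isCorner_up.2 h2) h1
  · exact h

theorem cornerShift_ne (p : Idx) : cornerShift p ≠ corner 0 := by
  intro h
  by_cases h1 : IsCorner p
  · rw [cornerShift, if_pos h1] at h
    have := congrArg (fun p : Idx => p.1.1) h
    simp [up, corner] at this
  · rw [cornerShift, if_neg h1] at h
    exact h1 (h ▸ isCorner_corner 0)

theorem exists_cornerShift {p : Idx} (hp : p ≠ corner 0) : ∃ p', cornerShift p' = p := by
  by_cases h : IsCorner p
  · rw [isCorner_iff] at h
    rcases hN : p.1.1 with _ | N
    · rw [hN] at h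
      exact absurd h hp
    · refine ⟨corner N, ?_⟩
      rw [cornerShift, if_pos (isCorner_corner N), up_corner, h, hN]
  · exact ⟨p, if_neg h⟩

theorem sign_cornerShift (p : Idx) :
    Real.sign (diracEigenvalue (cornerShift p)) = Real.sign (diracEigenvalue p) := by
  rw [cornerShift]
  split_ifs
  · exact sign_up_one 0 p
  · rfl

theorem commute_signDirac_weightedShift (r s : Idx → Idx) (hr : Function.Injective r)
    (hs : Function.Injective s) (c : Idx → ℝ) (C : ℝ) (hc : ∀ k, |c k| ≤ C)
    (h : ∀ k, Real.sign (diracEigenvalue (s k)) = Real.sign (diracEigenvalue (r k))) :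
    Commute signDirac (weightedShift r s hr hs c C hc) := by
  have h2 : ∀ k, |c k * (Real.sign (diracEigenvalue (s k)) - Real.sign (diracEigenvalue (r k)))| ≤
      0 := fun k => by rw [h k]; simp
  have h3 := signOp_mul_sub_mul_signOp _ r s hr hs _ _ hc _ h2
  have h4 := norm_le_zero_iff.1 (weightedShift_norm_le r s hr hs _ _ h2 le_rfl)
  exact sub_eq_zero.1 (h3.trans h4)

/-- The isometry `e_p ↦ e_{cornerShift p}`. -/
def cornerIsometry : Hq →L[ℂ] Hq :=
  weightedShift id cornerShift Function.injective_id cornerShift_injective (fun _ => 1) 1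
    (fun _ => by simp)

theorem cornerIsometry_basisVec (p : Idx) :
    cornerIsometry (basisVec p) = basisVec (cornerShift p) := by
  rw [cornerIsometry, weightedShift_id_basisVec]
  simp

theorem star_cornerIsometry_basisVec (p : Idx) :
    star cornerIsometry (basisVec (cornerShift p)) = basisVec p := by
  rw [cornerIsometry, star_weightedShift, weightedShift_basisVec]
  simp

theorem star_cornerIsometry_mul : star cornerIsometry * cornerIsometry = 1 :=
  ext_basisVec fun p => by
    rw [mul_apply_eq_comp, cornerIsometry_basisVec, star_cornerIsometry_basisVec, one_apply_eq_self]

theorem cornerIsometry_star_apply (f : Hq) : cornerIsometry (star cornerIsometry f) =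
    f - innerSL ℂ (basisVec (corner 0)) f • basisVec (corner 0) := by
  have h : cornerIsometry * star cornerIsometry =
      1 - (innerSL ℂ (basisVec (corner 0) : Hq)).smulRight (basisVec (corner 0) : Hq) := by
    refine ext_basisVec fun p => ?_
    rw [mul_apply_eq_comp, sub_apply, one_apply_eq_self, ContinuousLinearMap.smulRight_apply,
      innerSL_apply_apply, inner_basisVec, basisVec_apply]
    by_cases hp : p = corner 0
    · rw [if_pos hp.symm, hp, one_smul, sub_self, cornerIsometry, star_weightedShift,
        weightedShift_basisVec_of_notMem _ _ _ _ _ _ _ _ cornerShift_ne, map_zero]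
    · obtain ⟨p, rfl⟩ := exists_cornerShift hp
      rw [if_neg (Ne.symm hp), star_cornerIsometry_basisVec, cornerIsometry_basisVec, zero_smul,
        sub_zero]
  exact congrArg (fun T : Hq →L[ℂ] Hq => T f) h

theorem commute_signDirac_cornerIsometry : Commute signDirac cornerIsometry :=
  commute_signDirac_weightedShift _ _ _ _ _ _ _ sign_cornerShift

theorem commute_signDirac_star_cornerIsometry : Commute signDirac (star cornerIsometry) := by
  have := commute_signDirac_cornerIsometry.star_star
  rwa [signDirac, star_signOp] at this

/-- The lower bidiagonal operator `e_p ↦ d_p e_p + t_p e_{up p}` on the span of the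
`e^{(n)}_{nj}` is the composition of an invertible operator with `cornerIsometry`, if it is
diagonally dominated for `j > -n` and subdiagonally dominated, asymptotically, for `j = -n`. -/
theorem exists_unit_mul_cornerIsometry (d t : Idx → ℝ) {ρ δ : ℝ} (hρ0 : 0 ≤ ρ) (hρ : ρ < 1 / 2)
    (hd : ∀ p : Idx, p.1.2.1 = p.1.1 → ¬ IsCorner p → 1 - ρ ≤ d p ∧ |d p| ≤ 1 ∧ |t p| ≤ ρ)
    (hδ : 0 < δ) (ht : ∀ N, δ ≤ |t (corner N)| ∧ |t (corner N)| ≤ 1)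
    (hlim : Filter.Tendsto (fun N => d (corner N) / t (corner N)) Filter.atTop (nhds 0)) :
    ∃ B : (Hq →L[ℂ] Hq)ˣ, Commute signDirac B ∧ ∀ p : Idx, p.1.2.1 = p.1.1 →
      (B : Hq →L[ℂ] Hq) (basisVec (cornerShift p)) =
        (d p : ℂ) • basisVec p + (t p : ℂ) • basisVec (up 1 0 p) := by
  have hρ1 : 0 < 1 - ρ := by linarith
  have hσ : ρ / (1 - ρ) < 1 := by rw [div_lt_one hρ1]; linarith
  -- Half of the room below `1` left by `S₂`, whose norm is at most `ρ / (1 - ρ)`.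
  set ε := (1 - ρ / (1 - ρ)) / 2 with hε
  have hε0 : 0 < ε := by rw [hε]; linarith
  obtain ⟨w, η, hη, hw, hκ⟩ := exists_rescaling hlim hε0
  have hw0 : ∀ N, 0 < w N := fun N => hη.trans_le (hw N).1
  -- the diagonal rescaling
  have hW : ∀ p : Idx, |if IsCorner p then w p.1.1 else 1| ≤ 1 := fun p => by
    split_ifs
    · rw [abs_of_pos (hw0 _)]; exact (hw _).2
    · simp
  have hη1 : η ≤ 1 := (hw 0).1.trans (hw 0).2
  have hW' : ∀ p : Idx, η ≤ |if IsCorner p then w p.1.1 else 1| := fun p => by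
    split_ifs
    · rw [abs_of_pos (hw0 _)]; exact (hw _).1
    · simpa using hη1
  have hWi : ∀ p : Idx, |if IsCorner p then (w p.1.1)⁻¹ else 1| ≤ η⁻¹ := fun p => by
    split_ifs
    · rw [abs_inv, abs_of_pos (hw0 _)]; exact inv_anti₀ hη (hw _).1
    · simpa using (one_le_inv₀ hη).2 hη1
  have hWi' : ∀ p : Idx, 1 ≤ |if IsCorner p then (w p.1.1)⁻¹ else 1| := fun p => by
    split_ifs
    · rw [abs_inv, abs_of_pos (hw0 _)]; exact (one_le_inv₀ (hw0 _)).2 (hw _).2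
    · simp
  -- the diagonal part
  let m : Idx → ℝ := fun p => if IsCorner p then
    (if p.1.1 = 0 then 1 else t (corner (p.1.1 - 1))) else if p.1.2.1 = p.1.1 then d p else 1
  have hm : ∀ p, |m p| ≤ 1 := fun p => by
    simp only [m]
    split_ifs with h1 h2 h3
    · simp
    · exact (ht _).2
    · exact (hd p h3 h1).2.1
    · simp
  have hm' : ∀ p, min δ (1 - ρ) ≤ |m p| := fun p => by
    have h0 : min δ (1 - ρ) ≤ 1 := (min_le_right _ _).trans (by linarith)
    simp only [m]
    split_ifs with h1 h2 h3
    · simpa using h0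
    · exact (min_le_left _ _).trans (ht _).1
    · exact (min_le_right _ _).trans ((hd p h3 h1).1.trans (le_abs_self _))
    · simpa using h0
  -- the off-diagonal parts
  have hS₁ : ∀ p : Idx, |if IsCorner p then d p / t p * w (p.1.1 + 1) / w p.1.1 else 0| ≤ ε :=
    fun p => by
      split_ifs with h
      · have := hκ p.1.1
        rw [isCorner_iff] at h
        rw [← h] at this
        rw [abs_div, abs_mul, abs_of_pos (hw0 (_ + 1)), abs_of_pos (hw0 p.1.1),
          div_le_iff₀ (hw0 _)]
        exact this
      · rw [abs_zero]; exact hε0.le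
  have hS₂ : ∀ p : Idx, |if p.1.2.1 = p.1.1 ∧ ¬ IsCorner p then t p / d p else 0| ≤
      ρ / (1 - ρ) := fun p => by
    split_ifs with h
    · obtain ⟨h1, h2, h3⟩ := hd p h.1 h.2
      rw [abs_div]
      exact div_le_div₀ hρ0 h3 hρ1 (h1.trans (le_abs_self _))
    · rw [abs_zero]; positivity
  set W := weightedShift id id Function.injective_id Function.injective_id _ _ hW with hWdef
  set Wi := weightedShift id id Function.injective_id Function.injective_id _ _ hWi with hWidef
  set M := weightedShift id id Function.injective_id Function.injective_id _ _ hm with hMdef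
  set S₁ := weightedShift (up 1 0) id (up_injective 1 0) Function.injective_id _ _ hS₁ with hS₁def
  set S₂ := weightedShift id (up 1 0) Function.injective_id (up_injective 1 0) _ _ hS₂ with hS₂def
  have hnorm : ‖-(S₁ + S₂)‖ < 1 := by
    rw [norm_neg]
    refine (norm_add_le _ _).trans_lt ?_
    have h1 := weightedShift_norm_le _ _ (up_injective 1 0) Function.injective_id _ _ hS₁ hε0.le
    have h2 := weightedShift_norm_le _ _ Function.injective_id (up_injective 1 0) _ _ hS₂
      (by positivity)
    have h3 : ε + ρ / (1 - ρ) < 1 := by rw [hε]; linarith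
    exact (add_le_add h1 h2).trans_lt h3
  have hK : IsUnit (1 + (S₁ + S₂)) := by
    have := (Units.oneSub _ hnorm).isUnit
    rwa [Units.val_oneSub, sub_neg_eq_add] at this
  -- Each column is divided by its dominant entry, `t` on the chain of corners and `d` on the
  -- others; the remainder is inverted by a Neumann series after rescaling by `W`. The diagonal
  -- entry at `corner 0` is free, since `cornerShift` misses that label, and is set to `1`.
  have hB : IsUnit (W * (1 + (S₁ + S₂)) * Wi * M) :=
    (((isUnit_diagonal _ _ hW hη hW').mul hK).mul (isUnit_diagonal _ _ hWi one_pos hWi')).mul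
      (isUnit_diagonal _ _ hm (lt_min hδ hρ1) hm')
  refine ⟨hB.unit, ?_, fun p hp => ?_⟩
  · rw [IsUnit.unit_spec]
    refine (((commute_signDirac_weightedShift _ _ _ _ _ _ _ fun _ => rfl).mul_right
      ((Commute.one_right _).add_right (.add_right ?_ ?_))).mul_right
      (commute_signDirac_weightedShift _ _ _ _ _ _ _ fun _ => rfl)).mul_right
      (commute_signDirac_weightedShift _ _ _ _ _ _ _ fun _ => rfl)
    · exact commute_signDirac_weightedShift _ _ _ _ _ _ _ fun k => (sign_up_one 0 k).symm
    · exact commute_signDirac_weightedShift _ _ _ _ _ _ _ fun k => sign_up_one 0 k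
  · rw [IsUnit.unit_spec]
    have hWb : ∀ k, W (basisVec k) = ((if IsCorner k then w k.1.1 else 1 : ℝ) : ℂ) • basisVec k :=
      fun k => weightedShift_id_basisVec _ _ _ _ _ k
    have hWib : ∀ k, Wi (basisVec k) =
        ((if IsCorner k then (w k.1.1)⁻¹ else 1 : ℝ) : ℂ) • basisVec k :=
      fun k => weightedShift_id_basisVec _ _ _ _ _ k
    have hMb : ∀ k, M (basisVec k) = (m k : ℂ) • basisVec k :=
      fun k => weightedShift_id_basisVec _ _ _ _ _ k
    have hS₂b : ∀ k, S₂ (basisVec k) =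
        ((if k.1.2.1 = k.1.1 ∧ ¬ IsCorner k then t k / d k else 0 : ℝ) : ℂ) •
          basisVec (up 1 0 k) := fun k => weightedShift_id_basisVec _ _ _ _ _ k
    rw [mul_apply_eq_comp, mul_apply_eq_comp, mul_apply_eq_comp, hMb, map_smul, map_smul, map_smul,
      hWib, map_smul, map_smul, add_apply, add_apply, one_apply_eq_self, hS₂b, map_add, map_add,
      map_smul, hWb]
    by_cases hc : IsCorner p
    · obtain ⟨N, rfl⟩ : ∃ N, p = corner N := ⟨_, isCorner_iff.1 hc⟩
      have e1 : S₁ (basisVec (corner (N + 1))) =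
          ((d (corner N) / t (corner N) * w (N + 1) / w N : ℝ) : ℂ) • basisVec (corner N) := by
        have := weightedShift_basisVec _ _ (up_injective 1 0) Function.injective_id _ _ hS₁
          (corner N)
        rwa [if_pos (isCorner_corner N)] at this
      have ht0 : (t (corner N) : ℂ) ≠ 0 := fun h => by
        have := (ht N).1
        rw [Complex.ofReal_eq_zero.1 h, abs_zero] at this
        linarith
      have hwN : (w N : ℂ) ≠ 0 := by exact_mod_cast (hw0 N).ne'
      have hwN' : (w (N + 1) : ℂ) ≠ 0 := by exact_mod_cast (hw0 (N + 1)).ne'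
      have em : m (corner (N + 1)) = t (corner N) := by
        change (if IsCorner _ then (if N + 1 = 0 then 1 else t (corner (N + 1 - 1))) else _) = _
        rw [if_pos (isCorner_corner _), if_neg N.succ_ne_zero, Nat.add_sub_cancel]
      rw [cornerShift, if_pos hc, up_corner, e1, map_smul, hWb, hWb, em,
        if_pos (isCorner_corner _), if_pos (isCorner_corner _), if_pos (isCorner_corner _),
        if_neg (fun h => h.2 (isCorner_corner _))]
      simp only [smul_smul, Complex.ofReal_zero, zero_mul, zero_smul, add_zero, smul_add]
      rw [add_comm]
      congr 2
      · change (t (corner N) : ℂ) * (((w (N + 1))⁻¹ : ℝ) * (((d (corner N) / t (corner N) *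
          w (N + 1) / w N : ℝ) : ℂ) * w N)) = d (corner N)
        push_cast
        field_simp
      · change (t (corner N) : ℂ) * (((w (N + 1))⁻¹ : ℝ) * (w (N + 1) : ℂ)) = t (corner N)
        push_cast
        field_simp
    · have e1 : S₁ (basisVec p) = 0 := by
        by_cases hk : ∃ k, up 1 0 k = p
        · obtain ⟨k, rfl⟩ := hk
          have := weightedShift_basisVec _ _ (up_injective 1 0) Function.injective_id _ _ hS₁ k
          rw [if_neg (fun h => hc (isCorner_up.2 h)), Complex.ofReal_zero, zero_smul] at this
          exact this
        · exact weightedShift_basisVec_of_notMem _ _ _ _ _ _ _ _ fun k h => hk ⟨k, h⟩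
      have hd0 : (d p : ℂ) ≠ 0 := fun h => by
        have := (hd p hp hc).1
        rw [Complex.ofReal_eq_zero.1 h] at this
        linarith
      have em : m p = d p := by simp [m, hc, hp]
      rw [cornerShift, if_neg hc, e1, map_zero, hWb, em, if_neg hc, if_neg hc, if_pos ⟨hp, hc⟩,
        if_neg (fun h => hc (isCorner_up.1 h))]
      simp only [smul_smul, Complex.ofReal_one, one_smul, zero_add, smul_add, one_mul]
      congr 2
      push_cast
      field_simp

end Bidiagonal

/-! ### Operator inequalities from the relations -/

section Inequalities

theorem commute_one_sub_pow {R : Type*} [Ring R] (c : R) (m : ℕ) : Commute c (1 - c ^ m) :=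
  (Commute.one_right c).sub_right (Commute.pow_right rfl m)

variable {R : Type*} [CStarAlgebra R] {t : ℝ} {a b : R}

theorem SUqRelations.pow_mul_star_a (h : SUqRelations t a b) (m : ℕ) :
    (star b * b) ^ m * star a = ((t ^ (2 * m) : ℝ) : ℂ) • (star a * (star b * b) ^ m) := by
  have h1 : star b * b * star a = ((t ^ 2 : ℝ) : ℂ) • (star a * (star b * b)) := by
    rw [mul_assoc, h.star_a_b, mul_smul_comm, ← mul_assoc, h.star_b_star_a, smul_mul_assoc,
      smul_smul, mul_assoc]
    push_cast
    rw [sq]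
  induction m with
  | zero => simp
  | succ m ih =>
    rw [pow_succ', mul_assoc, ih, mul_smul_comm, ← mul_assoc, h1, smul_mul_assoc, smul_smul,
      mul_assoc, ← Complex.ofReal_mul, ← pow_add, ← mul_add_one]

variable [PartialOrder R] [StarOrderedRing R]

theorem one_sub_pow_nonneg {c : R} (h0 : 0 ≤ c) (h1 : 0 ≤ 1 - c) (m : ℕ) : 0 ≤ 1 - c ^ m := by
  induction m with
  | zero => simp
  | succ m ih =>
    have h : 1 - c ^ (m + 1) = (1 - c) + c * (1 - c ^ m) := by
      rw [pow_succ']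
      noncomm_ring
    rw [h]
    exact add_nonneg h1 (Commute.mul_nonneg h0 ih (commute_one_sub_pow c m))

/-- Bernoulli's inequality for a positive contraction. -/
theorem one_sub_pow_le {c : R} (h0 : 0 ≤ c) (h1 : 0 ≤ 1 - c) (m : ℕ) :
    1 - c ^ m ≤ m • (1 - c) := by
  induction m with
  | zero => simp
  | succ m ih =>
    have h : 1 - c ^ (m + 1) = (1 - c ^ m) + (1 - c) - (1 - c) * (1 - c ^ m) := by
      rw [pow_succ']
      noncomm_ring
    rw [h, succ_nsmul]
    refine (sub_le_self _ (Commute.mul_nonneg h1 (one_sub_pow_nonneg h0 h1 m) ?_)).trans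
      (add_le_add_left ih _)
    exact (Commute.one_left _).sub_left (commute_one_sub_pow c m)

theorem SUqRelations.one_sub_nonneg (h : SUqRelations t a b) : 0 ≤ 1 - star b * b := by
  rw [← h.star_a_a, add_sub_cancel_right]
  exact star_mul_self_nonneg a

/-- With `c = b*b`, moving `a*` to the left of `c^m` costs `t^{2m}`, which gives `t^{2m} aa* c^m`.
Here `aa* = 1 - t² c` is positive and commutes with `c^m ≤ 1`. -/
theorem SUqRelations.conj_pow_le (h : SUqRelations t a b) (h0 : 0 ≤ t) (m : ℕ) :
    a * (star b * b) ^ m * star a ≤ ((t ^ (2 * m) : ℝ) : ℂ) • (a * star a) := by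
  have hc0 : 0 ≤ star b * b := star_mul_self_nonneg b
  have hc1 := h.one_sub_nonneg
  have e1 : a * star a = (1 - star b * b) + ((1 - t ^ 2 : ℝ) : ℂ) • (star b * b) := by
    have := h.a_star_a
    rw [← h.normal_b] at this
    rw [eq_sub_of_add_eq this]
    push_cast
    module
  have e2 : 0 ≤ a * star a := mul_star_self_nonneg a
  have e3 : Commute (a * star a) (1 - (star b * b) ^ m) := by
    rw [e1]
    exact ((Commute.one_left _).sub_left (commute_one_sub_pow _ m)).add_left
      ((commute_one_sub_pow _ m).smul_left _)
  have e4 := Commute.mul_nonneg e2 (one_sub_pow_nonneg hc0 hc1 m) e3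
  have e5 : ((t ^ (2 * m) : ℝ) : ℂ) • (a * star a) - a * (star b * b) ^ m * star a =
      t ^ (2 * m) • (a * star a * (1 - (star b * b) ^ m)) := by
    rw [mul_assoc, h.pow_mul_star_a, mul_smul_comm, ← smul_sub, mul_sub, mul_one, ← mul_assoc,
      Complex.coe_smul]
  rw [← sub_nonneg, e5]
  exact smul_nonneg (by positivity) e4

end Inequalities

/-! ### Expectations of positive operators -/

section DiagonalEntries

variable {ι : Type*}

theorem re_apply_nonneg {T : L2 ι →L[ℂ] L2 ι} (hT : 0 ≤ T) (f : L2 ι) :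
    0 ≤ (inner ℂ f (T f)).re :=
  ((ContinuousLinearMap.nonneg_iff_isPositive _).1 hT).re_inner_nonneg_right f

theorem re_apply_le {S T : L2 ι →L[ℂ] L2 ι} (h : S ≤ T) (f : L2 ι) :
    (inner ℂ f (S f)).re ≤ (inner ℂ f (T f)).re := by
  have := re_apply_nonneg (sub_nonneg.2 h) f
  rw [sub_apply, inner_sub_right, Complex.sub_re] at this
  linarith

theorem apply_basisVec_eq_re [DecidableEq ι] {T : L2 ι →L[ℂ] L2 ι} (hT : IsSelfAdjoint T) (i : ι) :
    (T (basisVec i) : L2 ι) i = ((inner ℂ (basisVec i) (T (basisVec i))).re : ℂ) := by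
  rw [inner_basisVec]
  have h := star_apply_basisVec T i i
  rw [hT.star_eq] at h
  exact (Complex.conj_eq_iff_re.1 h.symm).symm

theorem inner_star_mul_self (S : L2 ι →L[ℂ] L2 ι) (f : L2 ι) :
    inner ℂ f ((star S * S) f) = ((‖S f‖ ^ 2 : ℝ) : ℂ) := by
  rw [mul_apply_eq_comp, ContinuousLinearMap.star_eq_adjoint,
    ContinuousLinearMap.adjoint_inner_right, inner_self_eq_norm_sq_to_K]
  simp

theorem inner_mul_mul_star (S T : L2 ι →L[ℂ] L2 ι) (f : L2 ι) :
    inner ℂ f ((S * T * star S) f) = inner ℂ (star S f) (T (star S f)) := by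
  rw [mul_apply_eq_comp, mul_apply_eq_comp, ContinuousLinearMap.star_eq_adjoint,
    ContinuousLinearMap.adjoint_inner_left]

/-- If a power of `S*S` has a vanishing expectation at `f`, then `S f = 0`. -/
theorem apply_eq_zero_of_inner_pow (S : L2 ι →L[ℂ] L2 ι) (m : ℕ) (f : L2 ι)
    (h : inner ℂ f (((star S * S) ^ m) f) = 0) : S f = 0 := by
  induction m using Nat.strong_induction_on with
  | _ m ih =>
    have hsa : ∀ k, star ((star S * S) ^ k) = (star S * S) ^ k := fun k =>
      ((IsSelfAdjoint.star_mul_self S).pow k).star_eq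
    -- Writing the power as `T*T` descends from `2k` to `k` and from `2k + 1` to `k + 1`.
    obtain ⟨k, rfl | rfl⟩ := Nat.even_or_odd' m
    · rw [two_mul, pow_add] at h
      nth_rewrite 1 [← hsa k] at h
      rw [inner_star_mul_self, Complex.ofReal_eq_zero, sq_eq_zero_iff, norm_eq_zero] at h
      rcases Nat.eq_zero_or_pos k with rfl | hk
      · rw [pow_zero, one_apply_eq_self] at h
        rw [h, map_zero]
      · exact ih k (by omega) (by rw [h, inner_zero_right])
    · have e : (star S * S) ^ (2 * k + 1) = star (S * (star S * S) ^ k) * (S * (star S * S) ^ k) := by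
        rw [star_mul, hsa, two_mul, add_assoc, pow_add, pow_succ']
        simp only [mul_assoc]
      rw [e, inner_star_mul_self, Complex.ofReal_eq_zero, sq_eq_zero_iff, norm_eq_zero] at h
      rcases Nat.eq_zero_or_pos k with rfl | hk
      · rwa [pow_zero, mul_one] at h
      · refine ih (k + 1) (by omega) ?_
        rw [pow_succ', mul_assoc, mul_apply_eq_comp, h, map_zero, inner_zero_right]

end DiagonalEntries

/-! ### The negative spectral projection -/

section Projection

theorem negProj_apply (f : Hq) (p : Idx) :
    negProj signDirac f p = if p.1.2.1 = p.1.1 then f p else 0 := by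
  have h : negProj signDirac f p = (1 / 2 : ℂ) * (f p - signDirac f p) := rfl
  rw [h, signDirac, signOp_apply, sign_diracEigenvalue]
  split_ifs <;> push_cast <;> ring

theorem negProj_basisVec (p : Idx) :
    negProj signDirac (basisVec p) = if p.1.2.1 = p.1.1 then basisVec p else 0 := by
  ext i
  rw [negProj_apply]
  by_cases hi : i = p
  · subst hi
    split_ifs <;> rfl
  · rw [basisVec_apply, if_neg hi, ite_self]
    split_ifs
    · rw [basisVec_apply, if_neg hi]
    · rfl

theorem negProj_mul_self : negProj signDirac * negProj signDirac = negProj signDirac :=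
  ext_basisVec fun p => by
    rw [mul_apply_eq_comp, negProj_basisVec]
    split_ifs with h
    · rw [negProj_basisVec, if_pos h]
    · rw [map_zero]

theorem commute_negProj {T : Hq →L[ℂ] Hq} (h : Commute signDirac T) :
    Commute (negProj signDirac) T :=
  ((Commute.one_left T).sub_left h).smul_left _

theorem negProj_ez (N x y : ℤ) :
    negProj signDirac (ez N x y) = if x = N then ez N x y else 0 := by
  by_cases hr : 0 ≤ x ∧ x ≤ N ∧ 0 ≤ y ∧ y ≤ N
  · refine ez_induction (P := fun N x y => negProj signDirac (ez N x y) =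
      if x = N then ez N x y else 0) (fun p => ?_) hr
    rw [ez_natCast, negProj_basisVec]
    simp
  · rw [ez_of_not hr, map_zero, ite_self]

end Projection

/-! ### The compression of `(β*β)^m` is diagonal -/

section Grading

variable (q : Set.Ioo (0 : ℝ) 1)

/-- Each term of `β*β` moves the label by a multiple of `(2, 1, 1)`. -/
theorem star_beta_mul_beta_ez_mem (N x y : ℤ) (k : ℤ) :
    (star (beta q) * beta q) (ez (N + 2 * k) (x + k) (y + k)) ∈
      Submodule.span ℂ (Set.range fun k : ℤ => ez (N + 2 * k) (x + k) (y + k)) := by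
  have hm : ∀ (l : ℤ) {N' x' y' : ℤ}, N' = N + 2 * l → x' = x + l → y' = y + l →
      ∀ z : ℂ, z • ez N' x' y' ∈
        Submodule.span ℂ (Set.range fun k : ℤ => ez (N + 2 * k) (x + k) (y + k)) := by
    rintro l _ _ _ rfl rfl rfl z
    exact Submodule.smul_mem _ _ (Submodule.subset_span ⟨l, rfl⟩)
  rw [mul_apply_eq_comp, beta_ez, map_add, map_smul, map_smul, star_beta_ez, star_beta_ez,
    smul_add, smul_add, smul_smul, smul_smul, smul_smul, smul_smul]
  refine add_mem (add_mem (hm k ?_ ?_ ?_ _) (hm (k + 1) ?_ ?_ ?_ _))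
    (add_mem (hm (k - 1) ?_ ?_ ?_ _) (hm k ?_ ?_ ?_ _)) <;> ring

theorem star_beta_mul_beta_pow_ez_mem (m : ℕ) (N x y : ℤ) :
    ((star (beta q) * beta q) ^ m) (ez N x y) ∈
      Submodule.span ℂ (Set.range fun k : ℤ => ez (N + 2 * k) (x + k) (y + k)) := by
  induction m with
  | zero => exact Submodule.subset_span ⟨0, by simp⟩
  | succ m ih =>
    rw [pow_succ', mul_apply_eq_comp]
    have : Submodule.span ℂ (Set.range fun k : ℤ => ez (N + 2 * k) (x + k) (y + k)) ≤
        (Submodule.span ℂ (Set.range fun k : ℤ => ez (N + 2 * k) (x + k) (y + k))).comap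
          (star (beta q) * beta q).toLinearMap := by
      rw [Submodule.span_le]
      rintro _ ⟨k, rfl⟩
      exact star_beta_mul_beta_ez_mem q N x y k
    exact this ih

/-- The expectation of `(β*β)^m` at a basis vector. -/
def powExpectation (m : ℕ) (p : Idx) : ℝ :=
  (inner ℂ (basisVec p) (((star (beta q) * beta q) ^ m) (basisVec p))).re

/-- A move by `k (2, 1, 1)` changes `N - x` by `k`, so only `k = 0` stays on the line `x = N`. -/
theorem negProj_pow_basisVec (m : ℕ) {p : Idx} (hp : p.1.2.1 = p.1.1) :
    negProj signDirac (((star (beta q) * beta q) ^ m) (basisVec p)) =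
      (powExpectation q m p : ℂ) • basisVec p := by
  have h1 := star_beta_mul_beta_pow_ez_mem q m p.1.1 p.1.2.1 p.1.2.2
  have h2 : Submodule.span ℂ (Set.range fun k : ℤ =>
      ez (p.1.1 + 2 * k) (p.1.2.1 + k) (p.1.2.2 + k)) ≤
      (Submodule.span ℂ {basisVec p}).comap (negProj signDirac).toLinearMap := by
    rw [Submodule.span_le]
    rintro _ ⟨k, rfl⟩
    change negProj signDirac _ ∈ Submodule.span ℂ {basisVec p}
    rw [negProj_ez]
    split_ifs with h
    · obtain rfl : k = 0 := by omega
      rw [mul_zero, add_zero, add_zero, add_zero, ez_natCast]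
      exact Submodule.mem_span_singleton_self _
    · exact zero_mem _
  obtain ⟨z, hz⟩ := Submodule.mem_span_singleton.1 (h2 h1)
  rw [ez_natCast] at hz
  have h3 := congrArg (fun f : Hq => f p) hz
  have h4 : (z • basisVec p : Hq) p = z := by
    rw [lp.coeFn_smul, Pi.smul_apply, basisVec_apply, if_pos rfl, smul_eq_mul, mul_one]
  have h5 : z = powExpectation q m p := by
    rw [powExpectation, ← apply_basisVec_eq_re ((IsSelfAdjoint.star_mul_self _).pow m)]
    refine h4.symm.trans (h3.trans ?_)
    change negProj signDirac _ p = _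
    rw [negProj_apply, if_pos hp]
  rw [← h5]
  exact hz.symm

end Grading

/-! ### Entries of the compression of `γ_r` and its index -/

section Estimates

variable (q : Set.Ioo (0 : ℝ) 1)

/-- On the line `x = N` the weight `b₋` contains the factor `1 - q^{2(N - x)} = 0`. -/
theorem beta_basisVec {p : Idx} (hp : p.1.2.1 = p.1.1) :
    beta q (basisVec p) = (bPlus q p.1.1 p.1.2.1 p.1.2.2 : ℂ) • basisVec (up 1 0 p) := by
  have h : zbMinus q p.1.1 p.1.2.1 p.1.2.2 = 0 := by
    rw [zbMinus, hp, sub_self, qsqrt_zero]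
    simp
  rw [← ez_natCast, beta_ez, h, bPlus_eq q.2, ← ez_natCast]
  simp [up]

theorem norm_beta_basisVec {p : Idx} (hp : p.1.2.1 = p.1.1) :
    ‖beta q (basisVec p)‖ = |bPlus q p.1.1 p.1.2.1 p.1.2.2| := by
  rw [beta_basisVec q hp, norm_smul, norm_basisVec, mul_one, Complex.norm_real, Real.norm_eq_abs]

theorem powExpectation_nonneg (m : ℕ) (p : Idx) : 0 ≤ powExpectation q m p :=
  re_apply_nonneg (CStarAlgebra.pow_nonneg (star_mul_self_nonneg _) m) _

theorem powExpectation_one (p : Idx) : powExpectation q 1 p = ‖beta q (basisVec p)‖ ^ 2 := by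
  rw [powExpectation, pow_one, inner_star_mul_self, Complex.ofReal_re]

theorem inner_basisVec_self (p : Idx) : (inner ℂ (basisVec p : Hq) (basisVec p)).re = 1 := by
  rw [inner_basisVec, basisVec_apply, if_pos rfl, Complex.one_re]

theorem powExpectation_le_one (m : ℕ) (p : Idx) : powExpectation q m p ≤ 1 := by
  have h := re_apply_nonneg (one_sub_pow_nonneg (star_mul_self_nonneg (beta q))
    (relations q).one_sub_nonneg m) (basisVec p)
  rw [sub_apply, inner_sub_right, Complex.sub_re, one_apply_eq_self, inner_basisVec_self] at h
  rw [powExpectation]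
  linarith

/-- Bernoulli's inequality for `β*β`, together with `1 - β*β = α*α`. -/
theorem one_sub_powExpectation_le (m : ℕ) (p : Idx) :
    1 - powExpectation q m p ≤ m * ‖alpha q (basisVec p)‖ ^ 2 := by
  have h := re_apply_le (one_sub_pow_le (star_mul_self_nonneg (beta q))
    (relations q).one_sub_nonneg m) (basisVec p)
  rw [← (relations q).star_a_a, add_sub_cancel_right, (relations q).star_a_a, sub_apply,
    inner_sub_right, Complex.sub_re, one_apply_eq_self, inner_basisVec_self,
    ← Nat.cast_smul_eq_nsmul ℂ, smul_apply, inner_smul_right, inner_star_mul_self,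
    ← Complex.ofReal_natCast, Complex.re_ofReal_mul, Complex.ofReal_re] at h
  exact h

theorem abs_bPlus_le_one {p : Idx} (hp : p.1.2.1 = p.1.1) :
    |bPlus q p.1.1 p.1.2.1 p.1.2.2| ≤ 1 := by
  have h := powExpectation_le_one q 1 p
  rw [powExpectation_one, norm_beta_basisVec q hp] at h
  exact (sq_le_one_iff₀ (abs_nonneg _)).1 h

/-- Off the corner the expectation of `(β*β)^m` is small. -/
theorem powExpectation_le (m : ℕ) {p : Idx} (hp : p.1.2.1 = p.1.1) (hc : ¬ IsCorner p) :
    powExpectation q m p ≤ (q : ℝ) ^ (2 * m) := by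
  obtain ⟨⟨N, x, y⟩, hx, hy⟩ := p
  obtain rfl : x = N := hp
  have hy0 : y ≠ 0 := fun h => hc ⟨rfl, h⟩
  obtain ⟨y, rfl⟩ := Nat.exists_eq_succ_of_ne_zero hy0
  obtain ⟨N, rfl⟩ : ∃ N, x = N + 1 := Nat.exists_eq_succ_of_ne_zero (by
    dsimp only at hy; omega)
  -- `α*` sends `e_{p'}` to a positive multiple of `e_p` alone, as the other component is out of
  -- range. Evaluating `conj_pow_le` at `e_{p'}` thus bounds the expectation at `p`.
  set p' : Idx := ⟨(N, N, y), le_rfl, by dsimp only at hy ⊢; omega⟩ with hp'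
  set p : Idx := ⟨(N + 1, N + 1, y + 1), hx, hy⟩ with hp
  have h1 : star (alpha q) (basisVec p') = (aMinus q (N + 1) (N + 1) (y + 1) : ℂ) • basisVec p := by
    have e0 : ez ((p'.1.1 : ℤ) - 1) p'.1.2.1 p'.1.2.2 = 0 :=
      ez_of_not (by rw [hp']; dsimp only; omega)
    rw [← ez_natCast, star_alpha_ez, e0, smul_zero, zero_add, ← ez_natCast, aMinus_eq q.2]
    simp [hp, hp']
  have ha : 0 < aMinus q (N + 1) (N + 1) (y + 1) := by
    have h2 := qsqrt_pos q.2 (m := (y + 1 : ℕ)) (by positivity)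
    have h3 := qsqrt_pos q.2 (m := (N + 1 : ℕ)) (by positivity)
    have h4 := qsqrt_pos q.2 (m := (N + 1 : ℕ) + 1) (by positivity)
    rw [aMinus_eq q.2, zaMinus]
    positivity
  have h2 := re_apply_le ((relations q).conj_pow_le q.2.1.le m) (basisVec p')
  have h3 := inner_mul_mul_star (alpha q) 1 (basisVec p')
  rw [mul_one, one_apply_eq_self] at h3
  rw [inner_mul_mul_star, smul_apply, inner_smul_right, h3, h1, map_smul, inner_smul_left,
    inner_smul_left, inner_smul_right, inner_smul_right, Complex.conj_ofReal,
    Complex.re_ofReal_mul, Complex.re_ofReal_mul, Complex.re_ofReal_mul, Complex.re_ofReal_mul,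
    Complex.re_ofReal_mul, inner_basisVec_self] at h2
  change _ * (_ * powExpectation q m p) ≤ _ at h2
  have h4 : aMinus q (N + 1) (N + 1) (y + 1) ^ 2 * powExpectation q m p ≤
      aMinus q (N + 1) (N + 1) (y + 1) ^ 2 * (q : ℝ) ^ (2 * m) := by linarith
  exact le_of_mul_le_mul_left h4 (by positivity)

/-- At `y = 0` the weight `a₋` vanishes, and `a₊` decays like `q^x` with `x = N`. -/
theorem norm_alpha_corner_le (N : ℕ) :
    ‖alpha q (basisVec (corner N))‖ ≤ 1 / (1 - (q : ℝ) ^ 2) * (q : ℝ) ^ N := by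
  have h : zaMinus q (corner N).1.1 (corner N).1.2.1 (corner N).1.2.2 = 0 := by
    simp [zaMinus, corner, qsqrt_zero]
  have h2 : ez (((corner N).1.1 : ℤ) + 1) (corner N).1.2.1 (corner N).1.2.2 =
      basisVec (up 0 0 (corner N)) := by
    rw [← ez_natCast]
    simp [up]
  rw [← ez_natCast, alpha_ez, h, h2, ← aPlus_eq q.2, Complex.ofReal_zero, zero_smul, add_zero,
    norm_smul, norm_basisVec, mul_one, Complex.norm_real, Real.norm_eq_abs]
  exact aPlus_le_pow q _ _ _

theorem tendsto_powExpectation_corner (m : ℕ) :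
    Filter.Tendsto (fun N => powExpectation q m (corner N)) Filter.atTop (nhds 1) := by
  have h1 := tendsto_pow_atTop_nhds_zero_of_lt_one q.2.1.le q.2.2
  have h2 := (((h1.const_mul (1 / (1 - (q : ℝ) ^ 2))).pow 2).const_mul (m : ℝ)).const_sub 1
  norm_num at h2
  refine tendsto_of_tendsto_of_tendsto_of_le_of_le h2 tendsto_const_nhds (fun N => ?_)
    fun N => powExpectation_le_one q m _
  have h3 := one_sub_powExpectation_le q m (corner N)
  have h4 : ‖alpha q (basisVec (corner N))‖ ^ 2 ≤ (1 / (1 - (q : ℝ) ^ 2) * (q : ℝ) ^ N) ^ 2 :=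
    pow_le_pow_left₀ (norm_nonneg _) (norm_alpha_corner_le q N) 2
  have h5 := mul_le_mul_of_nonneg_left h4 m.cast_nonneg
  norm_num at h5
  dsimp only
  linarith

theorem bPlus_ne_zero {p : Idx} : bPlus q p.1.1 p.1.2.1 p.1.2.2 ≠ 0 := by
  have := p.2
  have h1 := qsqrt_pos q.2 (m := p.1.1 - p.1.2.2 + 1) (by omega)
  have h2 := qsqrt_pos q.2 (m := p.1.2.1 + 1) (by omega)
  have h3 := qsqrt_pos q.2 (m := p.1.1 + 1) (by omega)
  have h4 := qsqrt_pos q.2 (m := p.1.1 + 2) (by omega)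
  have h0 := q.2.1
  rw [bPlus_eq q.2, zbPlus, neg_ne_zero]
  positivity

/-- A zero expectation would force `β e_p = 0`, contrary to `b₊ ≠ 0`. -/
theorem powExpectation_pos (m : ℕ) {p : Idx} (hp : p.1.2.1 = p.1.1) :
    0 < powExpectation q m p := by
  refine (powExpectation_nonneg q m p).lt_of_ne' fun h => ?_
  have h1 := apply_basisVec_eq_re ((IsSelfAdjoint.star_mul_self (beta q)).pow m) p
  rw [← inner_basisVec] at h1
  change _ = ((powExpectation q m p : ℝ) : ℂ) at h1
  rw [h, Complex.ofReal_zero] at h1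
  have h2 := apply_eq_zero_of_inner_pow _ m _ h1
  have h3 := norm_beta_basisVec q hp
  rw [h2, norm_zero] at h3
  exact bPlus_ne_zero q (abs_eq_zero.1 h3.symm)

/-- The subdiagonal coefficient of the compression of `γ_m`. -/
def subdiagonal (m : ℕ) (p : Idx) : ℝ :=
  bPlus q p.1.1 p.1.2.1 p.1.2.2 * powExpectation q m (up 1 0 p)

theorem tendsto_abs_subdiagonal (m : ℕ) :
    Filter.Tendsto (fun N => |subdiagonal q m (corner N)|) Filter.atTop (nhds 1) := by
  have h1 := tendsto_powExpectation_corner q 1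
  have h2 := (tendsto_powExpectation_corner q m).comp (Filter.tendsto_add_atTop_nat 1)
  have h3 := h1.sqrt.mul h2
  rw [Real.sqrt_one, one_mul] at h3
  refine h3.congr fun N => ?_
  rw [powExpectation_one, Real.sqrt_sq (norm_nonneg _), norm_beta_basisVec q rfl, subdiagonal,
    abs_mul, up_corner, abs_of_nonneg (powExpectation_nonneg q m _)]
  rfl

/-- The moduli are positive and tend to `1`, so their inverses are bounded. -/
theorem exists_le_abs_subdiagonal (m : ℕ) : ∃ δ > 0, ∀ N, δ ≤ |subdiagonal q m (corner N)| := by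
  obtain ⟨C, hC⟩ := ((tendsto_abs_subdiagonal q m).inv₀ one_ne_zero).bddAbove_range
  have h0 : ∀ N, 0 < |subdiagonal q m (corner N)| := fun N =>
    abs_pos.2 (mul_ne_zero (bPlus_ne_zero q) (powExpectation_pos q m rfl).ne')
  have hC0 : 0 < C := (inv_pos.2 (h0 0)).trans_le (hC ⟨0, rfl⟩)
  exact ⟨C⁻¹, inv_pos.2 hC0, fun N => inv_le_of_inv_le₀ (h0 N) (hC ⟨N, rfl⟩)⟩

theorem abs_subdiagonal_le (m : ℕ) {p : Idx} (hp : p.1.2.1 = p.1.1) :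
    |subdiagonal q m p| ≤ powExpectation q m (up 1 0 p) := by
  rw [subdiagonal, abs_mul, abs_of_nonneg (powExpectation_nonneg q m _)]
  exact mul_le_of_le_one_left (powExpectation_nonneg q m _) (abs_bPlus_le_one q hp)

/-- On the line `x = N` the operator `β` is a single step up the chain and `(β*β)^m` compresses to a
diagonal operator, so the compression is lower bidiagonal. -/
theorem negProj_gam_basisVec (m : ℕ) {p : Idx} (hp : p.1.2.1 = p.1.1) :
    negProj signDirac (gam q m (basisVec p)) =
      ((1 - powExpectation q m p : ℝ) : ℂ) • basisVec p +
        (subdiagonal q m p : ℂ) • basisVec (up 1 0 p) := by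
  rw [gam, add_apply, mul_apply_eq_comp, sub_apply, one_apply_eq_self, beta_basisVec q hp, map_sub,
    map_smul, map_add, map_sub, map_smul, negProj_pow_basisVec q m hp,
    negProj_pow_basisVec q m (show (up 1 0 p).1.2.1 = (up 1 0 p).1.1 by simp [up, hp]),
    negProj_basisVec, if_pos hp, subdiagonal]
  push_cast
  module

/-- Off the corners the diagonal exceeds `1/2` and dominates the subdiagonal. On the chain of
corners the diagonal tends to `0` and the subdiagonal to modulus `1`, and this chain alone
contributes the index `-1` of a unilateral shift. -/
theorem isFredholm_and_index_gam {m : ℕ} (hm : (q : ℝ) ^ (2 * m) < 1 / 2) :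
    (compression (negProj signDirac) (gam q m)).IsFredholm ∧
      fredholmIndex (compression (negProj signDirac) (gam q m)) = -1 := by
  obtain ⟨δ, hδ, hδ'⟩ := exists_le_abs_subdiagonal q m
  have hlim : Filter.Tendsto (fun N => (1 - powExpectation q m (corner N)) /
      subdiagonal q m (corner N)) Filter.atTop (nhds 0) := by
    have h := ((tendsto_powExpectation_corner q m).const_sub 1).abs.div
      (tendsto_abs_subdiagonal q m) one_ne_zero
    rw [sub_self, abs_zero, zero_div] at h
    rw [tendsto_zero_iff_abs_tendsto_zero]
    exact h.congr fun N => (abs_div _ _).symm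
  have h0 : (0 : ℝ) ≤ (q : ℝ) ^ (2 * m) := pow_nonneg q.2.1.le _
  obtain ⟨B, hB, hBV⟩ := exists_unit_mul_cornerIsometry (fun p => 1 - powExpectation q m p)
    (subdiagonal q m) h0 hm (fun p hp hc => by
      have h1 := powExpectation_le q m hp hc
      have h2 := powExpectation_nonneg q m p
      have h3 := abs_subdiagonal_le q m hp
      have h4 := powExpectation_le q m (p := up 1 0 p) (by simp [up, hp])
        (fun h => hc (isCorner_up.1 h))
      exact ⟨by linarith, abs_le.2 ⟨by linarith, by linarith⟩, h3.trans h4⟩) hδ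
    (fun N => ⟨hδ' N, (abs_subdiagonal_le q m rfl).trans (powExpectation_le_one q m _)⟩) hlim
  refine isFredholm_and_index_compression negProj_mul_self B (commute_negProj hB)
    (commute_negProj commute_signDirac_cornerIsometry) (e₀ := basisVec (corner 0))
    (φ := innerSL ℂ (basisVec (corner 0))) ?_ ?_ star_cornerIsometry_mul cornerIsometry_star_apply
    ?_ (commute_negProj commute_signDirac_star_cornerIsometry)
  · exact (negProj_basisVec _).trans (if_pos rfl)
  · refine ext_basisVec fun p => ?_
    simp only [mul_apply_eq_comp, negProj_basisVec]
    split_ifs with hp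
    · rw [negProj_gam_basisVec q m hp, cornerIsometry_basisVec, hBV p hp, map_add, map_smul,
        map_smul, negProj_basisVec, negProj_basisVec, if_pos hp, if_pos (by simp [up, hp])]
    · simp only [map_zero]
  · rw [innerSL_apply_apply, inner_basisVec, basisVec_apply, if_pos rfl]

end Estimates

end SUq

end

theorem theorem4p1 (q : Set.Ioo (0 : ℝ) 1) :
    SUq.SUqRelations (q : ℝ) (SUq.alpha q) (SUq.beta q) ∧
    SUq.IsOddSpectralTriple (SUq.Af q) SUq.dirac ∧
    SUq.IsEquivariant q SUq.dirac ∧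
    SUq.IsSummableFredholmModule (SUq.Af q) SUq.signDirac 0 ∧
    SUq.RepresentsNonzeroClass (SUq.chernCharacter (SUq.Af q) SUq.signDirac 0) ∧
    ∀ r : ℕ, (q : ℝ) ^ (2 * r) < 1 / 2 →
      SUq.gam q r ∈ SUq.Af q ∧
      (∃ g ∈ SUq.CSUq q, SUq.gam q r * g = 1 ∧ g * SUq.gam q r = 1) ∧
      (SUq.compression (SUq.negProj SUq.signDirac) (SUq.gam q r)).IsFredholm ∧
      SUq.fredholmIndex (SUq.compression (SUq.negProj SUq.signDirac) (SUq.gam q r)) = -1 := by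
  exact ⟨SUq.relations q, SUq.isOddSpectralTriple q, SUq.isEquivariant_dirac q,
    SUq.isSummableFredholmModule q, SUq.representsNonzeroClass q, fun r hr =>
      ⟨SUq.gam_mem_Af q r, SUq.exists_inverse_gam q hr, SUq.isFredholm_and_index_gam q hr⟩⟩
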